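/- In an unbiased Maker–Breaker game on the edge set of a finite graph $G$, Maker and Breaker alternately claim one unclaimed edge of $G$ each, with Maker moving first, until all edges are claimed. For a fixed tournament $T$, in the $T$-tournament game on $E(G)$ Maker also chooses one of the two orientations of every edge she claims, and she wins if at the end her oriented edges contain a copy of $T$; in the (undirected) triangle game there are no orientations and Maker wins if at the end her edges contain a triangle. A game is a Maker's win if Maker has a winning strategy, and a Breaker's win otherwise. Let $\mathcal{G}_{n,p}$ be the random graph on $n$ vertices in which each edge is present independently with probability $p$. A function $q=q(n)$ is a threshold probability for a game if for every $p=p(n)\in[0,1]$ with $p=\omega(q)$ the game on $E(\mathcal{G}_{n,p})$ is a Maker's win with probability tending to $1$ as $n\to\infty$, and for every $p=p(n)\in[0,1]$ with $p=o(q)$ it is a Breaker's win with probability tending to $1$ as $n\to\infty$. **Theorem 3.** Let $T_A$ be the acyclic (transitive) tournament and $T_C$ the cyclic tournament on three vertices. The threshold probability for the unbiased $T_A$-tournament game on $\mathcal{G}_{n,p}$ is $n^{-5/9}$, which is also the threshold probability for the unbiased undirected triangle game on $\mathcal{G}_{n,p}$. The threshold probability for the unbiased $T_C$-tournament game on $\mathcal{G}_{n,p}$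 is $n^{-8/15}$. -/

import Mathlib

open Filter Topology Asymptotics

namespace MakerBreaker

/-- The two players. -/
inductive Player
  | maker
  | breaker

/-- Elements of the board `X` that nobody has claimed yet. Maker's claims are recorded as a set `A`
of labelled claims (`el a` is the board element taken by the claim `a`; the label is, for instance,
an orientation), Breaker's claims as a set `B` of board elements. -/
def free {α β : Type*} (X : Set β) (el : α → β) (A : Set α) (B : Set β) : Set β :=
  {x | x ∈ X ∧ x ∉ el '' A ∧ x ∉ B}

/-- `ForcesWin X el Goal t A B`: in the unbiased Maker-Breaker game on the board `X`, at the
position where Maker has made the claims `A`, Breaker has claimed `B`, and it is the turn of `t`,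
Maker has a strategy that guarantees `Goal` for the set of her claims at the end of the game.
The players alternate, each turn claiming one free element, until no element is free. -/
inductive ForcesWin {α β : Type*} (X : Set β) (el : α → β) (Goal : Set α → Prop) :
    Player → Set α → Set β → Prop
  | gameOver {t : Player} {A : Set α} {B : Set β} :
      free X el A B = ∅ → Goal A → ForcesWin X el Goal t A B
  | makerMove {A : Set α} {B : Set β} (a : α) :
      el a ∈ free X el A B → ForcesWin X el Goal Player.breaker (insert a A) B →
      ForcesWin X el Goal Player.maker A B
  | breakerMove {A : Set α} {B : Set β} :
      (free X el A B).Nonempty →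
      (∀ x ∈ free X el A B, ForcesWin X el Goal Player.maker A (insert x B)) →
      ForcesWin X el Goal Player.breaker A B

/-- The digraph with arc set `A` contains a copy of the digraph `T`. -/
def ContainsCopy {V W : Type*} (T : Digraph W) (A : Set (V × V)) : Prop :=
  ∃ f : W ↪ V, ∀ i j : W, T.Adj i j → (f i, f j) ∈ A

/-- The unbiased `T`-tournament game on the edge set of `G` is a Maker's win: Maker moves first,
claiming an edge `uv` in one of the two orientations `(u, v)`, `(v, u)` at each turn, Breaker claims
(unoriented) edges, and Maker wants her oriented graph to contain a copy of `T`. The game is a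
Breaker's win if this fails. -/
def TournamentGameMakerWin {V W : Type*} (T : Digraph W) (G : SimpleGraph V) : Prop :=
  ForcesWin G.edgeSet (fun a : V × V => s(a.1, a.2)) (ContainsCopy T) Player.maker ∅ ∅

/-- The unbiased (undirected) triangle game on the edge set of `G` is a Maker's win: Maker moves
first and wants the graph formed by her edges to contain a triangle. -/
def TriangleGameMakerWin {V : Type*} (G : SimpleGraph V) : Prop :=
  ForcesWin G.edgeSet (fun e : Sym2 V => e)
    (fun A => ¬ (SimpleGraph.fromEdgeSet A).CliqueFree 3) Player.maker ∅ ∅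

/-- The acyclic (transitive) triangle `T_A`, with arcs `(0, 1)`, `(0, 2)`, `(1, 2)`. -/
def acyclicTriangle : Digraph (Fin 3) where
  Adj i j := i < j

/-- The cyclic triangle `T_C`, with arcs `(0, 1)`, `(1, 2)`, `(2, 0)`. -/
def cyclicTriangle : Digraph (Fin 3) where
  Adj i j := j = i + 1

/-- Asymptotically almost surely, the binomial random graph `G(n, p n)` has the property `P`. -/
def AAS (p : ℕ → unitInterval) (P : ∀ n : ℕ, SimpleGraph (Fin n) → Prop) : Prop :=
  Tendsto (fun n : ℕ => SimpleGraph.binomialRandom (Fin n) (p n) {G | P n G}) atTop (𝓝 1)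

/-- `q` is a threshold probability for a game, where `MakerWin n G` says that the game played on the
edge set of the graph `G` on `n` vertices is a Maker's win: for `p = ω(q)` the game on `G(n, p)` is
a.a.s. a Maker's win, and for `p = o(q)` it is a.a.s. a Breaker's win (i.e. not a Maker's win). -/
def IsThresholdProbability (MakerWin : ∀ n : ℕ, SimpleGraph (Fin n) → Prop) (q : ℕ → ℝ) : Prop :=
  (∀ p : ℕ → unitInterval, q =o[atTop] (fun n => (p n : ℝ)) → AAS p MakerWin) ∧
  (∀ p : ℕ → unitInterval, (fun n => (p n : ℝ)) =o[atTop] q → AAS p (fun n G => ¬ MakerWin n G))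

end MakerBreaker

/-! Write a threshold as n^(-a/b); here b/a is the critical edge density, 9/5 or 15/8. Above the
threshold a fixed graph of exactly this density, none of whose subgraphs is denser, appears by the
second moment method (`aas_exists_embedding`). Below it, the first moment method excludes all vertex
sets of bounded size that reach this density (`aas_forall_edgesIn_card_lt`).
`isThresholdProbability_of_density` combines the two, so only two deterministic statements about
games remain.

Maker's side: for the triangle game the critical graph is K₅ minus an edge, for the cyclic game two
four-spoke wheels that share a spoke. Maker opens with a well-chosen edge. Whatever Breaker replies,
an intact K₄ or wheel remains in which she makes threats that must be answered, until a last claim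
makes two threats at once.

Breaker's side: when Maker claims uv, grow {u, v} to a maximal S by adding vertices with at least
two neighbours in the current set (`Built`). No triangle has one edge inside S and another outside,
so S can be treated as a board of its own, and induction handles the rest
(`blocks_triangleFamily_univ`). If k counts the surplus back edges, S spans 2|S| - 3 + k edges, so
low density bounds |S| and k. For k = 0 Breaker pairs the two back edges of each added vertex. For k
= 1 his reply removes one edge at the only vertex with three back edges. Density below 9/5 forces k
≤ 1, which settles the triangle game. Density below 15/8 also allows k = 2 with |S| ≤ 7. In the
cyclic game this finite case is decided by a verified exhaustive search (`search_eq_true`,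
`Built.exists_blocks_of_two`).

The acyclic tournament game reduces to the triangle game, since Maker can orient all her edges along
a fixed linear order (`acyclic_makerWin_iff`). -/

namespace MakerBreaker

/-! ### Breaker's strategies as a calculus on families of winning sets -/

section Blocking

variable {α β : Type*}

/-- What is left of the family `𝓕` of winning sets after Maker has made the claim `a` and Breaker
has claimed `y`. -/
def residual (el : α → β) (𝓕 : Set (Set α)) (a : α) (y : β) : Set (Set α) :=
  {F' | ∃ F ∈ 𝓕, (∀ b ∈ F, b ≠ a → el b ≠ el a ∧ el b ≠ y) ∧ F' = F \ {a}}

/-- `Blocks el 𝓕`: as second player, Breaker can prevent Maker from making all the claims of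
a member of `𝓕`. -/
inductive Blocks (el : α → β) : Set (Set α) → Prop
  | move {𝓕 : Set (Set α)} (y : α → β) : ∅ ∉ 𝓕 →
      (∀ a, (∃ F ∈ 𝓕, a ∈ F) → Blocks el (residual el 𝓕 a (y a))) → Blocks el 𝓕
  | refine {𝓕 𝓖 : Set (Set α)} : Blocks el 𝓕 → (∀ G ∈ 𝓖, ∃ F ∈ 𝓕, F ⊆ G) → Blocks el 𝓖

variable {el : α → β} {𝓕 𝓖 𝓗 : Set (Set α)}

lemma Blocks.mono (h : Blocks el 𝓕) (h' : 𝓖 ⊆ 𝓕) : Blocks el 𝓖 :=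
  h.refine fun G hG => ⟨G, h' hG, subset_rfl⟩

lemma Blocks.of_forall_not_mem (h : ∀ F, F ∉ 𝓕) : Blocks el 𝓕 :=
  .move el (h _) fun _ ⟨F, hF, _⟩ => (h F hF).elim

lemma Blocks.empty_notMem (h : Blocks el 𝓕) : ∅ ∉ 𝓕 := by
  induction h with
  | move _ h _ => exact h
  | refine _ h ih =>
    intro h0
    obtain ⟨F, hF, hF0⟩ := h _ h0
    exact ih (Set.subset_empty_iff.1 hF0 ▸ hF)

/-- The constructor `move` demands replies only to claims that occur in the family. For any other
claim `el a`, which is taken already, serves as a pass. -/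
lemma Blocks.exists_reply (h : Blocks el 𝓕) (a : α) : ∃ y, Blocks el (residual el 𝓕 a y) := by
  induction h with
  | @move 𝓕 y h0 h _ =>
    by_cases ha : ∃ F ∈ 𝓕, a ∈ F
    · exact ⟨_, h a ha⟩
    · refine ⟨el a, (Blocks.move y h0 h).mono ?_⟩
      rintro _ ⟨F, hF, -, rfl⟩
      rwa [Set.sdiff_singleton_eq_self fun h => ha ⟨F, hF, h⟩]
  | @refine 𝓕 𝓖 _ h ih =>
    obtain ⟨y, hy⟩ := ih
    refine ⟨y, hy.refine ?_⟩
    rintro _ ⟨G, hG, h1, rfl⟩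
    obtain ⟨F, hF, hFG⟩ := h G hG
    exact ⟨F \ {a}, ⟨F, hF, fun b hb => h1 b (hFG hb), rfl⟩, Set.sdiff_subset_sdiff_left hFG⟩

/-- The position of Maker's claims `A` and Breaker's claims `B` is under the control of `𝓕`: every
winning set in `𝓦` either can no longer be completed, or contains a member of `𝓕` none of whose
claims has been made. -/
structure Guards (X : Set β) (el : α → β) (𝓦 𝓕 : Set (Set α)) (A : Set α) (B : Set β) : Prop where
  mem_board : ∀ a ∈ A, el a ∈ X
  dominates : ∀ W ∈ 𝓦, (∃ b ∈ W, b ∉ A ∧ el b ∉ free X el A B) ∨ ∃ F ∈ 𝓕, F ⊆ W ∧ ∀ b ∈ F, b ∉ A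

variable {X : Set β} {𝓦 : Set (Set α)} {A : Set α} {B : Set β}

lemma free_anti {B' : Set β} {A' : Set α} (h : A ⊆ A') (h' : B ⊆ B') :
    free X el A' B' ⊆ free X el A B :=
  fun _ hx => ⟨hx.1, fun hA => hx.2.1 (Set.image_mono h hA), fun hB => hx.2.2 (h' hB)⟩

lemma Guards.step (h : Guards X el 𝓦 𝓕 A B) {a : α} (ha : el a ∈ free X el A B) (y : β) :
    Guards X el 𝓦 (residual el 𝓕 a y) (insert a A) (insert y B) where
  mem_board := by
    rintro b (rfl | hb)
    · exact ha.1
    · exact h.1 b hb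
  dominates W hW := by
    obtain ⟨b, hb, hbA, hbf⟩ | ⟨F, hF, hFW, hFA⟩ := h.2 W hW
    · refine .inl ⟨b, hb, ?_, fun h => hbf (free_anti (Set.subset_insert _ _)
        (Set.subset_insert _ _) h)⟩
      rintro (rfl | h)
      exacts [hbf ha, hbA h]
    · by_cases hF' : ∀ b ∈ F, b ≠ a → el b ≠ el a ∧ el b ≠ y
      · refine .inr ⟨F \ {a}, ⟨F, hF, hF', rfl⟩, Set.sdiff_subset.trans hFW, ?_⟩
        rintro b ⟨hb, hba⟩ (h | h)
        exacts [hba h, hFA b hb h]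
      · push Not at hF'
        obtain ⟨b, hb, hba, hb'⟩ := hF'
        refine .inl ⟨b, hFW hb, ?_, ?_⟩
        · rintro (h | h)
          exacts [hba h, hFA b hb h]
        · rintro ⟨-, h1, h2⟩
          by_cases h : el b = el a
          · exact h1 ⟨a, Set.mem_insert _ _, h.symm⟩
          · exact h2 (.inl (hb' h))

lemma Guards.anti {B' : Set β} (h : Guards X el 𝓦 𝓕 A B)
    (hB : free X el A B' ⊆ free X el A B) : Guards X el 𝓦 𝓕 A B' :=
  ⟨h.1, fun W hW => (h.2 W hW).imp_left fun ⟨b, hb, hbA, hbf⟩ => ⟨b, hb, hbA, fun h => hbf (hB h)⟩⟩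

/-- Breaker maintains `Guards` with a blocked family. At the end of the game a completed winning set
would force the empty set into that family, which `Blocks` forbids. -/
theorem Blocks.not_forcesWin {Goal : Set α → Prop}
    (hGoal : ∀ A, (∀ a ∈ A, el a ∈ X) → Goal A → ∃ W ∈ 𝓦, W ⊆ A)
    (h𝓕 : Blocks el 𝓕) (hg : Guards X el 𝓦 𝓕 A B) :
    ¬ ForcesWin X el Goal Player.maker A B := by
  have hover : ∀ {A B 𝓕}, Blocks el 𝓕 → Guards X el 𝓦 𝓕 A B → ¬ Goal A := by
    intro A B 𝓕 h𝓕 hg hG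
    obtain ⟨W, hW, hWA⟩ := hGoal A hg.1 hG
    obtain ⟨b, hb, hbA, -⟩ | ⟨F, hF, hFW, hFA⟩ := hg.2 W hW
    · exact hbA (hWA hb)
    · exact h𝓕.empty_notMem ((Set.eq_empty_of_forall_notMem fun b hb =>
        hFA b hb (hWA (hFW hb))) ▸ hF)
  -- On Breaker's turn the invariant reads: it would hold once he has claimed a suitable `y`.
  suffices h : ∀ t A B, ForcesWin X el Goal t A B → ∀ 𝓕, Blocks el 𝓕 → match t with
      | .maker => ¬ Guards X el 𝓦 𝓕 A B
      | .breaker => ∀ y, ¬ Guards X el 𝓦 𝓕 A (insert y B) from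
    fun hf => h _ _ _ hf 𝓕 h𝓕 hg
  intro t A B h
  induction h with
  | @gameOver t A B _ hG =>
    intro 𝓕 h𝓕
    cases t
    · exact fun hg => hover h𝓕 hg hG
    · exact fun y hg => hover h𝓕 hg hG
  | @makerMove A B a ha _ ih =>
    intro 𝓕 h𝓕 hg
    obtain ⟨y, hy⟩ := h𝓕.exists_reply a
    exact ih _ hy y (hg.step ha y)
  | @breakerMove A B hne _ ih =>
    intro 𝓕 h𝓕 y hg
    by_cases hy : y ∈ free X el A B
    · exact ih y hy 𝓕 h𝓕 hg
    -- The prescribed reply is already taken or off the board. Breaker then claims any free element,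
    -- which cannot hurt him.
    · obtain ⟨x, hx⟩ := hne
      refine ih x hx 𝓕 h𝓕 (hg.anti fun z hz => ?_)
      have hz' := free_anti subset_rfl (Set.subset_insert _ _) hz
      exact ⟨hz'.1, hz'.2.1, by
        rintro (rfl | h)
        exacts [hy hz', hz'.2.2 h]⟩

/-- Breaker can play on two disjoint boards at a time. -/
lemma Blocks.union {X Y : Set β} (hXY : Disjoint X Y) (h𝓕 : Blocks el 𝓕) (h𝓖 : Blocks el 𝓖)
    (h : ∀ H ∈ 𝓗, (∃ F ∈ 𝓕, F ⊆ H ∧ ∀ a ∈ F, el a ∈ X) ∨ ∃ G ∈ 𝓖, G ⊆ H ∧ ∀ a ∈ G, el a ∈ Y) :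
    Blocks el 𝓗 := by
  suffices h' : Blocks el ({F ∈ 𝓕 | ∀ a ∈ F, el a ∈ X} ∪ {G ∈ 𝓖 | ∀ a ∈ G, el a ∈ Y}) by
    refine h'.refine fun H hH => ?_
    obtain ⟨F, hF, hFH, hX⟩ | ⟨F, hF, hFH, hX⟩ := h H hH
    exacts [⟨F, .inl ⟨hF, hX⟩, hFH⟩, ⟨F, .inr ⟨hF, hX⟩, hFH⟩]
  clear h
  have hd : ∀ {z}, z ∈ X → z ∉ Y := fun hx hy => Set.disjoint_left.1 hXY hx hy
  induction h𝓕 generalizing 𝓖 with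
  | @refine 𝓕₀ 𝓕 _ h ih =>
    refine (ih h𝓖).refine ?_
    rintro G (⟨hG, hGX⟩ | hG)
    · obtain ⟨F, hF, hFG⟩ := h G hG
      exact ⟨F, .inl ⟨hF, fun a ha => hGX a (hFG ha)⟩, hFG⟩
    · exact ⟨G, .inr hG, subset_rfl⟩
  | @move 𝓕 y h0 hy ih =>
    have h𝓕 := Blocks.move y h0 hy
    induction h𝓖 with
    | @refine 𝓖₀ 𝓖 _ h ih' =>
      refine ih'.refine ?_
      rintro G (hG | ⟨hG, hGX⟩)
      · exact ⟨G, .inl hG, subset_rfl⟩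
      · obtain ⟨F, hF, hFG⟩ := h G hG
        exact ⟨F, .inr ⟨hF, fun a ha => hGX a (hFG ha)⟩, hFG⟩
    | @move 𝓖 y' h0' hy' ih' =>
      classical
      refine .move (fun a => if el a ∈ X then y a else y' a) ?_ ?_
      · rintro (h | h)
        exacts [h0 h.1, h0' h.1]
      · rintro a ⟨F, hF, haF⟩
        by_cases haX : el a ∈ X
        · rw [if_pos haX]
          have haF' : ∃ F ∈ 𝓕, a ∈ F := by
            obtain hF | hF := hF
            exacts [⟨F, hF.1, haF⟩, (hd haX (hF.2 a haF)).elim]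
          refine (ih a haF' (Blocks.move y' h0' hy')).mono ?_
          rintro _ ⟨F, ⟨hF, hFX⟩ | ⟨hF, hFX⟩, h1, rfl⟩
          · exact .inl ⟨⟨F, hF, h1, rfl⟩, fun b hb => hFX b hb.1⟩
          · have : a ∉ F := fun h => hd haX (hFX a h)
            rw [Set.sdiff_singleton_eq_self this]
            exact .inr ⟨hF, hFX⟩
        · rw [if_neg haX]
          have haF' : ∃ F ∈ 𝓖, a ∈ F := by
            obtain hF | hF := hF
            exacts [(haX (hF.2 a haF)).elim, ⟨F, hF.1, haF⟩]
          refine (ih' a haF').mono ?_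
          rintro _ ⟨F, ⟨hF, hFX⟩ | ⟨hF, hFX⟩, h1, rfl⟩
          · have : a ∉ F := fun h => haX (hFX a h)
            rw [Set.sdiff_singleton_eq_self this]
            exact .inl ⟨hF, hFX⟩
          · exact .inr ⟨⟨F, hF, h1, rfl⟩, fun b hb => hFX b hb.1⟩

/-- Breaker answers the claims `a` and `b` by each other's elements. -/
lemma Blocks.claim_pair {a b : α} (hab : el a ≠ el b) (h𝓕 : Blocks el 𝓕)
    (h : ∀ H ∈ 𝓗, (a ∈ H ∧ b ∈ H) ∨ ∃ F ∈ 𝓕, F ⊆ H ∧ a ∉ F ∧ b ∉ F) : Blocks el 𝓗 := by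
  suffices h' : Blocks el ({F ∈ 𝓕 | a ∉ F ∧ b ∉ F} ∪ {{a, b}}) by
    refine h'.refine fun H hH => ?_
    obtain ⟨ha, hb⟩ | ⟨F, hF, hFH, hF'⟩ := h H hH
    · exact ⟨{a, b}, .inr rfl, by rintro x (rfl | rfl) <;> assumption⟩
    · exact ⟨F, .inl ⟨hF, hF'⟩, hFH⟩
  clear h
  induction h𝓕 with
  | @refine 𝓕₀ 𝓕 _ h ih =>
    refine ih.refine ?_
    rintro G (⟨hG, hGX⟩ | hG)
    · obtain ⟨F, hF, hFG⟩ := h G hG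
      exact ⟨F, .inl ⟨hF, fun h => hGX.1 (hFG h), fun h => hGX.2 (hFG h)⟩, hFG⟩
    · exact ⟨G, .inr hG, subset_rfl⟩
  | @move 𝓕 y h0 hy ih =>
    have h𝓕 := Blocks.move y h0 hy
    classical
    refine .move (fun c => if c = a then el b else if c = b then el a else y c) ?_ ?_
    · rintro (h | h)
      · exact h0 h.1
      · exact (h.symm ▸ (by simp : a ∈ ({a, b} : Set α)) : a ∈ (∅ : Set α))
    · rintro c ⟨F, hF, hcF⟩
      -- Once Maker claims one of the pair and Breaker takes the element of the other, the set {a,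
      -- b} is dead. No reply inside 𝓕 is needed, because its members avoid both claims and what
      -- survives is a subfamily of 𝓕.
      have key : ∀ c, (c = a ∨ c = b) → ∀ z, (c = a → z = el b) → (c = b → z = el a) →
          Blocks el (residual el ({F ∈ 𝓕 | a ∉ F ∧ b ∉ F} ∪ {{a, b}}) c z) := by
        intro c hc z hza hzb
        refine h𝓕.mono ?_
        rintro _ ⟨F, ⟨hF, haF, hbF⟩ | rfl, h1, rfl⟩
        · have : c ∉ F := by rcases hc with rfl | rfl <;> assumption
          rwa [Set.sdiff_singleton_eq_self this]
        · rcases hc with rfl | rfl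
          · exact ((h1 b (by simp) (fun h => hab (h ▸ rfl))).2 (hza rfl).symm).elim
          · exact ((h1 a (by simp) (fun h => hab (h ▸ rfl))).2 (hzb rfl).symm).elim
      by_cases hca : c = a
      · refine key c (.inl hca) _ (fun _ => if_pos hca) fun hcb => ?_
        exact (hab (by rw [← hca, hcb])).elim
      by_cases hcb : c = b
      · exact key c (.inr hcb) _ (fun h => (hca h).elim) fun _ => by rw [if_neg hca, if_pos hcb]
      rw [if_neg hca, if_neg hcb]
      have hcF' : ∃ F ∈ 𝓕, c ∈ F := by
        obtain hF | rfl := hF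
        · exact ⟨F, hF.1, hcF⟩
        · rcases hcF with h | h
          exacts [(hca h).elim, (hcb h).elim]
      refine (ih c hcF').mono ?_
      rintro _ ⟨F, ⟨hF, haF, hbF⟩ | rfl, h1, rfl⟩
      · exact .inl ⟨⟨F, hF, h1, rfl⟩, fun h => haF h.1, fun h => hbF h.1⟩
      · refine .inr (Set.sdiff_singleton_eq_self ?_)
        rintro (h | h)
        exacts [hca h, hcb h]

/-- Breaker answers each of the elements `x` and `y` by the other one. -/
lemma Blocks.pair {x y : β} (hxy : x ≠ y) (h𝓕 : Blocks el 𝓕)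
    (h : ∀ H ∈ 𝓗, (∃ a ∈ H, ∃ b ∈ H, el a = x ∧ el b = y) ∨
      ∃ F ∈ 𝓕, F ⊆ H ∧ ∀ a ∈ F, el a ≠ x ∧ el a ≠ y) : Blocks el 𝓗 := by
  have h2 : Blocks el {F | ∃ a b, F = {a, b} ∧ el a = x ∧ el b = y} := by
    classical
    refine .move (fun a => if el a = x then y else x) ?_ ?_
    · rintro ⟨a, b, h, -⟩
      exact (h ▸ (by simp : a ∈ ({a, b} : Set α)) : a ∈ (∅ : Set α))
    · rintro c ⟨F, ⟨a, b, rfl, ha, hb⟩, hc⟩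
      refine .of_forall_not_mem ?_
      rintro _ ⟨_, ⟨a', b', rfl, ha', hb'⟩, h1, rfl⟩
      have hc' : el c = x ∨ el c = y := by
        rcases hc with rfl | rfl
        exacts [.inl ha, .inr hb]
      obtain hc' | hc' := hc'
      · rw [if_pos hc'] at h1
        exact (h1 b' (by simp) (by rintro rfl; exact hxy (hc'.symm.trans hb'))).2 hb'
      · rw [if_neg (by rw [hc']; exact hxy.symm)] at h1
        exact (h1 a' (by simp) (by rintro rfl; exact hxy (ha'.symm.trans hc'))).2 ha'
  refine h𝓕.union (X := {x, y}ᶜ) (Y := {x, y}) disjoint_compl_left h2 fun H hH => ?_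
  obtain ⟨a, ha, b, hb, hax, hby⟩ | ⟨F, hF, hFH, h'⟩ := h H hH
  · refine .inr ⟨{a, b}, ⟨a, b, rfl, hax, hby⟩, ?_, ?_⟩
    · rintro z (rfl | rfl) <;> assumption
    · rintro z (rfl | rfl)
      exacts [.inl hax, .inr hby]
  · refine .inl ⟨F, hF, hFH, fun a ha => ?_⟩
    rintro (h | h)
    exacts [(h' a ha).1 h, (h' a ha).2 h]

/-- Transport of a Breaker's strategy along a map that identifies two boards. -/
lemma Blocks.image {α' β' : Type*} {el' : α' → β'} (ι : α → α') (C : Set α) (hι : Set.InjOn ι C)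
    (κ : β → β') (hel : ∀ c ∈ C, el' (ι c) = κ (el c))
    (h𝓕 : Blocks el 𝓕) : Blocks el' {G | ∃ F ∈ 𝓕, F ⊆ C ∧ G = ι '' F} := by
  induction h𝓕 with
  | @refine 𝓕₀ 𝓕 _ h ih =>
    refine ih.refine ?_
    rintro _ ⟨G, hG, hGC, rfl⟩
    obtain ⟨F, hF, hFG⟩ := h G hG
    exact ⟨ι '' F, ⟨F, hF, hFG.trans hGC, rfl⟩, Set.image_mono hFG⟩
  | @move 𝓕 y h0 hy ih =>
    -- Injectivity of ι on C makes the translated reply well defined. Claims outside ι(C) get the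
    -- dummy reply `el' a'`.
    have hinv : ∀ a', ∃ z, ∀ a ∈ C, ι a = a' → z = κ (y a) := by
      intro a'
      by_cases h : ∃ a ∈ C, ι a = a'
      · obtain ⟨a, ha, rfl⟩ := h
        exact ⟨κ (y a), fun b hb hba => by rw [hι hb ha hba]⟩
      · exact ⟨el' a', fun a ha haa => (h ⟨a, ha, haa⟩).elim⟩
    choose y' hy' using hinv
    refine .move y' ?_ ?_
    · rintro ⟨F, hF, -, h⟩
      exact h0 (Set.image_eq_empty.1 h.symm ▸ hF)
    · rintro _ ⟨_, ⟨F, hF, hFC, rfl⟩, a, ha, rfl⟩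
      refine (ih a ⟨F, hF, ha⟩).mono ?_
      rintro _ ⟨_, ⟨F', hF', hF'C, rfl⟩, h1, rfl⟩
      have haC := hFC ha
      refine ⟨F' \ {a}, ⟨F', hF', fun b hb hba => ?_, rfl⟩, Set.sdiff_subset.trans hF'C, ?_⟩
      · have := h1 _ ⟨b, hb, rfl⟩ (fun h => hba (hι (hF'C hb) haC h))
        rw [hel b (hF'C hb), hel a haC, hy' (ι a) a haC rfl] at this
        exact ⟨fun h => this.1 (by rw [h]), fun h => this.2 (by rw [h])⟩
      · ext z
        constructor
        · rintro ⟨⟨b, hb, rfl⟩, hz⟩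
          exact ⟨b, ⟨hb, fun h => hz (by rw [Set.mem_singleton_iff.1 h]; rfl)⟩, rfl⟩
        · rintro ⟨b, ⟨hb, hba⟩, rfl⟩
          exact ⟨⟨b, hb, rfl⟩, fun h => hba (hι (hF'C hb) haC h)⟩

end Blocking

/-! ### Growing vertex sets from an edge, and Breaker's local strategies -/

section Structure

variable {V α : Type*}

/-- The winning sets `{c x y, c y z, c z x}` for triangles `xyz` of `G` with vertices in `S`. Here
`c x y` stands for a claim of the edge `xy`. -/
def triangleFamily (c : V → V → α) (G : SimpleGraph V) (S : Set V) : Set (Set α) :=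
  {F | ∃ x ∈ S, ∃ y ∈ S, ∃ z ∈ S, G.Adj x y ∧ G.Adj y z ∧ G.Adj z x ∧ F = {c x y, c y z, c z x}}

variable {c : V → V → α} {G : SimpleGraph V} {S : Set V} {el : α → Sym2 V}

lemma mem_triangleFamily_diff_or (w : V) {F : Set α} (hF : F ∈ triangleFamily c G S) :
    F ∈ triangleFamily c G (S \ {w}) ∨
      ∃ y ∈ S, ∃ z ∈ S, G.Adj w y ∧ G.Adj y z ∧ G.Adj z w ∧ F = {c w y, c y z, c z w} := by
  obtain ⟨x, hx, y, hy, z, hz, hxy, hyz, hzx, rfl⟩ := hF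
  by_cases h1 : x = w
  · subst h1
    exact .inr ⟨y, hy, z, hz, hxy, hyz, hzx, rfl⟩
  by_cases h2 : y = w
  · subst h2
    refine .inr ⟨z, hz, x, hx, hyz, hzx, hxy, ?_⟩
    ext; simp; tauto
  by_cases h3 : z = w
  · subst h3
    refine .inr ⟨x, hx, y, hy, hzx, hxy, hyz, ?_⟩
    ext; simp; tauto
  exact .inl ⟨x, ⟨hx, h1⟩, y, ⟨hy, h2⟩, z, ⟨hz, h3⟩, hxy, hyz, hzx, rfl⟩

/-- After Maker has claimed `uv` and Breaker `f`, a vertex `w` other than `u` and `v` with at most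
two edges left is harmless: Breaker pairs these two edges. -/
lemma Blocks.of_diff_singleton (hel : ∀ x y, el (c x y) = s(x, y)) {u v w p q : V} {f : Sym2 V}
    (hwu : w ≠ u) (hwv : w ≠ v) (hpq : p ≠ q)
    (hw : ∀ z ∈ S, G.Adj w z → s(w, z) ≠ f → z = p ∨ z = q)
    (h : Blocks el (residual el (triangleFamily c G (S \ {w})) (c u v) f)) :
    Blocks el (residual el (triangleFamily c G S) (c u v) f) := by
  have hne : ∀ {a}, el a = s(w, p) ∨ el a = s(w, q) → w ∈ el a := by
    rintro a (h | h) <;> simp [h]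
  refine h.pair (x := s(w, p)) (y := s(w, q)) (fun h => hpq (Sym2.congr_right.1 h)) ?_
  rintro _ ⟨F, hF, h1, rfl⟩
  obtain hF | ⟨y, hy, z, hz, hwy, hyz, hzw, rfl⟩ := mem_triangleFamily_diff_or w hF
  · refine .inr ⟨F \ {c u v}, ⟨F, hF, h1, rfl⟩, subset_rfl, ?_⟩
    obtain ⟨x, hx, y, hy, z, hz, -, -, -, rfl⟩ := hF
    have hx' : w ≠ x := fun h => hx.2 h.symm
    have hy' : w ≠ y := fun h => hy.2 h.symm
    have hz' : w ≠ z := fun h => hz.2 h.symm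
    rintro a ⟨ha, -⟩
    suffices w ∉ el a from ⟨fun h => this (hne (.inl h)), fun h => this (hne (.inr h))⟩
    rcases ha with rfl | rfl | rfl <;> simp [*]
  · left
    have hwn : ∀ t, c w t ≠ c u v := fun t h => by
      have := congrArg el h
      rw [hel, hel] at this
      have h2 : w ∈ s(u, v) := this ▸ Sym2.mem_mk_left w t
      simp [hwu, hwv] at h2
    have hwn' : ∀ t, c t w ≠ c u v := fun t h => by
      have := congrArg el h
      rw [hel, hel] at this
      have h2 : w ∈ s(u, v) := this ▸ Sym2.mem_mk_right t w
      simp [hwu, hwv] at h2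
    have hy' := hw y hy hwy (by simpa [hel] using (h1 (c w y) (by simp) (hwn y)).2)
    have hz' := hw z hz hzw.symm (by
      simpa [hel, Sym2.eq_swap] using (h1 (c z w) (by simp) (hwn' z)).2)
    have hyz' := hyz.ne
    have m1 : c w y ∈ ({c w y, c y z, c z w} : Set α) \ {c u v} := ⟨by simp, hwn y⟩
    have m2 : c z w ∈ ({c w y, c y z, c z w} : Set α) \ {c u v} := ⟨by simp, hwn' z⟩
    rcases hy' with rfl | rfl
    · have : z = q := hz'.resolve_left hyz'.symm
      subst this
      exact ⟨_, m1, _, m2, by simp [hel], by rw [hel, Sym2.eq_swap]⟩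
    · have : z = p := hz'.resolve_right hyz'.symm
      subst this
      exact ⟨_, m2, _, m1, by rw [hel, Sym2.eq_swap], by simp [hel]⟩

open Classical in
/-- The edges of `G` with both ends in `S`. -/
noncomputable def edgesIn (G : SimpleGraph V) (S : Finset V) : Finset (Sym2 V) :=
  S.sym2.filter (· ∈ G.edgeSet)

open Classical in
/-- The neighbours of `w` in `S`. -/
noncomputable def neighborsIn (G : SimpleGraph V) (w : V) (S : Finset V) : Finset V :=
  S.filter (G.Adj w)

lemma mem_edgesIn {S : Finset V} {e : Sym2 V} :
    e ∈ edgesIn G S ↔ (∀ x ∈ e, x ∈ S) ∧ e ∈ G.edgeSet := by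
  simp [edgesIn, Finset.mem_sym2_iff]

lemma mem_neighborsIn {S : Finset V} {w z : V} : z ∈ neighborsIn G w S ↔ z ∈ S ∧ G.Adj w z := by
  simp [neighborsIn]

lemma edgesIn_mono_left {G' : SimpleGraph V} (h : G' ≤ G) (S : Finset V) :
    edgesIn G' S ⊆ edgesIn G S := fun e he => by
  rw [mem_edgesIn] at he ⊢
  exact ⟨he.1, SimpleGraph.edgeSet_mono h he.2⟩

lemma neighborsIn_mono {S T : Finset V} (h : S ⊆ T) (w : V) :
    neighborsIn G w S ⊆ neighborsIn G w T := fun _ hz =>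
  mem_neighborsIn.2 ⟨h (mem_neighborsIn.1 hz).1, (mem_neighborsIn.1 hz).2⟩

variable [DecidableEq V]

lemma card_edgesIn_insert {S : Finset V} {w : V} (hw : w ∉ S) :
    (edgesIn G (insert w S)).card = (edgesIn G S).card + (neighborsIn G w S).card := by
  have : edgesIn G (insert w S) = edgesIn G S ∪ (neighborsIn G w S).image (fun z => s(w, z)) := by
    ext e
    induction e with | _ x y
    simp only [mem_edgesIn, Finset.mem_union, Finset.mem_image, mem_neighborsIn, Sym2.mem_iff,
      forall_eq_or_imp, forall_eq, Finset.mem_insert, SimpleGraph.mem_edgeSet]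
    constructor
    · rintro ⟨⟨rfl | hx, rfl | hy⟩, h⟩
      · exact (h.ne rfl).elim
      · exact .inr ⟨y, ⟨hy, h⟩, rfl⟩
      · exact .inr ⟨x, ⟨hx, h.symm⟩, Sym2.eq_swap⟩
      · exact .inl ⟨⟨hx, hy⟩, h⟩
    · rintro (⟨⟨hx, hy⟩, h⟩ | ⟨z, ⟨hz, h⟩, h'⟩)
      · exact ⟨⟨.inr hx, .inr hy⟩, h⟩
      · rcases Sym2.eq_iff.1 h' with ⟨rfl, rfl⟩ | ⟨rfl, rfl⟩
        · exact ⟨⟨.inl rfl, .inr hz⟩, h⟩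
        · exact ⟨⟨.inr hz, .inl rfl⟩, h.symm⟩
  rw [this, Finset.card_union_of_disjoint, Finset.card_image_of_injective]
  · intro a b hab
    exact Sym2.congr_right.1 hab
  · rw [Finset.disjoint_left]
    intro e he he'
    obtain ⟨z, -, rfl⟩ := Finset.mem_image.1 he'
    exact hw ((mem_edgesIn.1 he).1 w (by simp))

/-- `Built G u v k S`: the vertex set `S` arises from `{u, v}` by adding vertices one by one, each
adjacent to at least two of the previous ones, and `k` is the number of edges by which the
minimum of two is exceeded on the whole. -/
inductive Built (G : SimpleGraph V) (u v : V) : ℕ → Finset V → Prop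
  | base : Built G u v 0 {u, v}
  | step {k j : ℕ} {S : Finset V} {w : V} : Built G u v k S → w ∉ S →
      (neighborsIn G w S).card = j + 2 → Built G u v (k + j) (insert w S)

namespace Built

variable {u v : V} {k : ℕ} {S : Finset V}

lemma subset (h : Built G u v k S) : {u, v} ⊆ S := by
  induction h with
  | base => rfl
  | step _ _ _ ih => exact ih.trans (Finset.subset_insert _ _)

/-- The starting pair has one edge, and each step adds one vertex together with 2 + j edges. -/
lemma card_edgesIn (huv : G.Adj u v) (h : Built G u v k S) :
    (edgesIn G S).card + 3 = 2 * S.card + k := by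
  induction h with
  | base =>
    rw [Finset.card_pair huv.ne]
    have : edgesIn G {u, v} = {s(u, v)} := by
      ext e
      induction e with | _ x y
      simp only [mem_edgesIn, Sym2.mem_iff, forall_eq_or_imp, forall_eq, Finset.mem_insert,
        Finset.mem_singleton, SimpleGraph.mem_edgeSet]
      constructor
      · rintro ⟨⟨rfl | rfl, rfl | rfl⟩, h⟩
        · exact (h.ne rfl).elim
        · rfl
        · exact Sym2.eq_swap
        · exact (h.ne rfl).elim
      · intro h
        rcases Sym2.eq_iff.1 h with ⟨rfl, rfl⟩ | ⟨rfl, rfl⟩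
        · simpa using huv
        · simpa using huv.symm
    simp [this]
  | step _ hw hd ih =>
    rw [card_edgesIn_insert hw, Finset.card_insert_of_notMem hw]
    omega

lemma two_le_card (huv : u ≠ v) (h : Built G u v k S) : 2 ≤ S.card :=
  (Finset.card_pair huv).symm.le.trans (Finset.card_le_card h.subset)

/-- A vertex that joins a set of size s has at most s back edges, hence surplus at most s - 2.
Summing over s gives the binomial coefficient of |S| - 2 over 2. -/
lemma two_mul_le (huv : u ≠ v) (h : Built G u v k S) : 2 * k ≤ (S.card - 2) * (S.card - 3) := by
  induction h with
  | base => simp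
  | @step k j S w h hw hd ih =>
    have h1 := h.two_le_card huv
    have h2 : j + 2 ≤ S.card := hd ▸ Finset.card_le_card (fun _ h => (mem_neighborsIn.1 h).1)
    rw [Finset.card_insert_of_notMem hw]
    obtain ⟨m, hm⟩ := Nat.exists_eq_add_of_le h1
    rw [hm] at ih h2 ⊢
    obtain _ | m := m
    · simp_all
    · rw [show 2 + (m + 1) - 2 = m + 1 by omega, show 2 + (m + 1) - 3 = m by omega] at ih
      rw [show 2 + (m + 1) + 1 - 2 = m + 2 by omega, show 2 + (m + 1) + 1 - 3 = m + 1 by omega]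
      nlinarith

lemma two_le_card_neighborsIn (h : Built G u v k S) {w : V} (hw : w ∈ S) (hwu : w ≠ u)
    (hwv : w ≠ v) : 2 ≤ (neighborsIn G w S).card := by
  induction h with
  | base => simp [hwu, hwv] at hw
  | @step k j S w' h hw' hd ih =>
    obtain rfl | hw := Finset.mem_insert.1 hw
    · exact (by omega : 2 ≤ j + 2).trans (hd ▸ Finset.card_le_card
        (neighborsIn_mono (Finset.subset_insert _ _) _))
    · exact (ih hw).trans (Finset.card_le_card
        (neighborsIn_mono (Finset.subset_insert _ _) _))

/-- Such a `w` already has two back neighbours when it is added, so it has surplus zero and no later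
vertex is adjacent to it. Dropping it from the construction order changes no other step. -/
lemma erase (h : Built G u v k S) {w : V} (hw : w ∈ S) (hwu : w ≠ u) (hwv : w ≠ v)
    (hd : (neighborsIn G w S).card ≤ 2) : Built G u v k (S.erase w) := by
  induction h with
  | base => simp [hwu, hwv] at hw
  | @step k j S w' h hw' hd' ih =>
    have hsub : neighborsIn G w S ⊆ neighborsIn G w (insert w' S) :=
      neighborsIn_mono (Finset.subset_insert _ _) _
    by_cases hww : w = w'
    · subst hww
      rw [Finset.erase_insert hw']
      have : j = 0 := by have := Finset.card_le_card hsub; omega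
      simpa [this] using h
    · have hwS : w ∈ S := (Finset.mem_insert.1 hw).resolve_left hww
      have h2 := h.two_le_card_neighborsIn hwS hwu hwv
      have hnadj : ¬ G.Adj w w' := fun hadj => by
        have : insert w' (neighborsIn G w S) ⊆ neighborsIn G w (insert w' S) := by
          refine Finset.insert_subset ?_ hsub
          exact mem_neighborsIn.2 ⟨Finset.mem_insert_self _ _, hadj⟩
        have := Finset.card_le_card this
        rw [Finset.card_insert_of_notMem (fun h => hw' (mem_neighborsIn.1 h).1)] at this
        omega
      rw [Finset.erase_insert_of_ne (Ne.symm hww)]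
      refine (ih hwS ((Finset.card_le_card hsub).trans hd)).step
        (fun h => hw' (Finset.mem_of_mem_erase h)) ?_
      rw [← hd']
      congr 1
      ext z
      simp only [mem_neighborsIn, Finset.mem_erase, and_congr_left_iff, and_iff_right_iff_imp]
      rintro hz - rfl
      exact hnadj hz.symm

lemma exists_maximal [Finite V] (G : SimpleGraph V) (u v : V) :
    ∃ k S, Built G u v k S ∧ ∀ w ∉ S, (neighborsIn G w S).card ≤ 1 := by
  classical
  cases nonempty_fintype V
  by_contra! hcon
  have : ∀ n, ∃ k S, Built G u v k S ∧ n ≤ S.card := by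
    intro n
    induction n with
    | zero => exact ⟨_, _, .base, Nat.zero_le _⟩
    | succ n ih =>
      obtain ⟨k, S, h, hn⟩ := ih
      obtain ⟨w, hw, hd⟩ := hcon k S h
      obtain ⟨j, hj⟩ := Nat.exists_eq_add_of_le' (show 2 ≤ (neighborsIn G w S).card from hd)
      exact ⟨_, _, h.step hw hj, by rw [Finset.card_insert_of_notMem hw]; omega⟩
  obtain ⟨k, S, -, h⟩ := this (Fintype.card V + 1)
  have := S.card_le_univ
  omega

/-- Bounded density keeps the vertex sets that can be built small. -/
lemma card_lt {a b K : ℕ} (hb : b < 2 * a) (hK : 3 * a ≤ K * (2 * a - b)) (huv : G.Adj u v)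
    (hG : ∀ S : Finset V, S.Nonempty → S.card ≤ K → a * (edgesIn G S).card < b * S.card)
    (hK2 : 2 < K) (h : Built G u v k S) : S.card < K := by
  induction h with
  | base => rwa [Finset.card_pair huv.ne]
  | @step k j S w h hw hd ih =>
    have h' := h.step hw hd
    rw [Finset.card_insert_of_notMem hw]
    -- Suppose the size reaches exactly K. The edge count 2K - 3 + k and the density bound then give
    -- (2a - b)K < 3a, contrary to `hK`.
    refine lt_of_le_of_ne ih fun hc => ?_
    have hc' := Finset.card_insert_of_notMem hw
    have h1 := hG _ (Finset.insert_nonempty w S) (by omega)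
    have h2 := h'.card_edgesIn huv
    rw [hc', hc] at h1 h2
    obtain ⟨d, hd⟩ := Nat.exists_eq_add_of_lt hb
    have : 2 * a - b = d + 1 := by omega
    rw [this] at hK
    nlinarith

end Built

variable {u v : V} {S : Finset V}

/-- The step that adds `w`: once Breaker holds `f`, at most two edges from `w` back to S matter, and
Breaker pairs them. -/
lemma Built.exists_reply_of_neighbors (hel : ∀ x y, el (c x y) = s(x, y)) {k : ℕ}
    (h : Built G u v k S) (huv : u ≠ v) {w : V} (hw : w ∉ S) {f : Sym2 V}
    (hd : ∃ N : Finset V, N.card ≤ 2 ∧ ∀ z ∈ S, G.Adj w z → s(w, z) ≠ f → z ∈ N)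
    (hB : Blocks el (residual el (triangleFamily c G S) (c u v) f)) :
    Blocks el (residual el (triangleFamily c G ↑(insert w S)) (c u v) f) := by
  obtain ⟨N, hN, hNz⟩ := hd
  -- N is padded to two distinct vertices because the pairing needs two edges. The padding by `u`,
  -- `v` has no other meaning.
  obtain ⟨p, q, hpq, hN'⟩ : ∃ p q, p ≠ q ∧ N ⊆ {p, q} := by
    obtain hN | hN | hN : N.card = 0 ∨ N.card = 1 ∨ N.card = 2 := by omega
    · exact ⟨u, v, huv, by simp [Finset.card_eq_zero.1 hN]⟩
    · obtain ⟨p, rfl⟩ := Finset.card_eq_one.1 hN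
      by_cases hpu : p = u
      · exact ⟨u, v, huv, by simp [hpu]⟩
      · exact ⟨p, u, hpu, by simp⟩
    · obtain ⟨p, q, hpq, rfl⟩ := Finset.card_eq_two.1 hN
      exact ⟨p, q, hpq, subset_rfl⟩
  have hsub := h.subset
  refine Blocks.of_diff_singleton hel (w := w) ?_ ?_ hpq ?_ ?_
  · rintro rfl
    exact hw (hsub (by simp))
  · rintro rfl
    exact hw (hsub (by simp))
  · intro z hz hwz hzf
    have hz : z ∈ S := (Finset.mem_insert.1 hz).resolve_left hwz.ne'
    simpa using hN' (hNz z hz hwz hzf)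
  · simpa [hw] using hB

/-- Every added vertex has exactly two back edges, and pairing them at each vertex blocks all
triangles. The immediate reply is not needed, hence arbitrary `f`. -/
lemma Built.blocks_of_zero (hel : ∀ x y, el (c x y) = s(x, y)) (huv : u ≠ v) {k : ℕ}
    (h : Built G u v k S) (hk : k = 0) (f : Sym2 V) :
    Blocks el (residual el (triangleFamily c G S) (c u v) f) := by
  induction h with
  | base =>
    refine .of_forall_not_mem ?_
    rintro _ ⟨_, ⟨x, hx, y, hy, z, hz, hxy, hyz, hzx, -⟩, -⟩
    simp only [Finset.coe_insert, Finset.coe_singleton, Set.mem_insert_iff,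
      Set.mem_singleton_iff] at hx hy hz
    have := hxy.ne
    have := hyz.ne
    have := hzx.ne
    grind
  | @step k j S w h hw hd ih =>
    refine h.exists_reply_of_neighbors hel huv hw ⟨neighborsIn G w S, by omega, ?_⟩
      (ih (by omega))
    exact fun z hz hwz _ => mem_neighborsIn.2 ⟨hz, hwz⟩

/-- Exactly one added vertex has three back edges. Breaker's reply takes one of them, after which
the pairing for surplus zero works at every vertex. -/
lemma Built.exists_blocks_of_one (hel : ∀ x y, el (c x y) = s(x, y)) (huv : u ≠ v) {k : ℕ}
    (h : Built G u v k S) (hk : k = 1) :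
    ∃ f, Blocks el (residual el (triangleFamily c G S) (c u v) f) := by
  induction h with
  | base => simp at hk
  | @step k j S w h hw hd ih =>
    obtain rfl | rfl : k = 1 ∨ k = 0 := by omega
    · obtain ⟨f, hf⟩ := ih rfl
      refine ⟨f, h.exists_reply_of_neighbors hel huv hw ⟨neighborsIn G w S, by omega, ?_⟩ hf⟩
      exact fun z hz hwz _ => mem_neighborsIn.2 ⟨hz, hwz⟩
    · obtain ⟨a, ha⟩ : (neighborsIn G w S).Nonempty := Finset.card_pos.1 (by omega)
      refine ⟨s(w, a), h.exists_reply_of_neighbors hel huv hw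
        ⟨(neighborsIn G w S).erase a, ?_, ?_⟩ (h.blocks_of_zero hel huv rfl _)⟩
      · rw [Finset.card_erase_of_mem ha]
        omega
      · exact fun z hz hwz hza => Finset.mem_erase.2 ⟨fun h => hza (h ▸ rfl),
          mem_neighborsIn.2 ⟨hz, hwz⟩⟩

/-- If Breaker can answer each first claim of Maker inside every vertex set built from it, then he
wins on the whole graph. -/
theorem blocks_triangleFamily_univ [Finite V] (hel : ∀ x y, el (c x y) = s(x, y))
    (G : SimpleGraph V) (hG : ∀ G' ≤ G, ∀ u v, G'.Adj u v → ∀ k S, Built G' u v k S →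
      ∃ f, Blocks el (residual el (triangleFamily c G' S) (c u v) f)) :
    Blocks el (triangleFamily c G Set.univ) := by
  induction G using WellFoundedLT.induction with
  | _ G ih =>
  have key : ∀ a, ∃ y, (∃ F ∈ triangleFamily c G Set.univ, a ∈ F) →
      Blocks el (residual el (triangleFamily c G Set.univ) a y) := by
    intro a
    by_cases ha : ∃ F ∈ triangleFamily c G Set.univ, a ∈ F
    swap
    · exact ⟨el a, fun h => (ha h).elim⟩
    obtain ⟨u, v, huv, rfl⟩ : ∃ u v, G.Adj u v ∧ a = c u v := by
      obtain ⟨_, ⟨x, -, y, -, z, -, hxy, hyz, hzx, rfl⟩, ha⟩ := ha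
      rcases ha with rfl | rfl | rfl
      exacts [⟨_, _, hxy, rfl⟩, ⟨_, _, hyz, rfl⟩, ⟨_, _, hzx, rfl⟩]
    obtain ⟨k, S, hS, hmax⟩ := Built.exists_maximal G u v
    obtain ⟨f, hf⟩ := hG G le_rfl u v huv k S hS
    have huS : u ∈ S := hS.subset (by simp)
    have hvS : v ∈ S := hS.subset (by simp)
    -- The board splits into the edges inside S, where `hf` applies, and the edges of G', where
    -- induction applies. The need to pass to G' is why the hypothesis covers all subgraphs.
    set G' := G.deleteEdges ↑(edgesIn G S) with hG'
    have hG'G : G' ≤ G := SimpleGraph.deleteEdges_le _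
    have hlt : G' < G := by
      refine lt_of_le_of_ne hG'G fun h => ?_
      have : G'.Adj u v := h ▸ huv
      rw [hG', SimpleGraph.deleteEdges_adj] at this
      exact this.2 (mem_edgesIn.2 ⟨by simp [huS, hvS], huv⟩)
    have hrest := ih G' hlt fun G'' hG'' => hG G'' (hG''.trans hG'G)
    refine ⟨f, fun _ => ?_⟩
    refine hf.union (X := {e | ∀ x ∈ e, x ∈ S}) (Y := {e | ∀ x ∈ e, x ∈ S}ᶜ) disjoint_compl_right
      hrest ?_
    rintro _ ⟨_, ⟨x, -, y, -, z, -, hxy, hyz, hzx, rfl⟩, h1, rfl⟩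
    -- By maximality a vertex outside S has at most one neighbour in S. So a triangle with one edge
    -- inside S lies entirely inside S.
    have hout : ∀ {x y z}, G.Adj x y → G.Adj y z → G.Adj z x → x ∈ S → y ∈ S → z ∈ S := by
      intro x y z hxy hyz hzx hx hy
      by_contra hz
      have : ({x, y} : Finset V) ⊆ neighborsIn G z S := by
        simp [Finset.insert_subset_iff, mem_neighborsIn, *, hyz.symm]
      have := (Finset.card_le_card this).trans (hmax z hz)
      rw [Finset.card_pair hxy.ne] at this
      omega
    by_cases hin : x ∈ S ∧ y ∈ S ∧ z ∈ S
    · refine .inl ⟨_, ⟨_, ⟨x, hin.1, y, hin.2.1, z, hin.2.2, hxy, hyz, hzx, rfl⟩, h1, rfl⟩,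
        subset_rfl, ?_⟩
      rintro a ⟨rfl | rfl | rfl, -⟩ <;> simp [hel, hin]
    · have nxy : ¬ (x ∈ S ∧ y ∈ S) := fun h => hin ⟨h.1, h.2, hout hxy hyz hzx h.1 h.2⟩
      have nyz : ¬ (y ∈ S ∧ z ∈ S) := fun h => hin ⟨hout hyz hzx hxy h.1 h.2, h.1, h.2⟩
      have nzx : ¬ (z ∈ S ∧ x ∈ S) := fun h => hin ⟨h.2, hout hzx hxy hyz h.1 h.2, h.1⟩
      have hY : ∀ a ∈ ({c x y, c y z, c z x} : Set α), ¬ ∀ x ∈ el a, x ∈ S := by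
        rintro a (rfl | rfl | rfl) <;> simp only [hel, Sym2.mem_iff, forall_eq_or_imp, forall_eq] <;>
          assumption
      refine .inr ⟨{c x y, c y z, c z x}, ⟨x, trivial, y, trivial, z, trivial, ?_, ?_, ?_, rfl⟩,
        ?_, hY⟩
      · exact SimpleGraph.deleteEdges_adj.2 ⟨hxy, fun h => nxy (by simpa using (mem_edgesIn.1 h).1)⟩
      · exact SimpleGraph.deleteEdges_adj.2 ⟨hyz, fun h => nyz (by simpa using (mem_edgesIn.1 h).1)⟩
      · exact SimpleGraph.deleteEdges_adj.2 ⟨hzx, fun h => nzx (by simpa using (mem_edgesIn.1 h).1)⟩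
      · rw [Set.sdiff_singleton_eq_self]
        exact fun h => hY _ h (by simp [hel, huS, hvS])
  choose y hy using key
  refine .move y ?_ hy
  rintro ⟨x, -, y, -, z, -, -, -, -, h⟩
  exact (h.symm ▸ (by simp : c x y ∈ ({c x y, c y z, c z x} : Set α)) : c x y ∈ (∅ : Set α))

end Structure

/-! A solver for the game on small boards, written for evaluation by the kernel: sets of arcs `ij`
with `i, j < 8` are bit masks, every intermediate number is forced to a literal, and lists are
passed on to continuations once they are evaluated. -/

namespace Solver

/-- Evaluate `n` to a literal before passing it on. -/
def force (n : ℕ) (f : ℕ → Bool) : Bool := Nat.rec (f 0) (fun k _ => f (Nat.succ k)) n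

/-- The mask of the arc from `i` to `j`. -/
def arc (i j : ℕ) : ℕ := Nat.pow 2 (Nat.add (Nat.mul 8 i) j)

/-- Compute the bits that occur in at least two of the masks. -/
def dupK (l : List ℕ) : ℕ → ℕ → (ℕ → Bool) → Bool :=
  List.rec (fun _ t k => k t)
    (fun s _ ih o t k => force (Nat.lor t (Nat.land o s)) fun t' =>
      force (Nat.lor o s) fun o' => ih o' t' k) l

def filterK (p : ℕ → Bool) (l : List ℕ) : List ℕ → (List ℕ → Bool) → Bool :=
  List.rec (fun acc k => k acc)
    (fun s _ ih acc k => Bool.rec (ih acc k) (ih (s :: acc) k) (p s)) l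

def mapK (f : ℕ → ℕ) (l : List ℕ) : List ℕ → (List ℕ → Bool) → Bool :=
  List.rec (fun acc k => k acc)
    (fun s _ ih acc k => force (f s) fun s' => ih (s' :: acc) k) l

def allK {γ : Type} (p : γ → Bool) (l : List γ) : Bool :=
  List.rec true (fun s _ ih => Bool.rec false ih (p s)) l

def anyK {γ : Type} (p : γ → Bool) (l : List γ) : Bool :=
  List.rec false (fun s _ ih => Bool.rec ih true (p s)) l

def orK (l : List ℕ) : ℕ → (ℕ → Bool) → Bool :=
  List.rec (fun t k => k t) (fun s _ ih t k => force (Nat.lor t s) fun t' => ih t' k) l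

/-- The operation x & (x - 1) clears the lowest set bit. The value 0 also passes. -/
def atMostOne (x : ℕ) : Bool := Nat.beq (Nat.land x (Nat.pred x)) 0

def isNil (l : List ℕ) : Bool := List.rec true (fun _ _ _ => false) l

/-- Discard, `n` times, all the masks with two bits that occur in no other mask. -/
def peelK (n : ℕ) : List ℕ → (List ℕ → Bool) → Bool :=
  Nat.rec (fun l k => k l) (fun _ ih l k => Bool.rec
    (dupK l 0 0 fun t =>
      filterK (fun s => atMostOne (Nat.xor s (Nat.land s t))) l [] fun l' => ih l' k)
    (k l) (isNil l)) n

/-- Breaker claims the bits in `m`. -/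
def avoidK (m : ℕ) (l : List ℕ) (k : List ℕ → Bool) : Bool :=
  filterK (fun s => Nat.beq (Nat.land s m) 0) l [] k

/-- Maker claims the arc with mask `b`, whose reverse has the mask `r`. -/
def claimK (b r : ℕ) (l : List ℕ) (k : List ℕ → Bool) : Bool :=
  avoidK r l fun l' => mapK (fun s => Nat.xor s (Nat.land s b)) l' [] k

/-- The certificate of a pairing strategy: after Breaker takes the edge `e`, peeling exhausts the
family. The bound of eight rounds affects only whether the check succeeds, not its soundness. -/
def avoidPeel (e : ℕ × ℕ) (l : List ℕ) : Bool :=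
  avoidK (Nat.lor e.1 e.2) l fun l' => peelK 8 l' isNil

/-- Breaker has an answer that leads to a pairing strategy. -/
def reply (E : List (ℕ × ℕ)) (l : List ℕ) : Bool := anyK (fun e => avoidPeel e l) E

/-- As `reply`, where Breaker has to fend off immediate threats. -/
def replyForced (E : List (ℕ × ℕ)) (l : List ℕ) : Bool :=
  filterK atMostOne l [] fun l' => orK l' 0 fun f =>
    anyK (fun e => Bool.rec false (avoidPeel e l) (Nat.beq (Nat.land f (Nat.lor e.1 e.2)) f)) E

/-- After each claim of Maker, Breaker has an answer that leads to a pairing strategy. -/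
def win (E : List (ℕ × ℕ)) (l : List ℕ) : Bool :=
  peelK 8 l fun l => orK l 0 fun s => Bool.rec false
    (allK (fun e => Bool.rec false
      (Bool.rec (claimK e.2 e.1 l (replyForced E)) true (Nat.beq (Nat.land s e.2) 0))
      (Bool.rec (claimK e.1 e.2 l (replyForced E)) true (Nat.beq (Nat.land s e.1) 0))) E)
    (allK (fun m => Bool.rec true false (atMostOne m)) l)

/-- Breaker can answer Maker's first claim, of the arc from `0` to `1`. -/
def solve (E : List (ℕ × ℕ)) (l : List ℕ) : Bool :=
  claimK (arc 0 1) (arc 1 0) l fun l =>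
    Bool.rec (anyK (fun e => avoidK (Nat.lor e.1 e.2) l (win E)) E) true (reply E l)

/-- Add the cyclic triangles through `n` when `n` becomes adjacent to the bits of `N`. -/
def newTriangles (n N : ℕ) (E : List (ℕ × ℕ)) : List ℕ → (List ℕ → Bool) → Bool :=
  List.rec (fun l k => k l) (fun e _ ih l k =>
    Bool.rec (ih l k)
     (force (Nat.lor (arc n e.1) (Nat.lor (arc e.1 e.2) (arc e.2 n))) fun t =>
      force (Nat.lor (arc n e.2) (Nat.lor (arc e.2 e.1) (arc e.1 n))) fun t' =>
        ih (t :: t' :: l) k)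
     (Bool.rec false (Nat.testBit N e.2) (Nat.testBit N e.1))) E

/-- Replace edges by pairs of opposite arcs. -/
def arcsK (E : List (ℕ × ℕ)) : (List (ℕ × ℕ) → Bool) → Bool :=
  List.rec (fun k => k []) (fun e _ ih k =>
    force (arc e.1 e.2) fun a => force (arc e.2 e.1) fun b => ih fun l => k ((a, b) :: l)) E

/-- Check `f` for all subsets of `{0, …, i - 1}` of size at most `r` as additional neighbours
of `n`. -/
def subsets (n : ℕ) (f : ℕ → ℕ → List (ℕ × ℕ) → Bool) (i : ℕ) :
    ℕ → ℕ → ℕ → List (ℕ × ℕ) → Bool :=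
  Nat.rec (fun _ c N E => f c N E) (fun i ih r c N E =>
    Bool.rec false
      (Nat.rec true (fun r _ => force (Nat.succ c) fun c' =>
        force (Nat.lor N (Nat.pow 2 i)) fun N' => ih r c' N' ((n, i) :: E)) r)
      (ih r c N E)) i

/-- Only surplus two without vertices recorded in `D` calls for a solution. Smaller surplus has a
direct strategy, and vertices of degree two are removed by pairing. -/
def leaf (k D : ℕ) (E : List (ℕ × ℕ)) (l : List ℕ) : Bool :=
  Bool.rec true (arcsK E fun A => solve A l) (Bool.rec false (Nat.beq D 0) (Nat.beq k 2))

/-- Check all the graphs that arise by adding up to `fuel` vertices one by one to the graph on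
`{0, …, n - 1}` with edges `E` and cyclic triangles `l`. The excess is `k`, and `D` contains the
vertices of degree two. -/
def search (fuel : ℕ) : ℕ → ℕ → ℕ → List (ℕ × ℕ) → List ℕ → Bool :=
  Nat.rec (fun _ k D E l => leaf k D E l)
   (fun _ ih n k D E l => Bool.rec false
     (subsets n (fun c N E' => Bool.rec true
       (newTriangles n N E l fun l' => force (Nat.sub (Nat.add k c) 2) fun k' =>
         force (Nat.lor (Nat.xor D (Nat.land D N))
           (Bool.rec 0 (Nat.pow 2 n) (Nat.beq c 2))) fun D' =>
         force (Nat.succ n) fun n' => ih n' k' D' E' l') (Nat.ble 2 c)) n (Nat.sub 4 k) 0 0 E)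
     (leaf k D E l)) fuel

-- The finite computation behind surplus two. The initial graph is the single edge on {0, 1}, and
-- five further vertices give the seven that the density bound allows.
set_option maxHeartbeats 0 in
theorem search_eq_true : search 5 2 0 0 [(1, 0)] [] = true := by decide +kernel


/-! ### Soundness of the solver -/

lemma force_eq (n : ℕ) (f : ℕ → Bool) : force n f = f n := by cases n <;> rfl

lemma boolRec_false {a b : Bool} : (Bool.rec false b a : Bool) = (a && b) := by cases a <;> rfl

lemma boolRec_true {a b : Bool} : (Bool.rec b true a : Bool) = (a || b) := by cases a <;> rfl

lemma filterK_eq (p : ℕ → Bool) (l acc : List ℕ) (k : List ℕ → Bool) :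
    filterK p l acc k = k ((l.filter p).reverse ++ acc) := by
  induction l generalizing acc with
  | nil => rfl
  | cons s l ih =>
    change @Bool.rec (fun _ => Bool) (filterK p l acc k) (filterK p l (s :: acc) k) (p s) = _
    cases h : p s <;> simp [h, ih]

lemma mapK_eq (f : ℕ → ℕ) (l acc : List ℕ) (k : List ℕ → Bool) :
    mapK f l acc k = k ((l.map f).reverse ++ acc) := by
  induction l generalizing acc with
  | nil => rfl
  | cons s l ih =>
    change force (f s) (fun s' => mapK f l (s' :: acc) k) = _
    simp [force_eq, ih]

lemma allK_eq {γ : Type} (p : γ → Bool) (l : List γ) : allK p l = l.all p := by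
  induction l with
  | nil => rfl
  | cons s l ih =>
    change @Bool.rec (fun _ => Bool) false (allK p l) (p s) = _
    rw [boolRec_false, ih, List.all_cons]

lemma anyK_eq {γ : Type} (p : γ → Bool) (l : List γ) : anyK p l = l.any p := by
  induction l with
  | nil => rfl
  | cons s l ih =>
    change @Bool.rec (fun _ => Bool) (anyK p l) true (p s) = _
    rw [boolRec_true, ih, List.any_cons]

lemma orK_eq (l : List ℕ) (t : ℕ) (k : ℕ → Bool) : orK l t k = k (l.foldl Nat.lor t) := by
  induction l generalizing t with
  | nil => rfl
  | cons s l ih =>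
    change force (Nat.lor t s) (fun t' => orK l t' k) = _
    simp [force_eq, ih]

lemma testBit_foldl_lor {l : List ℕ} {t i : ℕ} :
    (l.foldl Nat.lor t).testBit i = true ↔ t.testBit i = true ∨ ∃ m ∈ l, m.testBit i = true := by
  induction l generalizing t with
  | nil => simp
  | cons s l ih =>
    rw [List.foldl_cons, ih]
    change (t ||| s).testBit i = true ∨ _ ↔ _
    simp [Nat.testBit_or, or_assoc]

/-- The bits that occur in at least two of the masks. -/
def dup : List ℕ → ℕ → ℕ → ℕ
  | [], _, t => t
  | s :: l, o, t => dup l (o ||| s) (t ||| (o &&& s))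

lemma dupK_eq (l : List ℕ) (o t : ℕ) (k : ℕ → Bool) : dupK l o t k = k (dup l o t) := by
  induction l generalizing o t with
  | nil => rfl
  | cons s l ih =>
    change force (Nat.lor t (Nat.land o s)) (fun t' => force (Nat.lor o s) fun o' =>
      dupK l o' t' k) = _
    rw [force_eq, force_eq, ih]
    rfl

/-- Here `o` accumulates the bits seen so far and `t` the repeated ones. A bit absent from the
result is therefore private to at most one mask of the list. -/
lemma dup_spec {l : List ℕ} {o t i : ℕ} (h : (dup l o t).testBit i = false) :
    t.testBit i = false ∧ (o.testBit i = true → ∀ s ∈ l, s.testBit i = false) ∧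
      l.Pairwise fun s s' => s.testBit i = true → s'.testBit i = false := by
  induction l generalizing o t with
  | nil => simpa [dup] using h
  | cons s l ih =>
    obtain ⟨h1, h2, h3⟩ := ih (o := o ||| s) (t := t ||| (o &&& s)) h
    simp only [Nat.testBit_or, Nat.testBit_and, Bool.or_eq_false_iff, Bool.and_eq_false_iff,
      Bool.or_eq_true] at h1 h2
    refine ⟨h1.1, fun ho => ?_, List.pairwise_cons.2 ⟨fun s' hs' hs => h2 (.inr hs) s' hs', h3⟩⟩
    simp only [List.mem_cons, forall_eq_or_imp]
    exact ⟨h1.2.resolve_left (by simp [ho]), fun s' hs' => h2 (.inl ho) s' hs'⟩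

/-- Take a bit j of x & (x - 1). If it were the only bit of x, then x = 2^j, and x - 1 would not
contain j. -/
lemma exists_two_bits {x : ℕ} (h : atMostOne x = false) :
    ∃ i j, i ≠ j ∧ x.testBit i = true ∧ x.testBit j = true := by
  have h0 : x &&& (x - 1) ≠ 0 := fun h0 => by
    rw [show atMostOne x = Nat.beq (x &&& (x - 1)) 0 from rfl, h0] at h
    exact absurd h (by decide)
  obtain ⟨j, hj⟩ := Nat.exists_testBit_of_ne_zero h0
  rw [Nat.testBit_and, Bool.and_eq_true] at hj
  by_contra! hcon
  have hx : x = 2 ^ j := Nat.eq_of_testBit_eq fun i => by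
    rw [Nat.testBit_two_pow]
    by_cases hij : j = i
    · subst hij; simpa using hj.1
    · have := hcon j i hij hj.1
      simpa [hij] using this
  have := hj.2
  rw [hx, Nat.testBit_two_pow_sub_one] at this
  simp at this

/-- The element of the board that is claimed by the arc with number `c`. -/
def elem (c : ℕ) : Sym2 ℕ := s(c / 8, c % 8)

def bits (m : ℕ) : Set ℕ := {i | m.testBit i = true}

/-- The family of sets encoded by a list of masks. -/
def fam (l : List ℕ) : Set (Set ℕ) := {F | ∃ m ∈ l, F = bits m}

/-- No mask contains two arcs with the same ends. -/
def Proper (l : List ℕ) : Prop := ∀ m ∈ l, Set.InjOn elem (bits m)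

lemma Proper.mono {l l' : List ℕ} (h : Proper l) (h' : ∀ m ∈ l', ∃ m' ∈ l, bits m ⊆ bits m') :
    Proper l' := fun m hm => by
  obtain ⟨m', hm', hs⟩ := h' m hm
  exact (h m' hm').mono hs

/-- The rejected masks are discarded in one go, each by a pair of claims private to it. The family 𝓚
carries the accepted masks already passed in the induction, so that the private pairs are known to
avoid them as well. -/
lemma blocks_of_filter {l : List ℕ} {p : ℕ → Bool} {𝓚 : Set (Set ℕ)}
    (hl : ∀ s ∈ l, p s = false → ∃ a b, elem a ≠ elem b ∧ a ∈ bits s ∧ b ∈ bits s ∧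
      (∀ F ∈ 𝓚, a ∉ F ∧ b ∉ F) ∧
      (l.Pairwise fun s s' => s.testBit a = true → s'.testBit a = false) ∧
      (l.Pairwise fun s s' => s.testBit b = true → s'.testBit b = false))
    (h : Blocks elem (𝓚 ∪ fam (l.filter p))) : Blocks elem (𝓚 ∪ fam l) := by
  induction l generalizing 𝓚 with
  | nil => exact h
  | cons s l ih =>
    cases hs : p s with
    | true =>
      have h' : Blocks elem ((𝓚 ∪ {bits s}) ∪ fam (l.filter p)) := by
        refine h.mono ?_
        rintro F ((hF | rfl) | ⟨m, hm, rfl⟩)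
        · exact .inl hF
        · exact .inr ⟨s, by simp [hs], rfl⟩
        · exact .inr ⟨m, by simp only [List.filter_cons, hs, if_true]; exact .tail _ hm, rfl⟩
      refine (ih (fun s' hs' hp => ?_) h').mono ?_
      · obtain ⟨a, b, hab, ha, hb, h𝓚, h1, h2⟩ := hl s' (.tail _ hs') hp
        rw [List.pairwise_cons] at h1 h2
        refine ⟨a, b, hab, ha, hb, ?_, h1.2, h2.2⟩
        rintro F (hF | rfl)
        · exact h𝓚 F hF
        · refine ⟨fun h => ?_, fun h => ?_⟩
          · exact absurd ha (by simpa [bits] using h1.1 s' hs' h)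
          · exact absurd hb (by simpa [bits] using h2.1 s' hs' h)
      · rintro F (hF | ⟨m, hm, rfl⟩)
        · exact .inl (.inl hF)
        · obtain rfl | hm := List.mem_cons.1 hm
          · exact .inl (.inr rfl)
          · exact .inr ⟨m, hm, rfl⟩
    | false =>
      rw [List.filter_cons, hs, if_neg (by simp)] at h
      have h' := ih (fun s' hs' hp => by
        obtain ⟨a, b, hab, ha, hb, h𝓚, h1, h2⟩ := hl s' (.tail _ hs') hp
        exact ⟨a, b, hab, ha, hb, h𝓚, (List.pairwise_cons.1 h1).2, (List.pairwise_cons.1 h2).2⟩) h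
      obtain ⟨a, b, hab, ha, hb, h𝓚, h1, h2⟩ := hl s (.head _) hs
      rw [List.pairwise_cons] at h1 h2
      refine h'.claim_pair hab fun H hH => ?_
      rcases hH with hH | ⟨m, hm, rfl⟩
      · exact .inr ⟨H, .inl hH, subset_rfl, h𝓚 H hH⟩
      · obtain rfl | hm := List.mem_cons.1 hm
        · exact .inl ⟨ha, hb⟩
        · refine .inr ⟨_, .inr ⟨m, hm, rfl⟩, subset_rfl, ?_, ?_⟩
          · simpa [bits] using h1.1 m hm ha
          · simpa [bits] using h2.1 m hm hb

lemma fam_congr {l l' : List ℕ} (h : ∀ m, m ∈ l ↔ m ∈ l') : fam l = fam l' := by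
  ext F; simp [fam, h]

/-- A mask is discarded when two of its bits occur in no other mask. Properness puts these bits on
different edges, so `Blocks.claim_pair` applies. -/
lemma peelK_spec {n : ℕ} {l : List ℕ} {k : List ℕ → Bool} (h : peelK n l k = true)
    (hl : Proper l) : ∃ l', k l' = true ∧ (∀ m ∈ l', m ∈ l) ∧
      (Blocks elem (fam l') → Blocks elem (fam l)) := by
  induction n generalizing l with
  | zero => exact ⟨l, h, fun _ => id, id⟩
  | succ n ih =>
    change @Bool.rec (fun _ => Bool) (dupK l 0 0 fun t =>
      filterK (fun s => atMostOne (Nat.xor s (Nat.land s t))) l [] fun l' => peelK n l' k)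
      (k l) (isNil l) = true at h
    cases hn : isNil l with
    | true =>
      rw [hn] at h
      exact ⟨l, h, fun _ => id, id⟩
    | false =>
      rw [hn] at h
      simp only [dupK_eq, filterK_eq] at h
      set t := dup l 0 0 with ht
      set p : ℕ → Bool := fun s => atMostOne (Nat.xor s (Nat.land s t)) with hp
      have hsub : ∀ m ∈ (l.filter p).reverse ++ [], m ∈ l := fun m hm => by
        simp only [List.append_nil, List.mem_reverse, List.mem_filter] at hm
        exact hm.1
      obtain ⟨l', hk, hl', hB⟩ := ih h (hl.mono fun m hm => ⟨m, hsub m hm, subset_rfl⟩)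
      refine ⟨l', hk, fun m hm => hsub m (hl' m hm), fun hl'' => ?_⟩
      have hB' := hB hl''
      rw [fam_congr (l' := l.filter p) (by simp)] at hB'
      rw [← Set.empty_union (fam l)]
      refine blocks_of_filter (p := p) (fun s hs hps => ?_) (by rwa [Set.empty_union])
      obtain ⟨a, b, hab, ha, hb⟩ := exists_two_bits hps
      change (s ^^^ (s &&& t)).testBit a = true at ha
      change (s ^^^ (s &&& t)).testBit b = true at hb
      have key : ∀ c, (s ^^^ (s &&& t)).testBit c = true → c ∈ bits s ∧ t.testBit c = false := by
        intro c hc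
        rw [Nat.testBit_xor, Nat.testBit_and] at hc
        cases h1 : s.testBit c <;> cases h2 : t.testBit c <;> simp_all [bits]
      exact ⟨a, b, fun h => hab (hl s hs (key a ha).1 (key b hb).1 h), (key a ha).1, (key b hb).1,
        by simp, (dup_spec (key a ha).2).2.2, (dup_spec (key b hb).2).2.2⟩

lemma blocks_fam_nil : Blocks elem (fam []) := .of_forall_not_mem (by simp [fam])

/-- `E` consists of the pairs of masks of opposite arcs. -/
def IsArcs (E : List (ℕ × ℕ)) : Prop :=
  ∀ e ∈ E, ∃ i j, i < 8 ∧ j < 8 ∧ i ≠ j ∧ e = (arc i j, arc j i)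

/-- All bits of masks in `l` belong to the arcs in `E`. -/
def Covers (E : List (ℕ × ℕ)) (l : List ℕ) : Prop :=
  ∀ m ∈ l, ∀ c ∈ bits m, ∃ e ∈ E, e.1 = 2 ^ c ∨ e.2 = 2 ^ c

lemma testBit_arc {i j c : ℕ} : (arc i j).testBit c = true ↔ c = 8 * i + j := by
  change (2 ^ (8 * i + j)).testBit c = true ↔ _
  rw [Nat.testBit_two_pow]
  simp [eq_comm]

lemma elem_arc {i j : ℕ} (hj : j < 8) : elem (8 * i + j) = s(i, j) := by
  rw [elem, show (8 * i + j) / 8 = i by omega, show (8 * i + j) % 8 = j by omega]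

lemma land_eq_zero {s m : ℕ} (h : ∀ c, s.testBit c = true → m.testBit c = true → False) :
    Nat.beq (Nat.land s m) 0 = true := by
  have : s &&& m = 0 := Nat.eq_of_testBit_eq fun c => by
    rw [Nat.testBit_and, Nat.zero_testBit]
    cases h1 : s.testBit c <;> cases h2 : m.testBit c <;> simp_all
  change Nat.beq (s &&& m) 0 = true
  rw [this]; rfl

/-- The masks left when Maker has claimed the arc with mask `b` and reverse `r`. -/
def claimed (b r : ℕ) (l : List ℕ) : List ℕ :=
  (l.filter fun s => Nat.beq (Nat.land s r) 0).map fun s => s ^^^ (s &&& b)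

/-- The masks left when Breaker has claimed the bits in `m`. -/
def avoiding (m : ℕ) (l : List ℕ) : List ℕ := l.filter fun s => Nat.beq (Nat.land s m) 0

lemma bits_xor_land_arc (s i j : ℕ) : bits (s ^^^ (s &&& arc i j)) = bits s \ {8 * i + j} := by
  ext c
  simp only [bits, Set.mem_ofPred_eq, Nat.testBit_xor, Nat.testBit_and, Set.mem_sdiff,
    Set.mem_singleton_iff, ← testBit_arc]
  cases s.testBit c <;> cases (arc i j).testBit c <;> simp

/-- Besides Maker's arc, only its reverse lies on the same edge, so removing masks with that reverse
captures the effect of her claim. Breaker's edge removes both orientations. -/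
lemma residual_fam_subset {i j p q : ℕ} (hi : i < 8) (hj : j < 8) (hij : i ≠ j) (hp : p < 8)
    (hq : q < 8) (l : List ℕ) : residual elem (fam l) (8 * i + j) s(p, q) ⊆
      fam (avoiding (arc p q ||| arc q p) (claimed (arc i j) (arc j i) l)) := by
  rintro _ ⟨_, ⟨m, hm, rfl⟩, h1, rfl⟩
  refine ⟨m ^^^ (m &&& arc i j), ?_, (bits_xor_land_arc m i j).symm⟩
  simp only [avoiding, claimed, List.mem_filter, List.mem_map]
  refine ⟨⟨m, ⟨hm, land_eq_zero fun c hc hc' => ?_⟩, rfl⟩, land_eq_zero fun c hc hc' => ?_⟩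
  · rw [testBit_arc] at hc'
    refine (h1 c hc (by omega)).1 ?_
    rw [hc', elem_arc hi, elem_arc hj, Sym2.eq_swap]
  · have hc2 : c ∈ bits m \ {8 * i + j} := bits_xor_land_arc m i j ▸ hc
    rw [Nat.testBit_or, Bool.or_eq_true, testBit_arc, testBit_arc] at hc'
    refine (h1 c hc2.1 hc2.2).2 ?_
    rcases hc' with rfl | rfl
    · exact elem_arc hq
    · rw [elem_arc hp, Sym2.eq_swap]

lemma avoidPeel_spec {e : ℕ × ℕ} {l : List ℕ} (h : avoidPeel e l = true) (hl : Proper l) :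
    Blocks elem (fam (avoiding (e.1 ||| e.2) l)) := by
  rw [avoidPeel, avoidK, filterK_eq] at h
  obtain ⟨l', hk, -, hB⟩ := peelK_spec h (hl.mono fun m hm => by
    simp only [List.append_nil, List.mem_reverse, List.mem_filter] at hm
    exact ⟨m, hm.1, subset_rfl⟩)
  obtain rfl : l' = [] := by
    cases l' with
    | nil => rfl
    | cons => simp [isNil] at hk
  rw [fam_congr (l' := (avoiding (e.1 ||| e.2) l).reverse ++ []) (by simp)]
  exact hB blocks_fam_nil

lemma claimK_spec {b r : ℕ} {l : List ℕ} {k : List ℕ → Bool} (h : claimK b r l k = true) :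
    ∃ l', k l' = true ∧ ∀ m, m ∈ l' ↔ m ∈ claimed b r l := by
  rw [claimK, avoidK, filterK_eq, mapK_eq] at h
  refine ⟨_, h, fun m => ?_⟩
  simp only [claimed, List.append_nil, List.mem_reverse, List.mem_map]
  rfl

lemma Proper.claimed {l : List ℕ} (hl : Proper l) {i j : ℕ} (r : ℕ) :
    Proper (claimed (arc i j) r l) := by
  refine hl.mono fun m hm => ?_
  obtain ⟨m', hm', rfl⟩ := List.mem_map.1 hm
  exact ⟨m', (List.mem_filter.1 hm').1, by rw [bits_xor_land_arc]; exact Set.sdiff_subset⟩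

lemma avoiding_congr {l l' : List ℕ} (h : ∀ m, m ∈ l ↔ m ∈ l') (s : ℕ) :
    ∀ m, m ∈ avoiding s l ↔ m ∈ avoiding s l' := by
  simp [avoiding, h]

/-- The threat test only prunes the candidates; soundness rests on the pairing certificate alone. -/
lemma replyForced_spec {E : List (ℕ × ℕ)} {l : List ℕ} (h : replyForced E l = true)
    (hl : Proper l) : ∃ e ∈ E, Blocks elem (fam (avoiding (e.1 ||| e.2) l)) := by
  rw [replyForced, filterK_eq, orK_eq, anyK_eq, List.any_eq_true] at h
  obtain ⟨e, he, h⟩ := h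
  rw [boolRec_false, Bool.and_eq_true] at h
  exact ⟨e, he, avoidPeel_spec h.2 hl⟩

lemma reply_spec {E : List (ℕ × ℕ)} {l : List ℕ} (h : reply E l = true)
    (hl : Proper l) : ∃ e ∈ E, Blocks elem (fam (avoiding (e.1 ||| e.2) l)) := by
  rw [reply, anyK_eq, List.any_eq_true] at h
  obtain ⟨e, he, h⟩ := h
  exact ⟨e, he, avoidPeel_spec h hl⟩

lemma exists_blocks_residual {E : List (ℕ × ℕ)} {l : List ℕ} (hE : IsArcs E) {i j : ℕ}
    (hi : i < 8) (hj : j < 8) (hij : i ≠ j) (hl : Proper l)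
    (h : claimK (arc i j) (arc j i) l (replyForced E) = true) :
    ∃ y, Blocks elem (residual elem (fam l) (8 * i + j) y) := by
  obtain ⟨l', hk, hm⟩ := claimK_spec h
  obtain ⟨e, he, hB⟩ := replyForced_spec hk
    ((hl.claimed (i := i) (j := j) (arc j i)).mono fun m h => ⟨m, (hm m).1 h, subset_rfl⟩)
  obtain ⟨p, q, hp, hq, -, rfl⟩ := hE e he
  rw [fam_congr (avoiding_congr hm _)] at hB
  exact ⟨_, hB.mono (residual_fam_subset hi hj hij hp hq l)⟩

lemma win_spec {E : List (ℕ × ℕ)} {l : List ℕ} (hE : IsArcs E) (hl : Proper l)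
    (hc : Covers E l) (h : win E l = true) : Blocks elem (fam l) := by
  obtain ⟨l₁, h, hsub, hB⟩ := peelK_spec h hl
  refine hB ?_
  have hl₁ : Proper l₁ := hl.mono fun m hm => ⟨m, hsub m hm, subset_rfl⟩
  rw [orK_eq, boolRec_false, Bool.and_eq_true, allK_eq, allK_eq, List.all_eq_true,
    List.all_eq_true] at h
  obtain ⟨hone, hall⟩ := h
  have key : ∀ a, ∃ y, (∃ F ∈ fam l₁, a ∈ F) → Blocks elem (residual elem (fam l₁) a y) := by
    intro a
    by_cases ha : ∃ F ∈ fam l₁, a ∈ F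
    swap
    · exact ⟨elem a, fun h => (ha h).elim⟩
    obtain ⟨_, ⟨m, hm, rfl⟩, ha⟩ := ha
    obtain ⟨e, he, hea⟩ := hc m (hsub m hm) a ha
    obtain ⟨i, j, hi, hj, hij, rfl⟩ := hE e he
    have hthis := hall _ he
    rw [boolRec_false, Bool.and_eq_true, boolRec_true, boolRec_true, Bool.or_eq_true,
      Bool.or_eq_true] at hthis
    -- The check skips arcs that occur in no mask. Since `a` occurs in `m`, its arc was not skipped.
    have hsupp : ∀ {i j}, arc i j = 2 ^ a →
        Nat.beq (Nat.land (l₁.foldl Nat.lor 0) (arc i j)) 0 = true → False := by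
      intro i j hij h
      have h0 : l₁.foldl Nat.lor 0 &&& arc i j = 0 := Nat.eq_of_beq_eq_true h
      have : (l₁.foldl Nat.lor 0 &&& arc i j).testBit a = true := by
        rw [Nat.testBit_and, Bool.and_eq_true]
        exact ⟨testBit_foldl_lor.2 (.inr ⟨m, hm, ha⟩), by rw [hij, Nat.testBit_two_pow_self]⟩
      rw [h0] at this
      simp at this
    have hinj : ∀ {i j}, arc i j = 2 ^ a → 8 * i + j = a := fun h =>
      Nat.pow_right_injective le_rfl h
    rcases hea with hea | hea
    · obtain ⟨y, hy⟩ := exists_blocks_residual hE hi hj hij hl₁ (hthis.1.resolve_left (hsupp hea))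
      exact ⟨y, fun _ => hinj hea ▸ hy⟩
    · obtain ⟨y, hy⟩ := exists_blocks_residual hE hj hi hij.symm hl₁
        (hthis.2.resolve_left (hsupp hea))
      exact ⟨y, fun _ => hinj hea ▸ hy⟩
  choose y hy using key
  refine .move y ?_ hy
  rintro ⟨m, hm, h0⟩
  -- All masks left after peeling were checked to have at least two bits, so none encodes the empty
  -- set.
  have h1 := hone m hm
  have hm0 : m = 0 := Nat.eq_of_testBit_eq fun c => by
    rw [Nat.zero_testBit, Bool.eq_false_iff]
    intro hc
    exact (h0 ▸ (hc : c ∈ bits m) : c ∈ (∅ : Set ℕ))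
  subst hm0
  exact absurd h1 (by decide)

lemma solve_spec {E : List (ℕ × ℕ)} {l : List ℕ} (hE : IsArcs E) (hl : Proper l)
    (hc : Covers E l) (h : solve E l = true) :
    ∃ e ∈ E, Blocks elem (fam (avoiding (e.1 ||| e.2) (claimed (arc 0 1) (arc 1 0) l))) := by
  obtain ⟨l', hk, hm⟩ := claimK_spec h
  have hl' : Proper l' :=
    (hl.claimed (i := 0) (j := 1) (arc 1 0)).mono fun m h => ⟨m, (hm m).1 h, subset_rfl⟩
  rw [boolRec_true, Bool.or_eq_true] at hk
  rcases hk with hk | hk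
  · obtain ⟨e, he, hB⟩ := reply_spec hk hl'
    exact ⟨e, he, by rwa [fam_congr (avoiding_congr hm _)] at hB⟩
  · rw [anyK_eq, List.any_eq_true] at hk
    obtain ⟨e, he, hw⟩ := hk
    refine ⟨e, he, ?_⟩
    rw [avoidK, filterK_eq] at hw
    have hsub : ∀ m, m ∈ (l'.filter fun s => Nat.beq (Nat.land s (Nat.lor e.1 e.2)) 0).reverse ++ []
        ↔ m ∈ avoiding (e.1 ||| e.2) (claimed (arc 0 1) (arc 1 0) l) := fun m => by
      rw [← avoiding_congr hm]
      simp only [List.append_nil, List.mem_reverse]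
      rfl
    have hsub' : ∀ m ∈ (l'.filter fun s => Nat.beq (Nat.land s (Nat.lor e.1 e.2)) 0).reverse ++ [],
        m ∈ l' := fun m hm => by
      simp only [List.append_nil, List.mem_reverse, List.mem_filter] at hm
      exact hm.1
    rw [← fam_congr hsub]
    refine win_spec hE (hl'.mono fun m hm => ⟨m, hsub' m hm, subset_rfl⟩) ?_ hw
    intro m hm' c hcm
    obtain ⟨m₁, hm₁, rfl⟩ := List.mem_map.1 ((hm m).1 (hsub' m hm'))
    rw [bits_xor_land_arc] at hcm
    exact hc m₁ (List.mem_filter.1 hm₁).1 c hcm.1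


/-! ### Completeness of the search -/

lemma subsets_spec {n : ℕ} {f : ℕ → ℕ → List (ℕ × ℕ) → Bool} {i r c N : ℕ} {E : List (ℕ × ℕ)}
    (h : subsets n f i r c N E = true) {T : Finset ℕ} (hT : ∀ t ∈ T, t < i) (hr : T.card ≤ r) :
    ∃ N' E', f (c + T.card) N' E' = true ∧
      (∀ t, N'.testBit t = true ↔ N.testBit t = true ∨ t ∈ T) ∧
      ∀ e, e ∈ E' ↔ e ∈ E ∨ ∃ t ∈ T, e = (n, t) := by
  induction i generalizing r c N E T with
  | zero =>
    obtain rfl : T = ∅ := Finset.eq_empty_of_forall_notMem fun t ht => by simpa using hT t ht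
    exact ⟨N, E, h, by simp, by simp⟩
  | succ i ih =>
    change @Bool.rec (fun _ => Bool) false
      (@Nat.rec (fun _ => Bool) true (fun r _ => force (Nat.succ c) fun c' =>
        force (Nat.lor N (Nat.pow 2 i)) fun N' => subsets n f i r c' N' ((n, i) :: E)) r)
      (subsets n f i r c N E) = true at h
    rw [boolRec_false, Bool.and_eq_true] at h
    by_cases hi : i ∈ T
    · have hcard := Finset.card_erase_add_one hi
      obtain _ | r := r
      · omega
      have h2 := h.2
      simp only [force_eq] at h2
      obtain ⟨N', E', hf, hN, hE⟩ := ih h2 (T := T.erase i)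
        (fun t ht => lt_of_le_of_ne (Nat.lt_succ_iff.1 (hT t (Finset.mem_of_mem_erase ht)))
          (Finset.ne_of_mem_erase ht)) (by omega)
      refine ⟨N', E', ?_, fun t => ?_, fun e => ?_⟩
      · rwa [show Nat.succ c + (T.erase i).card = c + T.card by omega] at hf
      · rw [hN, show Nat.lor N (Nat.pow 2 i) = N ||| 2 ^ i from rfl, Nat.testBit_or,
          Bool.or_eq_true, Nat.testBit_two_pow]
        by_cases hti : t = i
        · subst hti; simp [hi]
        · simp [hti, Ne.symm hti]
      · rw [hE]
        simp only [List.mem_cons, Finset.mem_erase]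
        constructor
        · rintro ((rfl | h) | ⟨t, ht, rfl⟩)
          exacts [.inr ⟨i, hi, rfl⟩, .inl h, .inr ⟨t, ht.2, rfl⟩]
        · rintro (h | ⟨t, ht, rfl⟩)
          · exact .inl (.inr h)
          · by_cases hti : t = i
            · subst hti; exact .inl (.inl rfl)
            · exact .inr ⟨t, ⟨hti, ht⟩, rfl⟩
    · exact ih h.1 (fun t ht => lt_of_le_of_ne (Nat.lt_succ_iff.1 (hT t ht))
        fun h => hi (h ▸ ht)) hr

lemma newTriangles_spec {n N : ℕ} {E : List (ℕ × ℕ)} {l : List ℕ} {k : List ℕ → Bool}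
    (h : newTriangles n N E l k = true) : ∃ l', k l' = true ∧ ∀ m, m ∈ l' ↔ m ∈ l ∨
      ∃ e ∈ E, N.testBit e.1 = true ∧ N.testBit e.2 = true ∧
        (m = arc n e.1 ||| (arc e.1 e.2 ||| arc e.2 n) ∨
          m = arc n e.2 ||| (arc e.2 e.1 ||| arc e.1 n)) := by
  induction E generalizing l with
  | nil => exact ⟨l, h, by simp⟩
  | cons e E ih =>
    change @Bool.rec (fun _ => Bool) (newTriangles n N E l k)
     (force (Nat.lor (arc n e.1) (Nat.lor (arc e.1 e.2) (arc e.2 n))) fun t =>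
      force (Nat.lor (arc n e.2) (Nat.lor (arc e.2 e.1) (arc e.1 n))) fun t' =>
        newTriangles n N E (t :: t' :: l) k)
     (@Bool.rec (fun _ => Bool) false (Nat.testBit N e.2) (Nat.testBit N e.1)) = true at h
    rw [boolRec_false] at h
    cases hb : (N.testBit e.1 && N.testBit e.2) with
    | false =>
      rw [hb] at h
      obtain ⟨l', hk, hm⟩ := ih h
      refine ⟨l', hk, fun m => ?_⟩
      rw [hm]
      simp only [List.mem_cons, exists_eq_or_imp]
      have : ¬ (N.testBit e.1 = true ∧ N.testBit e.2 = true) := by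
        rw [← Bool.and_eq_true, hb]; simp
      constructor
      · rintro (h | h)
        exacts [.inl h, .inr (.inr h)]
      · rintro (h | ⟨h1, h2, -⟩ | h)
        exacts [.inl h, (this ⟨h1, h2⟩).elim, .inr h]
    | true =>
      rw [hb] at h
      simp only [force_eq] at h
      obtain ⟨l', hk, hm⟩ := ih h
      refine ⟨l', hk, fun m => ?_⟩
      rw [hm]
      simp only [List.mem_cons, exists_eq_or_imp]
      rw [Bool.and_eq_true] at hb
      change (m = arc n e.1 ||| (arc e.1 e.2 ||| arc e.2 n) ∨
        m = arc n e.2 ||| (arc e.2 e.1 ||| arc e.1 n) ∨ m ∈ l) ∨ _ ↔ _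
      constructor
      · rintro ((h | h | h) | h)
        exacts [.inr (.inl ⟨hb.1, hb.2, .inl h⟩), .inr (.inl ⟨hb.1, hb.2, .inr h⟩), .inl h,
          .inr (.inr h)]
      · rintro (h | ⟨-, -, h | h⟩ | h)
        exacts [.inl (.inr (.inr h)), .inl (.inl h), .inl (.inr (.inl h)), .inr h]

lemma arcsK_eq (E : List (ℕ × ℕ)) (k : List (ℕ × ℕ) → Bool) :
    arcsK E k = k (E.map fun e => (arc e.1 e.2, arc e.2 e.1)) := by
  induction E generalizing k with
  | nil => rfl
  | cons e E ih =>
    change force (arc e.1 e.2) (fun a => force (arc e.2 e.1) fun b =>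
      arcsK E fun l => k ((a, b) :: l)) = _
    rw [force_eq, force_eq, ih]
    rfl

lemma search_succ {fuel n k D : ℕ} {E : List (ℕ × ℕ)} {l : List ℕ}
    (h : search (fuel + 1) n k D E l = true) {T : Finset ℕ} (hT : ∀ t ∈ T, t < n) {j : ℕ}
    (hj : T.card = j + 2) (hk : k + j ≤ 2) :
    ∃ (N' : ℕ) (E' : List (ℕ × ℕ)) (D' : ℕ) (l' : List ℕ), search fuel (n + 1) (k + j) D' E' l' = true ∧
      (∀ t, N'.testBit t = true ↔ t ∈ T) ∧ (∀ e, e ∈ E' ↔ e ∈ E ∨ ∃ t ∈ T, e = (n, t)) ∧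
      (∀ t, D'.testBit t = true → (D.testBit t = true ∧ t ∉ T) ∨ (j = 0 ∧ t = n)) ∧
      ∀ m, m ∈ l' ↔ m ∈ l ∨ ∃ e ∈ E, e.1 ∈ T ∧ e.2 ∈ T ∧
        (m = arc n e.1 ||| (arc e.1 e.2 ||| arc e.2 n) ∨
          m = arc n e.2 ||| (arc e.2 e.1 ||| arc e.1 n)) := by
  change @Bool.rec (fun _ => Bool) false
     (subsets n (fun c N E' => @Bool.rec (fun _ => Bool) true
       (newTriangles n N E l fun l' => force (Nat.sub (Nat.add k c) 2) fun k' =>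
         force (Nat.lor (Nat.xor D (Nat.land D N))
           (@Bool.rec (fun _ => ℕ) 0 (Nat.pow 2 n) (Nat.beq c 2))) fun D' =>
         force (Nat.succ n) fun n' => search fuel n' k' D' E' l') (Nat.ble 2 c))
         n (Nat.sub 4 k) 0 0 E)
     (leaf k D E l) = true at h
  rw [boolRec_false, Bool.and_eq_true] at h
  -- The new vertex has j + 2 back neighbours with k + j ≤ 2, so subsets of size at most 4 - k
  -- suffice.
  obtain ⟨N', E', hf, hN, hE⟩ := subsets_spec h.2 hT (show T.card ≤ 4 - k by omega)
  rw [Nat.zero_add, Nat.ble_eq_true_of_le (by omega : 2 ≤ T.card)] at hf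
  simp only [force_eq] at hf
  obtain ⟨l', hs, hm⟩ := newTriangles_spec hf
  simp only [Nat.zero_testBit, Bool.false_eq_true, false_or] at hN
  obtain ⟨D', hD'⟩ : ∃ D', D' = Nat.lor (Nat.xor D (Nat.land D N'))
      (@Bool.rec (fun _ => ℕ) 0 (Nat.pow 2 n) (Nat.beq T.card 2)) := ⟨_, rfl⟩
  rw [← hD'] at hs
  refine ⟨N', E', D', l', ?_, hN, hE, ?_, ?_⟩
  · rw [show Nat.sub (Nat.add k T.card) 2 = k + j by
      change k + T.card - 2 = _; omega] at hs
    exact hs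
  · intro t ht
    rw [hD'] at ht
    change ((D ^^^ (D &&& N')) ||| _).testBit t = true at ht
    rw [Nat.testBit_or, Bool.or_eq_true] at ht
    rcases ht with ht | ht
    · left
      rw [Nat.testBit_xor, Nat.testBit_and] at ht
      rw [← hN]
      cases h1 : D.testBit t <;> cases h2 : N'.testBit t <;> simp_all
    · right
      cases hb : Nat.beq T.card 2 with
      | false => rw [hb] at ht; simp at ht
      | true =>
        rw [hb] at ht
        have := Nat.eq_of_beq_eq_true hb
        change (2 ^ n).testBit t = true at ht
        rw [Nat.testBit_two_pow, decide_eq_true_eq] at ht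
        exact ⟨by omega, ht.symm⟩
  · intro m
    rw [hm]
    simp only [hN]

lemma search_leaf {fuel n D : ℕ} {E : List (ℕ × ℕ)} {l : List ℕ}
    (h : search fuel n 2 D E l = true) (hD : D = 0) :
    solve (E.map fun e => (arc e.1 e.2, arc e.2 e.1)) l = true := by
  subst hD
  rw [← arcsK_eq E (fun A => solve A l)]
  cases fuel with
  | zero => exact h
  | succ fuel =>
    change @Bool.rec (fun _ => Bool) false _ (leaf 2 0 E l) = true at h
    rw [boolRec_false, Bool.and_eq_true] at h
    exact h.1

/-- The lists `E` and `l` describe the graph induced by `G` on the vertices `φ 0, …, φ (n - 1)` and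
its cyclic triangles. -/
structure Describes {V : Type*} (G : SimpleGraph V) (φ : ℕ → V) (n : ℕ) (E : List (ℕ × ℕ))
    (l : List ℕ) : Prop where
  injOn : ∀ i < n, ∀ j < n, φ i = φ j → i = j
  lt : ∀ e ∈ E, e.1 < n ∧ e.2 < n ∧ e.1 ≠ e.2
  edge : ∀ i < n, ∀ j < n, G.Adj (φ i) (φ j) → (i, j) ∈ E ∨ (j, i) ∈ E
  triangle : ∀ x < n, ∀ y < n, ∀ z < n, G.Adj (φ x) (φ y) → G.Adj (φ y) (φ z) → G.Adj (φ z) (φ x) →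
    ∃ m ∈ l, bits m = {8 * x + y, 8 * y + z, 8 * z + x}
  eq_triangle : ∀ m ∈ l, ∃ x y z, ((x, y) ∈ E ∨ (y, x) ∈ E) ∧ ((y, z) ∈ E ∨ (z, y) ∈ E) ∧
    ((z, x) ∈ E ∨ (x, z) ∈ E) ∧ bits m = {8 * x + y, 8 * y + z, 8 * z + x}

lemma bits_lor_arc (a b c d e f : ℕ) :
    bits (arc a b ||| (arc c d ||| arc e f)) = {8 * a + b, 8 * c + d, 8 * e + f} := by
  ext t
  simp only [bits, Set.mem_ofPred_eq, Nat.testBit_or, Bool.or_eq_true, testBit_arc,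
    Set.mem_insert_iff, Set.mem_singleton_iff]

lemma rotate_triple {γ : Type*} (a b c : γ) : ({a, b, c} : Set γ) = {b, c, a} := by
  ext; simp only [Set.mem_insert_iff, Set.mem_singleton_iff]; tauto

variable {V : Type*} [DecidableEq V] {G : SimpleGraph V} {u v : V}

/-- The search covers all the vertex sets that can be built with an excess of at most two. -/
lemma exists_describes (huv : G.Adj u v) {k : ℕ} {S : Finset V} (h : Built G u v k S)
    (hk : k ≤ 2) (hS : S.card ≤ 7) : ∃ (φ : ℕ → V) (D : ℕ) (E : List (ℕ × ℕ)) (l : List ℕ),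
      φ 0 = u ∧ φ 1 = v ∧ S = (Finset.range S.card).image φ ∧ Describes G φ S.card E l ∧
      (∀ t, D.testBit t = true → t < S.card ∧ 2 ≤ t ∧ (neighborsIn G (φ t) S).card ≤ 2) ∧
      search (7 - S.card) S.card k D E l = true := by
  induction h with
  | base =>
    have hc : ({u, v} : Finset V).card = 2 := Finset.card_pair huv.ne
    rw [hc]
    refine ⟨fun i => if i = 0 then u else v, 0, [(1, 0)], [], rfl, rfl, ?_, ?_, by simp,
      search_eq_true⟩
    · ext x; simp [Finset.range_add_one, or_comm, eq_comm]
    · have hne := huv.ne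
      constructor
      · intro i hi j hj hij
        interval_cases i <;> interval_cases j <;> simp_all
      · simp
      · intro i hi j hj hij
        interval_cases i <;> interval_cases j <;> simp_all
      · intro x hx y hy z hz hxy hyz hzx
        interval_cases x <;> interval_cases y <;> interval_cases z <;> simp_all
      · simp
  | @step k j S w h hw hd ih =>
    obtain ⟨φ, D, E, l, hφ0, hφ1, hSφ, hdesc, hD, hs⟩ := ih (by omega) (by
      rw [Finset.card_insert_of_notMem hw] at hS; omega)
    rw [Finset.card_insert_of_notMem hw] at hS ⊢
    set n := S.card with hn
    have hn2 : 2 ≤ n := h.two_le_card huv.ne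
    have hmemS : ∀ x, x ∈ S ↔ ∃ i < n, φ i = x := fun x => by
      rw [hSφ, Finset.mem_image]; simp
    classical
    -- The labels of the neighbours of `w` in S select the branch of the search to follow.
    set T := (Finset.range n).filter (fun i => G.Adj w (φ i)) with hT
    have hTmem : ∀ i, i ∈ T ↔ i < n ∧ G.Adj w (φ i) := by simp [hT]
    have hTcard : T.card = j + 2 := by
      rw [← hd, ← Finset.card_image_of_injOn (f := φ) (s := T)]
      · congr 1
        ext x
        simp only [Finset.mem_image, hTmem, mem_neighborsIn, hmemS]
        constructor
        · rintro ⟨i, ⟨hi, ha⟩, rfl⟩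
          exact ⟨⟨i, hi, rfl⟩, ha⟩
        · rintro ⟨⟨i, hi, rfl⟩, ha⟩
          exact ⟨i, ⟨hi, ha⟩, rfl⟩
      · intro a ha b hb hab
        exact hdesc.injOn a ((hTmem a).1 ha).1 b ((hTmem b).1 hb).1 hab
    obtain ⟨f, hf⟩ : ∃ f, 7 - n = f + 1 := ⟨6 - n, by omega⟩
    rw [hf] at hs
    obtain ⟨N', E', D', l', hs', -, hE', hD', hl'⟩ :=
      search_succ hs (fun t ht => ((hTmem t).1 ht).1) hTcard hk
    have hφS : ∀ i < n, φ i ∈ S := fun i hi => (hmemS _).2 ⟨i, hi, rfl⟩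
    have hup : ∀ i < n, Function.update φ n w i = φ i := fun i hi =>
      Function.update_of_ne hi.ne _ _
    have hupn : Function.update φ n w n = w := Function.update_self _ _ _
    have hcases : ∀ i < n + 1, i < n ∨ i = n := fun i hi => by omega
    refine ⟨Function.update φ n w, D', E', l', ?_, ?_, ?_, ⟨?_, ?_, ?_, ?_, ?_⟩, ?_, ?_⟩
    · rw [hup 0 (by omega), hφ0]
    · rw [hup 1 (by omega), hφ1]
    · rw [Finset.range_add_one, Finset.image_insert, hupn]
      congr 1
      conv_lhs => rw [hSφ]
      exact Finset.image_congr fun i hi => (hup i (Finset.mem_range.1 hi)).symm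
    · intro i hi j hj hij
      obtain hi | rfl := hcases i hi <;> obtain hj | rfl := hcases j hj
      · rw [hup i hi, hup j hj] at hij
        exact hdesc.injOn i hi j hj hij
      · rw [hup i hi, hupn] at hij
        exact (hw (hij ▸ hφS i hi)).elim
      · rw [hup j hj, hupn] at hij
        exact (hw (hij ▸ hφS j hj)).elim
      · rfl
    · intro e he
      obtain he | ⟨t, ht, rfl⟩ := (hE' e).1 he
      · have := hdesc.lt e he
        omega
      · have := ((hTmem t).1 ht).1
        exact ⟨by simp, by simp only; omega, by simp only; omega⟩
    · intro i hi j hj hij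
      obtain hi | rfl := hcases i hi <;> obtain hj | rfl := hcases j hj
      · rw [hup i hi, hup j hj] at hij
        exact (hdesc.edge i hi j hj hij).imp (fun h => (hE' _).2 (.inl h))
          fun h => (hE' _).2 (.inl h)
      · rw [hup i hi, hupn] at hij
        exact .inr ((hE' _).2 (.inr ⟨i, (hTmem i).2 ⟨hi, hij.symm⟩, rfl⟩))
      · rw [hup j hj, hupn] at hij
        exact .inl ((hE' _).2 (.inr ⟨j, (hTmem j).2 ⟨hj, hij⟩, rfl⟩))
      · exact (hij.ne rfl).elim
    · have key : ∀ a < n + 1, ∀ b < n + 1, G.Adj w (Function.update φ n w a) →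
          G.Adj (Function.update φ n w a) (Function.update φ n w b) →
          G.Adj (Function.update φ n w b) w →
          ∃ m ∈ l', bits m = {8 * n + a, 8 * a + b, 8 * b + n} := by
        intro a ha b hb hwa hab hbw
        obtain ha | rfl := hcases a ha
        swap
        · rw [hupn] at hwa; exact (hwa.ne rfl).elim
        obtain hb | rfl := hcases b hb
        swap
        · rw [hupn] at hbw; exact (hbw.ne rfl).elim
        rw [hup a ha] at hwa hab
        rw [hup b hb] at hab hbw
        have haT := (hTmem a).2 ⟨ha, hwa⟩
        have hbT := (hTmem b).2 ⟨hb, hbw.symm⟩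
        obtain he | he := hdesc.edge a ha b hb hab
        · exact ⟨_, (hl' _).2 (.inr ⟨_, he, haT, hbT, .inl rfl⟩), bits_lor_arc _ _ _ _ _ _⟩
        · exact ⟨_, (hl' _).2 (.inr ⟨_, he, hbT, haT, .inr rfl⟩), bits_lor_arc _ _ _ _ _ _⟩
      intro x hx y hy z hz hxy hyz hzx
      by_cases hxn : x = n
      · subst hxn
        rw [hupn] at hxy hzx
        exact key y hy z hz hxy hyz hzx
      by_cases hyn : y = n
      · subst hyn
        rw [hupn] at hxy hyz
        obtain ⟨m, hm, hb⟩ := key z hz x hx hyz hzx hxy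
        exact ⟨m, hm, by rw [hb, rotate_triple (8 * x + n)]⟩
      by_cases hzn : z = n
      · subst hzn
        rw [hupn] at hyz hzx
        obtain ⟨m, hm, hb⟩ := key x hx y hy hzx hxy hyz
        exact ⟨m, hm, by rw [hb, ← rotate_triple (8 * n + x)]⟩
      have hx : x < n := by omega
      have hy : y < n := by omega
      have hz : z < n := by omega
      rw [hup x hx, hup y hy] at hxy
      rw [hup y hy, hup z hz] at hyz
      rw [hup x hx, hup z hz] at hzx
      obtain ⟨m, hm, hb⟩ := hdesc.triangle x hx y hy z hz hxy hyz hzx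
      exact ⟨m, (hl' m).2 (.inl hm), hb⟩
    · intro m hm
      obtain hm | ⟨e, he, h1, h2, hm⟩ := (hl' m).1 hm
      · obtain ⟨x, y, z, hxy, hyz, hzx, hb⟩ := hdesc.eq_triangle m hm
        refine ⟨x, y, z, ?_, ?_, ?_, hb⟩
        · exact hxy.imp (fun h => (hE' _).2 (.inl h)) fun h => (hE' _).2 (.inl h)
        · exact hyz.imp (fun h => (hE' _).2 (.inl h)) fun h => (hE' _).2 (.inl h)
        · exact hzx.imp (fun h => (hE' _).2 (.inl h)) fun h => (hE' _).2 (.inl h)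
      · have e1 : (n, e.1) ∈ E' := (hE' _).2 (.inr ⟨_, h1, rfl⟩)
        have e2 : (n, e.2) ∈ E' := (hE' _).2 (.inr ⟨_, h2, rfl⟩)
        have e3 : (e.1, e.2) ∈ E' := (hE' _).2 (.inl he)
        obtain rfl | rfl := hm
        · exact ⟨n, e.1, e.2, .inl e1, .inl e3, .inr e2, bits_lor_arc _ _ _ _ _ _⟩
        · exact ⟨n, e.2, e.1, .inl e2, .inr e3, .inr e1, bits_lor_arc _ _ _ _ _ _⟩
    · intro t ht
      obtain ⟨ht, htT⟩ | ⟨rfl, rfl⟩ := hD' t ht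
      · obtain ⟨htn, ht2, hdeg⟩ := hD t ht
        refine ⟨by omega, ht2, ?_⟩
        rw [hup t htn]
        refine (Finset.card_le_card fun z hz => ?_).trans hdeg
        rw [mem_neighborsIn, Finset.mem_insert] at hz
        obtain ⟨rfl | hz, hadj⟩ := hz
        · exact (htT ((hTmem t).2 ⟨htn, hadj.symm⟩)).elim
        · exact mem_neighborsIn.2 ⟨hz, hadj⟩
      · refine ⟨by omega, hn2, ?_⟩
        rw [hupn]
        refine (Finset.card_le_card fun z hz => ?_).trans hd.le
        rw [mem_neighborsIn, Finset.mem_insert] at hz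
        obtain ⟨rfl | hz, hadj⟩ := hz
        · exact (hadj.ne rfl).elim
        · exact mem_neighborsIn.2 ⟨hz, hadj⟩
    · rwa [show 7 - (n + 1) = f by omega]

end Solver

/-! ### Surplus two in the cyclic game -/

variable {V : Type*} [DecidableEq V] {G : SimpleGraph V} {u v : V}

open Solver in
/-- In the game of cyclic triangles Breaker can answer the claim of `uv` in vertex sets with at most
seven vertices that are built with excess two. -/
theorem Built.exists_blocks_of_two (huv : G.Adj u v) {S : Finset V} (h : Built G u v 2 S)
    (hS : S.card ≤ 7) : ∃ f, Blocks (fun a : V × V => s(a.1, a.2))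
      (residual (fun a : V × V => s(a.1, a.2)) (triangleFamily Prod.mk G S) (u, v) f) := by
  induction hc : S.card using Nat.strong_induction_on generalizing S with
  | _ n ih =>
  subst hc
  -- A vertex of degree at most two, other than u and v, is removed and its edges are paired. Once
  -- none is left, `D` is zero and the search must have solved this graph.
  by_cases hdeg : ∃ w ∈ S, w ≠ u ∧ w ≠ v ∧ (neighborsIn G w S).card ≤ 2
  · obtain ⟨w, hw, hwu, hwv, hd⟩ := hdeg
    have h' := h.erase hw hwu hwv hd
    have hcard := Finset.card_erase_of_mem hw
    have hpos := Finset.card_pos.2 ⟨w, hw⟩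
    obtain ⟨f, hf⟩ := ih _ (by omega) h' (by omega) rfl
    refine ⟨f, ?_⟩
    have := h'.exists_reply_of_neighbors (fun _ _ => rfl) huv.ne (Finset.notMem_erase w S) (f := f)
      ⟨neighborsIn G w S, hd, fun z hz hwz _ =>
        mem_neighborsIn.2 ⟨Finset.mem_of_mem_erase hz, hwz⟩⟩ hf
    rwa [Finset.insert_erase hw] at this
  push Not at hdeg
  obtain ⟨φ, D, E, l, hφ0, hφ1, hSφ, hd, hD, hs⟩ := exists_describes huv h le_rfl hS
  set n := S.card with hn
  have hφS : ∀ i < n, φ i ∈ S := fun i hi => by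
    rw [hSφ]; exact Finset.mem_image_of_mem _ (Finset.mem_range.2 hi)
  have hn2 : 2 ≤ n := h.two_le_card huv.ne
  have hD0 : D = 0 := Nat.eq_of_testBit_eq fun t => by
    rw [Nat.zero_testBit, Bool.eq_false_iff]
    intro ht
    obtain ⟨htn, ht2, hdt⟩ := hD t ht
    have := hdeg (φ t) (hφS t htn)
      (fun h => by have := hd.injOn t htn 0 (by omega) (h.trans hφ0.symm); omega)
      (fun h => by have := hd.injOn t htn 1 (by omega) (h.trans hφ1.symm); omega)
    omega
  have hsolve := search_leaf hs hD0
  have hlt : ∀ {x y}, (x, y) ∈ E ∨ (y, x) ∈ E → x < 8 ∧ y < 8 ∧ x ≠ y := by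
    rintro x y (h | h)
    · have := hd.lt _ h
      simp only at this
      omega
    · have := hd.lt _ h
      simp only at this
      omega
  have hE : IsArcs (E.map fun e => (arc e.1 e.2, arc e.2 e.1)) := by
    intro e he
    obtain ⟨⟨i, j⟩, he', rfl⟩ := List.mem_map.1 he
    have := hlt (.inl he')
    exact ⟨i, j, this.1, this.2.1, this.2.2, rfl⟩
  have hl : Proper l := by
    intro m hm
    obtain ⟨x, y, z, hxy, hyz, hzx, hb⟩ := hd.eq_triangle m hm
    have h1 := hlt hxy
    have h2 := hlt hyz
    have h3 := hlt hzx
    rw [hb]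
    intro a ha b hb hab
    simp only [Set.mem_insert_iff, Set.mem_singleton_iff] at ha hb
    rcases ha with rfl | rfl | rfl <;> rcases hb with rfl | rfl | rfl <;>
      simp only [elem_arc, h1.1, h1.2.1, h2.2.1, Sym2.eq_iff] at hab <;> omega
  have hcov : Covers (E.map fun e => (arc e.1 e.2, arc e.2 e.1)) l := by
    have key : ∀ {x y}, (x, y) ∈ E ∨ (y, x) ∈ E → ∃ e ∈ E.map fun e => (arc e.1 e.2, arc e.2 e.1),
        e.1 = 2 ^ (8 * x + y) ∨ e.2 = 2 ^ (8 * x + y) := by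
      rintro x y (h | h)
      · exact ⟨_, List.mem_map.2 ⟨_, h, rfl⟩, .inl rfl⟩
      · exact ⟨_, List.mem_map.2 ⟨_, h, rfl⟩, .inr rfl⟩
    intro m hm c hc
    obtain ⟨x, y, z, hxy, hyz, hzx, hb⟩ := hd.eq_triangle m hm
    rw [hb] at hc
    rcases hc with rfl | rfl | rfl
    exacts [key hxy, key hyz, key hzx]
  obtain ⟨e, he, hB⟩ := solve_spec hE hl hcov hsolve
  obtain ⟨⟨i, j⟩, he', rfl⟩ := List.mem_map.1 he
  have hij := hlt (.inl he')
  have hijn := hd.lt _ he'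
  simp only at hijn hB
  set C : Set ℕ := {c | c / 8 < n ∧ c % 8 < n} with hC
  -- Arc numbers decode to ordered pairs of vertices. Since φ is controlled only below n,
  -- injectivity is claimed only on C.
  set ι : ℕ → V × V := fun c => (φ (c / 8), φ (c % 8)) with hι
  have hιC : Set.InjOn ι C := by
    intro a ha b hb hab
    have h1 := hd.injOn _ ha.1 _ hb.1 (congrArg Prod.fst hab)
    have h2 := hd.injOn _ ha.2 _ hb.2 (congrArg Prod.snd hab)
    omega
  have hιarc : ∀ {x y}, y < n → ι (8 * x + y) = (φ x, φ y) := by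
    intro x y hy
    simp only [hι]
    rw [show (8 * x + y) / 8 = x by omega, show (8 * x + y) % 8 = y by omega]
  have hCarc : ∀ {x y}, x < n → y < n → 8 * x + y ∈ C := by
    intro x y hx hy
    exact ⟨by omega, by omega⟩
  refine ⟨s(φ i, φ j), (hB.image ι C hιC (Sym2.map φ) (fun c _ => rfl)
    (el' := fun a : V × V => s(a.1, a.2))).mono ?_⟩
  rintro _ ⟨F, ⟨x', hx', y', hy', z', hz', hxy, hyz, hzx, rfl⟩, h1, rfl⟩
  simp only [Finset.mem_coe] at hx' hy' hz'
  rw [hSφ, Finset.mem_image] at hx' hy' hz'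
  obtain ⟨x, hx, rfl⟩ := hx'
  obtain ⟨y, hy, rfl⟩ := hy'
  obtain ⟨z, hz, rfl⟩ := hz'
  rw [Finset.mem_range] at hx hy hz
  obtain ⟨m, hm, hb⟩ := hd.triangle x hx y hy z hz hxy hyz hzx
  have hbC : bits m ⊆ C := by
    rw [hb]
    rintro c (rfl | rfl | rfl)
    exacts [hCarc hx hy, hCarc hy hz, hCarc hz hx]
  have himg : ι '' bits m = {(φ x, φ y), (φ y, φ z), (φ z, φ x)} := by
    rw [hb, Set.image_insert_eq, Set.image_insert_eq, Set.image_singleton, hιarc hy, hιarc hz,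
      hιarc hx]
  rw [← himg] at h1 ⊢
  have huvι : (u, v) = ι (8 * 0 + 1) := by rw [hιarc (by omega), hφ0, hφ1]
  have h01C : 8 * 0 + 1 ∈ C := hCarc (by omega) (by omega)
  refine ⟨bits m \ {8 * 0 + 1}, ⟨m ^^^ (m &&& arc 0 1), ?_, (bits_xor_land_arc m 0 1).symm⟩,
    Set.sdiff_subset.trans hbC, ?_⟩
  · have hne : ∀ c ∈ bits m, c ≠ 8 * 0 + 1 → ι c ≠ (u, v) := fun c hc hc1 h =>
      hc1 (hιC (hbC hc) h01C (h.trans huvι))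
    simp only [avoiding, claimed, List.mem_filter, List.mem_map]
    refine ⟨⟨m, ⟨hm, land_eq_zero fun c hc hc' => ?_⟩, rfl⟩, land_eq_zero fun c hc hc' => ?_⟩
    · rw [testBit_arc] at hc'
      refine (h1 (ι c) ⟨c, hc, rfl⟩ (hne c hc (by omega))).1 ?_
      rw [hc', hιarc (by omega), hφ0, hφ1]
      exact Sym2.eq_swap
    · have hc2 : c ∈ bits m \ {8 * 0 + 1} := bits_xor_land_arc m 0 1 ▸ hc
      rw [Nat.testBit_or, Bool.or_eq_true, testBit_arc, testBit_arc] at hc'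
      refine (h1 (ι c) ⟨c, hc2.1, rfl⟩ (hne c hc2.1 hc2.2)).2 ?_
      rcases hc' with rfl | rfl
      · rw [hιarc hijn.2.1]
      · rw [hιarc hijn.1]
        exact Sym2.eq_swap
  · rw [huvι]
    ext a
    constructor
    · rintro ⟨⟨c, hc, rfl⟩, hne⟩
      exact ⟨c, ⟨hc, fun h => hne (congrArg ι h)⟩, rfl⟩
    · rintro ⟨c, ⟨hc, hne⟩, rfl⟩
      exact ⟨⟨c, hc, rfl⟩, fun h => hne (hιC (hbC hc) h01C h)⟩


/-! ### From blocked families to Breaker's wins -/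

section Games

variable {V α α' β : Type*}

lemma Blocks.not_forcesWin_start {X : Set β} {el : α → β} {𝓕 : Set (Set α)} {Goal : Set α → Prop}
    (h𝓕 : Blocks el 𝓕) (hGoal : ∀ A, (∀ a ∈ A, el a ∈ X) → Goal A → ∃ W ∈ 𝓕, W ⊆ A) :
    ¬ ForcesWin X el Goal Player.maker ∅ ∅ :=
  h𝓕.not_forcesWin hGoal
    ⟨by simp, fun W hW => .inr ⟨W, hW, subset_rfl, fun _ _ h => h⟩⟩

/-- Maker can carry a strategy over to different labels of the same board elements. -/
lemma ForcesWin.map {X : Set β} {el : α → β} {el' : α' → β} {Goal : Set α → Prop}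
    {Goal' : Set α' → Prop} (σ : α → α') (hσ : ∀ a, el' (σ a) = el a)
    (hGoal : ∀ A, Goal A → Goal' (σ '' A)) {t : Player} {A : Set α} {B : Set β}
    (h : ForcesWin X el Goal t A B) : ForcesWin X el' Goal' t (σ '' A) B := by
  have hfree : ∀ A B, free X el' (σ '' A) B = free X el A B := fun A B => by
    simp only [free, Set.image_image, hσ]
  induction h with
  | gameOver h hG => exact .gameOver (by rwa [hfree]) (hGoal _ hG)
  | makerMove a ha _ ih =>
    rw [Set.image_insert_eq] at ih
    exact .makerMove (σ a) (by rwa [hfree, hσ]) ih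
  | breakerMove hne _ ih =>
    exact .breakerMove (by rwa [hfree]) fun x hx => ih x (by rwa [hfree] at hx)

lemma containsCopy_acyclic {A : Set (V × V)} : ContainsCopy acyclicTriangle A ↔
    ∃ x y z, x ≠ y ∧ y ≠ z ∧ x ≠ z ∧ (x, y) ∈ A ∧ (x, z) ∈ A ∧ (y, z) ∈ A := by
  constructor
  · rintro ⟨f, hf⟩
    exact ⟨f 0, f 1, f 2, f.injective.ne (by decide), f.injective.ne (by decide),
      f.injective.ne (by decide), hf 0 1 (show (0 : Fin 3) < 1 by decide),
      hf 0 2 (show (0 : Fin 3) < 2 by decide), hf 1 2 (show (1 : Fin 3) < 2 by decide)⟩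
  · rintro ⟨x, y, z, hxy, hyz, hxz, h1, h2, h3⟩
    refine ⟨⟨![x, y, z], ?_⟩, ?_⟩
    · intro i j hij
      fin_cases i <;> fin_cases j <;> simp_all
    · intro i j hij
      replace hij : i < j := hij
      fin_cases i <;> fin_cases j <;>
        first | exact h1 | exact h2 | exact h3 | exact absurd hij (by decide)

lemma containsCopy_cyclic {A : Set (V × V)} : ContainsCopy cyclicTriangle A ↔
    ∃ x y z, x ≠ y ∧ y ≠ z ∧ x ≠ z ∧ (x, y) ∈ A ∧ (y, z) ∈ A ∧ (z, x) ∈ A := by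
  constructor
  · rintro ⟨f, hf⟩
    exact ⟨f 0, f 1, f 2, f.injective.ne (by decide), f.injective.ne (by decide),
      f.injective.ne (by decide), hf 0 1 (show (1 : Fin 3) = 0 + 1 by decide),
      hf 1 2 (show (2 : Fin 3) = 1 + 1 by decide), hf 2 0 (show (0 : Fin 3) = 2 + 1 by decide)⟩
  · rintro ⟨x, y, z, hxy, hyz, hxz, h1, h2, h3⟩
    refine ⟨⟨![x, y, z], ?_⟩, ?_⟩
    · intro i j hij
      fin_cases i <;> fin_cases j <;> simp_all
    · intro i j hij
      replace hij : j = i + 1 := hij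
      subst hij
      fin_cases i
      exacts [h1, h2, h3]

lemma not_cliqueFree_fromEdgeSet {A : Set (Sym2 V)} :
    ¬ (SimpleGraph.fromEdgeSet A).CliqueFree 3 ↔
    ∃ x y z, x ≠ y ∧ y ≠ z ∧ x ≠ z ∧ s(x, y) ∈ A ∧ s(x, z) ∈ A ∧ s(y, z) ∈ A := by
  classical
  simp only [SimpleGraph.CliqueFree, not_forall, not_not, SimpleGraph.is3Clique_iff,
    SimpleGraph.fromEdgeSet_adj]
  constructor
  · rintro ⟨_, x, y, z, h1, h2, h3, -⟩
    exact ⟨x, y, z, h1.2, h3.2, h2.2, h1.1, h2.1, h3.1⟩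
  · rintro ⟨x, y, z, h1, h2, h3, h4, h5, h6⟩
    exact ⟨_, x, y, z, ⟨h4, h1⟩, ⟨h5, h3⟩, ⟨h6, h2⟩, rfl⟩

/-- The game of the acyclic triangle is equivalent to the triangle game: Maker may orient all her
edges along a linear order. -/
theorem acyclic_makerWin_iff [LinearOrder V] (G : SimpleGraph V) :
    TournamentGameMakerWin acyclicTriangle G ↔ TriangleGameMakerWin G := by
  constructor
  · intro h
    have := h.map (el' := fun e : Sym2 V => e)
      (Goal' := fun A => ¬ (SimpleGraph.fromEdgeSet A).CliqueFree 3)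
      (fun a : V × V => s(a.1, a.2)) (fun _ => rfl) fun A hA => by
        obtain ⟨x, y, z, h1, h2, h3, h4, h5, h6⟩ := containsCopy_acyclic.1 hA
        exact not_cliqueFree_fromEdgeSet.2 ⟨x, y, z, h1, h2, h3, ⟨_, h4, rfl⟩, ⟨_, h5, rfl⟩,
          ⟨_, h6, rfl⟩⟩
    rwa [Set.image_empty] at this
  · intro h
    have hσ : ∀ e : Sym2 V, s(e.inf, e.sup) = e := fun e => by
      induction e with | _ x y
      rcases le_total x y with h | h
      · simp [h]
      · simp [h, Sym2.eq_swap]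
    have := h.map (el' := fun a : V × V => s(a.1, a.2)) (Goal' := ContainsCopy acyclicTriangle)
      (fun e : Sym2 V => (e.inf, e.sup)) hσ fun A hA => by
        obtain ⟨x, y, z, h1, h2, h3, h4, h5, h6⟩ := not_cliqueFree_fromEdgeSet.1 hA
        have key : ∀ {x y}, s(x, y) ∈ A → x < y →
            (x, y) ∈ (fun e : Sym2 V => (e.inf, e.sup)) '' A := fun {x y} h hxy =>
          ⟨_, h, by simp [hxy.le]⟩
        refine containsCopy_acyclic.2 ?_
        have h4' : s(y, x) ∈ A := Sym2.eq_swap ▸ h4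
        have h5' : s(z, x) ∈ A := Sym2.eq_swap ▸ h5
        have h6' : s(z, y) ∈ A := Sym2.eq_swap ▸ h6
        rcases lt_or_gt_of_ne h1 with h1 | h1 <;> rcases lt_or_gt_of_ne h2 with h2 | h2 <;>
          rcases lt_or_gt_of_ne h3 with h3 | h3
        · exact ⟨x, y, z, h1.ne, h2.ne, h3.ne, key h4 h1, key h5 h3, key h6 h2⟩
        · exact (lt_asymm (h1.trans h2) h3).elim
        · exact ⟨x, z, y, h3.ne, h2.ne, h1.ne, key h5 h3, key h4 h1, key h6' h2⟩
        · exact ⟨z, x, y, h3.ne, h1.ne, h2.ne, key h5' h3, key h6' h2, key h4 h1⟩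
        · exact ⟨y, x, z, h1.ne, h3.ne, h2.ne, key h4' h1, key h6 h2, key h5 h3⟩
        · exact ⟨y, z, x, h2.ne, h3.ne, h1.ne, key h6 h2, key h4' h1, key h5' h3⟩
        · exact (lt_asymm (h2.trans h1) h3).elim
        · exact ⟨z, y, x, h2.ne, h1.ne, h3.ne, key h6' h2, key h5' h3, key h4' h1⟩
    rwa [Set.image_empty] at this

/-- Breaker wins the triangle game on graphs of small local density. -/
theorem not_triangleGameMakerWin [Finite V] (G : SimpleGraph V)
    (hG : ∀ S : Finset V, S.Nonempty → S.card ≤ 15 → 5 * (edgesIn G S).card < 9 * S.card) :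
    ¬ TriangleGameMakerWin G := by
  classical
  have hB : Blocks (fun e : Sym2 V => e) (triangleFamily (fun x y => s(x, y)) G Set.univ) := by
    refine blocks_triangleFamily_univ (c := fun x y => s(x, y)) (el := fun e : Sym2 V => e)
      (fun _ _ => rfl) G fun G' hG' u v huv k S hS => ?_
    have hG'' : ∀ S : Finset V, S.Nonempty → S.card ≤ 15 → 5 * (edgesIn G' S).card < 9 * S.card :=
      fun S h1 h2 => lt_of_le_of_lt
        (Nat.mul_le_mul_left _ (Finset.card_le_card (edgesIn_mono_left hG' S))) (hG S h1 h2)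
    -- For density 9/5 the size bound 3a / (2a - b) equals 15.
    have hlt := hS.card_lt (by norm_num) (by norm_num) huv hG'' (by norm_num)
    have h1 := hG'' S (Finset.card_pos.1 (by have := hS.two_le_card huv.ne; omega)) hlt.le
    have h2 := hS.card_edgesIn huv
    have h3 := hS.two_mul_le huv.ne
    have h4 := hS.two_le_card huv.ne
    -- The density bound reads |S| < 15 - 5k, so k ≥ 2 would force |S| ≤ 4. Four vertices have
    -- surplus at most one.
    have hk : k = 0 ∨ k = 1 := by
      by_contra hk
      have : S.card ≤ 4 := by omega
      interval_cases hc : S.card <;> omega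
    obtain rfl | rfl := hk
    · exact ⟨s(u, v), hS.blocks_of_zero (c := fun x y => s(x, y)) (el := fun e : Sym2 V => e)
        (fun _ _ => rfl) huv.ne rfl _⟩
    · exact hS.exists_blocks_of_one (c := fun x y => s(x, y)) (el := fun e : Sym2 V => e) (fun _ _ => rfl) huv.ne rfl
  refine hB.not_forcesWin_start fun A hA hGoal => ?_
  obtain ⟨x, y, z, h1, h2, h3, h4, h5, h6⟩ := not_cliqueFree_fromEdgeSet.1 hGoal
  have h5' : s(z, x) ∈ A := Sym2.eq_swap ▸ h5
  refine ⟨_, ⟨x, trivial, y, trivial, z, trivial, hA _ h4, hA _ h6, hA _ h5', rfl⟩, ?_⟩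
  rintro _ (rfl | rfl | rfl) <;> assumption

/-- Breaker wins the game of the cyclic triangle on graphs of small local density. -/
theorem not_cyclicGameMakerWin [Finite V] (G : SimpleGraph V)
    (hG : ∀ S : Finset V, S.Nonempty → S.card ≤ 24 → 8 * (edgesIn G S).card < 15 * S.card) :
    ¬ TournamentGameMakerWin cyclicTriangle G := by
  classical
  have hB : Blocks (fun a : V × V => s(a.1, a.2)) (triangleFamily Prod.mk G Set.univ) := by
    refine blocks_triangleFamily_univ (fun _ _ => rfl) G fun G' hG' u v huv k S hS => ?_
    have hG'' : ∀ S : Finset V, S.Nonempty → S.card ≤ 24 → 8 * (edgesIn G' S).card < 15 * S.card :=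
      fun S h1 h2 => lt_of_le_of_lt
        (Nat.mul_le_mul_left _ (Finset.card_le_card (edgesIn_mono_left hG' S))) (hG S h1 h2)
    have hlt := hS.card_lt (by norm_num) (by norm_num) huv hG'' (by norm_num)
    have h1 := hG'' S (Finset.card_pos.1 (by have := hS.two_le_card huv.ne; omega)) hlt.le
    have h2 := hS.card_edgesIn huv
    have h4 := hS.two_le_card huv.ne
    -- The density bound reads |S| < 24 - 8k. This excludes k ≥ 3 and leaves at most seven vertices
    -- for k = 2.
    obtain rfl | rfl | ⟨rfl, hc⟩ : k = 0 ∨ k = 1 ∨ (k = 2 ∧ S.card ≤ 7) := by omega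
    · exact ⟨s(u, v), hS.blocks_of_zero (fun _ _ => rfl) huv.ne rfl _⟩
    · exact hS.exists_blocks_of_one (fun _ _ => rfl) huv.ne rfl
    · exact hS.exists_blocks_of_two huv hc
  refine hB.not_forcesWin_start fun A hA hGoal => ?_
  obtain ⟨x, y, z, h1, h2, h3, h4, h5, h6⟩ := containsCopy_cyclic.1 hGoal
  refine ⟨_, ⟨x, trivial, y, trivial, z, trivial, hA _ h4, hA _ h5, hA _ h6, rfl⟩, ?_⟩
  rintro _ (rfl | rfl | rfl) <;> assumption

end Games

/-! ### Maker's forcing sequences -/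

section MakerStrategies

variable {V α β : Type*} {X : Set β} {el : α → β} {Goal : Set α → Prop} {A : Set α} {B : Set β}

lemma mem_free_insert_left {a : α} {x : β} :
    x ∈ free X el (insert a A) B ↔ x ∈ free X el A B ∧ x ≠ el a := by
  simp only [free, Set.image_insert_eq, Set.mem_insert_iff, Set.mem_ofPred_eq]
  tauto

lemma mem_free_insert_right {x y : β} :
    x ∈ free X el A (insert y B) ↔ x ∈ free X el A B ∧ x ≠ y := by
  simp only [free, Set.mem_insert_iff, Set.mem_ofPred_eq]
  tauto

/-- The conditions under which Maker cannot lose what she has already achieved. -/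
structure IsMonotoneGame (X : Set β) (el : α → β) (Goal : Set α → Prop) : Prop where
  finite : X.Finite
  exists_claim : ∀ x ∈ X, ∃ a, el a = x
  mono : ∀ A A', A ⊆ A' → Goal A → Goal A'

namespace IsMonotoneGame

/-- Further claims cannot destroy the goal, so Maker plays arbitrarily until the board is full; the
induction is on the number of free elements. -/
lemma forcesWin_of_goal (h : IsMonotoneGame X el Goal) (t : Player) (hG : Goal A) :
    ForcesWin X el Goal t A B := by
  have hfin : ∀ A B, (free X el A B).Finite := fun A B => h.finite.subset fun _ hx => hx.1
  induction hn : (free X el A B).ncard using Nat.strong_induction_on generalizing t A B with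
  | _ n ih =>
  subst hn
  obtain h0 | hne := (free X el A B).eq_empty_or_nonempty
  · exact .gameOver h0 hG
  cases t with
  | maker =>
    obtain ⟨x, hx⟩ := hne
    obtain ⟨a, rfl⟩ := h.exists_claim x hx.1
    refine .makerMove a hx (ih _ ?_ _ (h.mono _ _ (Set.subset_insert _ _) hG) rfl)
    refine Set.ncard_lt_ncard ⟨fun y hy => (mem_free_insert_left.1 hy).1, fun hsub => ?_⟩ (hfin _ _)
    exact (mem_free_insert_left.1 (hsub hx)).2 rfl
  | breaker =>
    refine .breakerMove hne fun x hx => ih _ ?_ _ hG rfl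
    refine Set.ncard_lt_ncard ⟨fun y hy => (mem_free_insert_right.1 hy).1, fun hsub => ?_⟩
      (hfin _ _)
    exact (mem_free_insert_right.1 (hsub hx)).2 rfl

/-- Maker claims `a` and threatens to claim `b`, so that Breaker has to claim the latter. -/
lemma forcesWin_of_threat (h : IsMonotoneGame X el Goal) {a b : α} (ha : el a ∈ free X el A B)
    (hb : el b ∈ free X el A B) (hab : el b ≠ el a) (hG : Goal (insert b (insert a A)))
    (hw : ForcesWin X el Goal .maker (insert a A) (insert (el b) B)) :
    ForcesWin X el Goal .maker A B := by
  have hb' : el b ∈ free X el (insert a A) B := mem_free_insert_left.2 ⟨hb, hab⟩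
  refine .makerMove a ha (.breakerMove ⟨_, hb'⟩ fun x _ => ?_)
  by_cases hxb : x = el b
  · rwa [hxb]
  · exact .makerMove b (mem_free_insert_right.2 ⟨hb', Ne.symm hxb⟩) (h.forcesWin_of_goal _ hG)

/-- Breaker can answer only one of the two threats that `a` creates. -/
lemma forcesWin_of_double_threat (h : IsMonotoneGame X el Goal) {a b b' : α}
    (ha : el a ∈ free X el A B) (hb : el b ∈ free X el A B) (hb' : el b' ∈ free X el A B)
    (hab : el b ≠ el a) (hab' : el b' ≠ el a) (hbb : el b' ≠ el b)
    (hG : Goal (insert b (insert a A))) (hG' : Goal (insert b' (insert a A))) :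
    ForcesWin X el Goal .maker A B :=
  h.forcesWin_of_threat ha hb hab hG <| .makerMove b'
    (mem_free_insert_right.2 ⟨mem_free_insert_left.2 ⟨hb', hab'⟩, hbb⟩) (h.forcesWin_of_goal _ hG')

lemma forcesWin_of_two (h : IsMonotoneGame X el Goal) {p₁ q₁ p₂ q₂ q₂' : α}
    (hnd : [el p₁, el q₁, el p₂, el q₂, el q₂'].Nodup)
    (hfree : ∀ x ∈ [el p₁, el q₁, el p₂, el q₂, el q₂'], x ∈ free X el A B)
    (h₁ : Goal (insert q₁ (insert p₁ A))) (h₂ : Goal (insert q₂ (insert p₂ (insert p₁ A))))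
    (h₂' : Goal (insert q₂' (insert p₂ (insert p₁ A)))) : ForcesWin X el Goal .maker A B := by
  simp only [List.nodup_cons, List.mem_cons, List.not_mem_nil, not_or, or_false] at hnd
  simp only [List.mem_cons, List.not_mem_nil, or_false, forall_eq_or_imp, forall_eq] at hfree
  refine h.forcesWin_of_threat (a := p₁) (b := q₁) ?_ ?_ ?_ h₁
    (h.forcesWin_of_double_threat ?_ ?_ ?_ ?_ ?_ ?_ h₂ h₂') <;>
  (try simp only [mem_free_insert_left, mem_free_insert_right]) <;> grind

lemma forcesWin_of_three (h : IsMonotoneGame X el Goal) {p₁ q₁ p₂ q₂ p₃ q₃ q₃' : α}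
    (hnd : [el p₁, el q₁, el p₂, el q₂, el p₃, el q₃, el q₃'].Nodup)
    (hfree : ∀ x ∈ [el p₁, el q₁, el p₂, el q₂, el p₃, el q₃, el q₃'], x ∈ free X el A B)
    (h₁ : Goal (insert q₁ (insert p₁ A))) (h₂ : Goal (insert q₂ (insert p₂ (insert p₁ A))))
    (h₃ : Goal (insert q₃ (insert p₃ (insert p₂ (insert p₁ A)))))
    (h₃' : Goal (insert q₃' (insert p₃ (insert p₂ (insert p₁ A))))) :
    ForcesWin X el Goal .maker A B := by
  simp only [List.nodup_cons, List.mem_cons, List.not_mem_nil, not_or, or_false] at hnd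
  simp only [List.mem_cons, List.not_mem_nil, or_false, forall_eq_or_imp, forall_eq] at hfree
  refine h.forcesWin_of_threat (a := p₁) (b := q₁) ?_ ?_ ?_ h₁
    (h.forcesWin_of_threat (a := p₂) (b := q₂) ?_ ?_ ?_ h₂
      (h.forcesWin_of_double_threat ?_ ?_ ?_ ?_ ?_ ?_ h₃ h₃')) <;>
  (try simp only [mem_free_insert_left, mem_free_insert_right]) <;> grind

end IsMonotoneGame

variable {G : SimpleGraph V}

lemma isMonotoneGame_cyclic [Finite V] (G : SimpleGraph V) :
    IsMonotoneGame G.edgeSet (fun a : V × V => s(a.1, a.2)) (ContainsCopy cyclicTriangle) where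
  finite := Set.toFinite _
  exists_claim x _ := by
    induction x with | _ x y
    exact ⟨(x, y), rfl⟩
  mono _ _ h := fun ⟨f, hf⟩ => ⟨f, fun i j hij => h (hf i j hij)⟩

lemma isMonotoneGame_triangle [Finite V] (G : SimpleGraph V) :
    IsMonotoneGame G.edgeSet (fun e : Sym2 V => e)
      (fun A => ¬ (SimpleGraph.fromEdgeSet A).CliqueFree 3) where
  finite := Set.toFinite _
  exists_claim x _ := ⟨x, rfl⟩
  mono _ _ h := fun hA hA' => hA (hA'.anti (SimpleGraph.fromEdgeSet_mono h))

/-- Maker, who owns the spoke `xr₀` of a wheel with four free rim edges and three further free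
spokes, gets a cyclic triangle. -/
lemma forcesWin_cyclic_of_wheel [Finite V] {A : Set (V × V)} {B : Set (Sym2 V)}
    {x r₀ r₁ r₂ r₃ : V} (hne : [x, r₀, r₁, r₂, r₃].Nodup) (hA : (x, r₀) ∈ A)
    (hfree : ∀ e ∈ [s(r₁, x), s(r₀, r₁), s(x, r₂), s(r₂, r₁), s(r₃, x), s(r₀, r₃), s(r₂, r₃)],
      e ∈ free G.edgeSet (fun a : V × V => s(a.1, a.2)) A B) :
    ForcesWin G.edgeSet (fun a : V × V => s(a.1, a.2)) (ContainsCopy cyclicTriangle) .maker A B := by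
  simp only [List.nodup_cons, List.mem_cons, List.not_mem_nil, not_or, or_false] at hne
  have key : ∀ {x y z : V} {A : Set (V × V)}, x ≠ y → y ≠ z → x ≠ z → (x, y) ∈ A → (y, z) ∈ A →
      (z, x) ∈ A → ContainsCopy cyclicTriangle A := fun h1 h2 h3 h4 h5 h6 =>
    containsCopy_cyclic.2 ⟨_, _, _, h1, h2, h3, h4, h5, h6⟩
  -- The spokes point alternately away from and towards the hub, so any two consecutive ones form a
  -- cyclic triangle with a suitably oriented rim edge. As the rim has even length, the last spoke
  -- threatens on both sides.
  refine (isMonotoneGame_cyclic G).forcesWin_of_three (p₁ := (r₁, x)) (q₁ := (r₀, r₁))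
    (p₂ := (x, r₂)) (q₂ := (r₂, r₁)) (p₃ := (r₃, x)) (q₃ := (r₀, r₃)) (q₃' := (r₂, r₃)) ?_ hfree
    (key (x := x) (y := r₀) (z := r₁) ?_ ?_ ?_ ?_ ?_ ?_)
    (key (x := x) (y := r₂) (z := r₁) ?_ ?_ ?_ ?_ ?_ ?_)
    (key (x := x) (y := r₀) (z := r₃) ?_ ?_ ?_ ?_ ?_ ?_)
    (key (x := x) (y := r₂) (z := r₃) ?_ ?_ ?_ ?_ ?_ ?_) <;>
  first
    | (simp only [Set.mem_insert_iff, hA, true_or, or_true]; done)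
    | (simp only [List.nodup_cons, List.mem_cons, List.not_mem_nil, Sym2.eq_iff]; grind)
    | grind

lemma forcesWin_triangle_of_wheel [Finite V] {A : Set (Sym2 V)} {B : Set (Sym2 V)}
    {x r₀ r₁ r₂ r₃ : V} (hne : [x, r₀, r₁, r₂, r₃].Nodup) (hA : s(x, r₀) ∈ A)
    (hfree : ∀ e ∈ [s(x, r₁), s(r₀, r₁), s(x, r₂), s(r₁, r₂), s(x, r₃), s(r₀, r₃), s(r₂, r₃)],
      e ∈ free G.edgeSet (fun e : Sym2 V => e) A B) :
    ForcesWin G.edgeSet (fun e : Sym2 V => e)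
      (fun A => ¬ (SimpleGraph.fromEdgeSet A).CliqueFree 3) .maker A B := by
  simp only [List.nodup_cons, List.mem_cons, List.not_mem_nil, not_or, or_false] at hne
  have key : ∀ {x y z : V} {A : Set (Sym2 V)}, x ≠ y → y ≠ z → x ≠ z → s(x, y) ∈ A → s(x, z) ∈ A →
      s(y, z) ∈ A → ¬ (SimpleGraph.fromEdgeSet A).CliqueFree 3 := fun h1 h2 h3 h4 h5 h6 =>
    not_cliqueFree_fromEdgeSet.2 ⟨_, _, _, h1, h2, h3, h4, h5, h6⟩
  refine (isMonotoneGame_triangle G).forcesWin_of_three (p₁ := s(x, r₁)) (q₁ := s(r₀, r₁))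
    (p₂ := s(x, r₂)) (q₂ := s(r₁, r₂)) (p₃ := s(x, r₃)) (q₃ := s(r₀, r₃)) (q₃' := s(r₂, r₃)) ?_ hfree
    (key (x := x) (y := r₀) (z := r₁) ?_ ?_ ?_ ?_ ?_ ?_)
    (key (x := x) (y := r₁) (z := r₂) ?_ ?_ ?_ ?_ ?_ ?_)
    (key (x := x) (y := r₀) (z := r₃) ?_ ?_ ?_ ?_ ?_ ?_)
    (key (x := x) (y := r₂) (z := r₃) ?_ ?_ ?_ ?_ ?_ ?_) <;>
  first
    | simp only [Set.mem_insert_iff, hA, true_or, or_true]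
    | (simp only [List.nodup_cons, List.mem_cons, List.not_mem_nil, Sym2.eq_iff]; grind)
    | grind

/-- In K₄ with ab owned, the claim ac forces Breaker to bc. The claim ad then threatens both bd and
cd. -/
lemma forcesWin_triangle_of_complete [Finite V] {A : Set (Sym2 V)} {B : Set (Sym2 V)}
    {a b c d : V} (hne : [a, b, c, d].Nodup) (hA : s(a, b) ∈ A)
    (hfree : ∀ e ∈ [s(a, c), s(b, c), s(a, d), s(b, d), s(c, d)],
      e ∈ free G.edgeSet (fun e : Sym2 V => e) A B) :
    ForcesWin G.edgeSet (fun e : Sym2 V => e)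
      (fun A => ¬ (SimpleGraph.fromEdgeSet A).CliqueFree 3) .maker A B := by
  simp only [List.nodup_cons, List.mem_cons, List.not_mem_nil, not_or, or_false] at hne
  have key : ∀ {x y z : V} {A : Set (Sym2 V)}, x ≠ y → y ≠ z → x ≠ z → s(x, y) ∈ A → s(x, z) ∈ A →
      s(y, z) ∈ A → ¬ (SimpleGraph.fromEdgeSet A).CliqueFree 3 := fun h1 h2 h3 h4 h5 h6 =>
    not_cliqueFree_fromEdgeSet.2 ⟨_, _, _, h1, h2, h3, h4, h5, h6⟩
  refine (isMonotoneGame_triangle G).forcesWin_of_two (p₁ := s(a, c)) (q₁ := s(b, c))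
    (p₂ := s(a, d)) (q₂ := s(b, d)) (q₂' := s(c, d)) ?_ hfree
    (key (x := a) (y := b) (z := c) ?_ ?_ ?_ ?_ ?_ ?_)
    (key (x := a) (y := b) (z := d) ?_ ?_ ?_ ?_ ?_ ?_)
    (key (x := a) (y := c) (z := d) ?_ ?_ ?_ ?_ ?_ ?_) <;>
  first
    | simp only [Set.mem_insert_iff, hA, true_or, or_true]
    | (simp only [List.nodup_cons, List.mem_cons, List.not_mem_nil, Sym2.eq_iff]; grind)
    | grind

/-- The edges of the complete graph on five vertices minus an edge. -/
def nearlyComplete : Finset (Sym2 (Fin 5)) :=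
  {s(0, 1), s(0, 2), s(0, 3), s(0, 4), s(1, 2), s(1, 3), s(1, 4), s(2, 3), s(2, 4)}

/-- The edges of two wheels with four spokes each that share the spoke `01` with hub `0`. -/
def doubleWheel : Finset (Sym2 (Fin 8)) :=
  {s(0, 1), s(0, 2), s(0, 3), s(0, 4), s(1, 2), s(2, 3), s(3, 4), s(1, 4),
    s(0, 5), s(0, 6), s(0, 7), s(1, 5), s(5, 6), s(6, 7), s(1, 7)}

lemma forall_mem_free {n : ℕ} {E : Finset (Sym2 (Fin n))} {φ : Fin n ↪ V}
    (h : ∀ e ∈ E, e.map φ ∈ G.edgeSet) {el : α → Sym2 V} {a : α} {e₀ : Sym2 (Fin n)}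
    (ha : el a = e₀.map φ) {f : Sym2 V} {L : List (Sym2 (Fin n))} (hL : ∀ e ∈ L, e ∈ E ∧ e ≠ e₀)
    (hf : f ∉ L.map (Sym2.map φ)) :
    ∀ e ∈ L.map (Sym2.map φ), e ∈ free G.edgeSet el {a} {f} := by
  intro e he
  obtain ⟨e', he', rfl⟩ := List.mem_map.1 he
  refine ⟨h e' (hL e' he').1, ?_, fun h => hf (h ▸ he)⟩
  rintro ⟨_, rfl, h⟩
  exact (hL e' he').2 (Sym2.map.injective φ.injective (h.symm.trans ha))

lemma notMem_map_of_disjoint {n : ℕ} {φ : Fin n ↪ V} {f : Sym2 V} {L L' : List (Sym2 (Fin n))}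
    (hL : ∀ e ∈ L, e ∉ L') (hf : f ∈ L.map (Sym2.map φ)) : f ∉ L'.map (Sym2.map φ) := by
  obtain ⟨e, he, rfl⟩ := List.mem_map.1 hf
  intro h
  obtain ⟨e', he', h⟩ := List.mem_map.1 h
  exact hL e he (Sym2.map.injective φ.injective h ▸ he')

lemma nodup_map_embedding {n : ℕ} (φ : Fin n ↪ V) {l : List (Fin n)} (hl : l.Nodup) :
    (l.map φ).Nodup := hl.map φ.injective

/-- The two wheels share only the spoke that Maker claims first. Breaker's reply spoils at most one
of them, and she continues in the other. -/
theorem cyclicGameMakerWin_of_doubleWheel [Finite V] (φ : Fin 8 ↪ V)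
    (h : ∀ e ∈ doubleWheel, e.map φ ∈ G.edgeSet) : TournamentGameMakerWin cyclicTriangle G := by
  have hne : (free G.edgeSet (fun a : V × V => s(a.1, a.2)) {(φ 0, φ 1)} ∅).Nonempty := by
    refine ⟨s(φ 0, φ 2), h s(0, 2) (by decide), ?_, by simp⟩
    rintro ⟨_, rfl, h⟩
    exact absurd (Sym2.map.injective φ.injective (a₁ := s(0, 1)) (a₂ := s(0, 2)) h) (by decide)
  refine .makerMove (φ 0, φ 1) ⟨h s(0, 1) (by decide), by simp, by simp⟩ ?_
  simp only [insert_empty_eq]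
  refine .breakerMove hne fun f _ => ?_
  simp only [insert_empty_eq]
  let L : List (Sym2 (Fin 8)) := [s(2, 0), s(1, 2), s(0, 3), s(3, 2), s(4, 0), s(1, 4), s(3, 4)]
  let L' : List (Sym2 (Fin 8)) := [s(5, 0), s(1, 5), s(0, 6), s(6, 5), s(7, 0), s(1, 7), s(6, 7)]
  by_cases hf : f ∈ L.map (Sym2.map φ)
  · exact forcesWin_cyclic_of_wheel (x := φ 0) (r₀ := φ 1) (r₁ := φ 5) (r₂ := φ 6) (r₃ := φ 7)
      (nodup_map_embedding φ (l := [0, 1, 5, 6, 7]) (by decide)) rfl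
      (forall_mem_free h (el := fun a : V × V => s(a.1, a.2)) (a := (φ 0, φ 1))
        (e₀ := s(0, 1)) rfl (L := L') (by decide)
        (notMem_map_of_disjoint (by decide) hf))
  · exact forcesWin_cyclic_of_wheel (x := φ 0) (r₀ := φ 1) (r₁ := φ 2) (r₂ := φ 3) (r₃ := φ 4)
      (nodup_map_embedding φ (l := [0, 1, 2, 3, 4]) (by decide)) rfl
      (forall_mem_free h (el := fun a : V × V => s(a.1, a.2)) (a := (φ 0, φ 1))
        (e₀ := s(0, 1)) rfl (L := L) (by decide) hf)

theorem triangleGameMakerWin_of_nearlyComplete [Finite V] (φ : Fin 5 ↪ V)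
    (h : ∀ e ∈ nearlyComplete, e.map φ ∈ G.edgeSet) : TriangleGameMakerWin G := by
  have hne : (free G.edgeSet (fun e : Sym2 V => e) {s(φ 0, φ 1)} ∅).Nonempty := by
    refine ⟨s(φ 0, φ 2), h s(0, 2) (by decide), ?_, by simp⟩
    rintro ⟨_, rfl, h⟩
    exact absurd (Sym2.map.injective φ.injective (a₁ := s(0, 1)) (a₂ := s(0, 2)) h) (by decide)
  refine .makerMove s(φ 0, φ 1) ⟨h s(0, 1) (by decide), by simp, by simp⟩ ?_
  simp only [insert_empty_eq]
  refine .breakerMove hne fun f _ => ?_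
  simp only [insert_empty_eq]
  let L : List (Sym2 (Fin 5)) := [s(0, 3), s(1, 3), s(0, 2), s(1, 2), s(3, 2)]
  let L' : List (Sym2 (Fin 5)) := [s(0, 4), s(1, 4), s(0, 2), s(1, 2), s(4, 2)]
  by_cases hf : f ∈ L.map (Sym2.map φ)
  swap
  · exact forcesWin_triangle_of_complete (a := φ 0) (b := φ 1) (c := φ 3) (d := φ 2)
      (nodup_map_embedding φ (l := [0, 1, 3, 2]) (by decide)) rfl
      (forall_mem_free h (el := fun e : Sym2 V => e) (a := s(φ 0, φ 1)) (e₀ := s(0, 1)) rfl (L := L) (by decide) hf)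
  by_cases hf' : f ∈ L'.map (Sym2.map φ)
  swap
  · exact forcesWin_triangle_of_complete (a := φ 0) (b := φ 1) (c := φ 4) (d := φ 2)
      (nodup_map_embedding φ (l := [0, 1, 4, 2]) (by decide)) rfl
      (forall_mem_free h (el := fun e : Sym2 V => e) (a := s(φ 0, φ 1)) (e₀ := s(0, 1)) rfl (L := L') (by decide) hf')
  -- Besides 01, the two copies of K₄ share only 02 and 12. If Breaker takes one of these, Maker
  -- plays the wheel with hub 1 and rim 0, 3, 2, 4, or with hub 0 and rim 1, 3, 2, 4, which does not
  -- use it.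
  have hLL : ∀ e ∈ L, e ∈ L' → e = s(0, 2) ∨ e = s(1, 2) := by decide
  obtain ⟨e, he, rfl⟩ := List.mem_map.1 hf
  obtain ⟨e', he', hee⟩ := List.mem_map.1 hf'
  obtain rfl := Sym2.map.injective φ.injective hee
  obtain rfl | rfl := hLL _ he he'
  · exact forcesWin_triangle_of_wheel (x := φ 1) (r₀ := φ 0) (r₁ := φ 3) (r₂ := φ 2) (r₃ := φ 4)
      (nodup_map_embedding φ (l := [1, 0, 3, 2, 4]) (by decide)) (by simp [Sym2.eq_swap])
      (forall_mem_free h (el := fun e : Sym2 V => e) (a := s(φ 0, φ 1)) (e₀ := s(0, 1)) rfl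
        (L := [s(1, 3), s(0, 3), s(1, 2), s(3, 2), s(1, 4), s(0, 4), s(2, 4)]) (by decide)
        (notMem_map_of_disjoint (L := [s(0, 2)]) (by decide) (List.mem_singleton_self _)))
  · exact forcesWin_triangle_of_wheel (x := φ 0) (r₀ := φ 1) (r₁ := φ 3) (r₂ := φ 2) (r₃ := φ 4)
      (nodup_map_embedding φ (l := [0, 1, 3, 2, 4]) (by decide)) rfl
      (forall_mem_free h (el := fun e : Sym2 V => e) (a := s(φ 0, φ 1)) (e₀ := s(0, 1)) rfl
        (L := [s(0, 3), s(1, 3), s(0, 2), s(3, 2), s(0, 4), s(1, 4), s(2, 4)]) (by decide)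
        (notMem_map_of_disjoint (L := [s(1, 2)]) (by decide) (List.mem_singleton_self _)))

end MakerStrategies

/-! ### First and second moment methods in the binomial random graph -/

section RandomGraphs

open MeasureTheory ProbabilityTheory
open scoped Finset

lemma measurableSet_simpleGraph {V : Type*} [Finite V] (s : Set (SimpleGraph V)) :
    MeasurableSet s := by
  have : MeasurableSingletonClass (SimpleGraph V) := by
    refine ⟨fun G => ?_⟩
    have hG : SimpleGraph.edgeSet ⁻¹' {G.edgeSet} = {G} := by
      ext G'
      simp
    exact hG ▸ SimpleGraph.measurable_edgeSet (MeasurableSet.singleton G.edgeSet)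
  exact s.toFinite.measurableSet

lemma binomialRandom_real_forall_mem_edgeSet {V : Type*} [Finite V] (p : unitInterval)
    (E : Finset (Sym2 V)) (hE : ∀ e ∈ E, ¬ e.IsDiag) :
    (SimpleGraph.binomialRandom V p).real {G | ∀ e ∈ E, e ∈ G.edgeSet} = (p : ℝ) ^ #E := by
  have hpre : SimpleGraph.fromEdgeSet ⁻¹' {G : SimpleGraph V | ∀ e ∈ E, e ∈ G.edgeSet} =
      {S : Set (Sym2 V) | ∀ e ∈ E, e ∈ S} := by
    ext S
    simp only [Set.mem_preimage, Set.mem_ofPred_eq, SimpleGraph.edgeSet_fromEdgeSet]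
    exact forall₂_congr fun e he => ⟨fun h => h.1, fun h => ⟨h, hE e he⟩⟩
  have hpi : (fun P : Sym2 V → Prop => {e | P e}) ⁻¹' {S : Set (Sym2 V) | ∀ e ∈ E, e ∈ S} =
      Set.pi (E : Set (Sym2 V)) fun _ => {True} := by
    ext P
    simp [Set.mem_pi]
  rw [measureReal_def, SimpleGraph.binomialRandom_eq_map,
    Measure.map_apply SimpleGraph.measurable_fromEdgeSet (measurableSet_simpleGraph _), hpre,
    setBernoulli_apply', hpi, Measure.infinitePi_pi _ (fun _ _ => .of_discrete)]
  rw [Finset.prod_congr rfl (g := fun _ => (unitInterval.toNNReal p : ENNReal))]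
  · simp
  · intro e he
    simp [hE e he]

lemma aas_of_forall_le {p : ℕ → unitInterval} {P : ∀ n : ℕ, SimpleGraph (Fin n) → Prop}
    (h : ∀ ε > 0, ∀ᶠ n in atTop,
      (SimpleGraph.binomialRandom (Fin n) (p n)).real {G | ¬ P n G} ≤ ε) : AAS p P := by
  rw [AAS, ← ENNReal.tendsto_toReal_iff (fun _ => measure_ne_top _ _) ENNReal.one_ne_top,
    ENNReal.toReal_one, Metric.tendsto_nhds]
  intro ε hε
  filter_upwards [h (ε / 2) (half_pos hε)] with n hn
  have hc := probReal_compl_eq_one_sub (μ := SimpleGraph.binomialRandom (Fin n) (p n))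
    (s := {G | P n G}) (measurableSet_simpleGraph _)
  rw [Set.compl_ofPred] at hc
  have h1 : (SimpleGraph.binomialRandom (Fin n) (p n)).real {G | P n G} ≤ 1 := measureReal_le_one
  rw [← measureReal_def, Real.dist_eq, abs_lt]
  constructor <;> linarith

/-- The second moment bound for the probability that none of finitely many events occurs. -/
lemma sq_sum_mul_measureReal_forall_notMem_le {Ω ι : Type*} [MeasurableSpace Ω] (μ : Measure Ω)
    [IsProbabilityMeasure μ] [Fintype ι] (A : ι → Set Ω) (hA : ∀ i, MeasurableSet (A i)) :
    (∑ i, μ.real (A i)) ^ 2 * μ.real {ω | ∀ i, ω ∉ A i} ≤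
      ∑ i, ∑ j, μ.real (A i ∩ A j) - (∑ i, μ.real (A i)) ^ 2 := by
  classical
  set m := ∑ i, μ.real (A i) with hm
  have hint : ∀ s : Set Ω, MeasurableSet s → Integrable (s.indicator (1 : Ω → ℝ)) μ :=
    fun s hs => (integrable_const (1 : ℝ)).indicator hs
  have hval : ∀ s : Set Ω, MeasurableSet s → ∫ ω, s.indicator (1 : Ω → ℝ) ω ∂μ = μ.real s :=
    fun s hs => integral_indicator_one hs
  have hZ : MeasurableSet {ω | ∀ i, ω ∉ A i} := by
    have : {ω | ∀ i, ω ∉ A i} = ⋂ i, (A i)ᶜ := by ext; simp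
    rw [this]
    exact .iInter fun i => (hA i).compl
  -- With X the number of events that occur, this is the pointwise bound m² · 1[X = 0] ≤ (X - m)².
  -- Integrating it gives the claim.
  have hle : ∀ ω, m ^ 2 * ({ω | ∀ i, ω ∉ A i}.indicator (1 : Ω → ℝ) ω) ≤
      ∑ i, ∑ j, (A i ∩ A j).indicator (1 : Ω → ℝ) ω -
        2 * m * ∑ i, (A i).indicator (1 : Ω → ℝ) ω + m ^ 2 := by
    intro ω
    have hsq : ∑ i, ∑ j, (A i ∩ A j).indicator (1 : Ω → ℝ) ω =
        (∑ i, (A i).indicator (1 : Ω → ℝ) ω) ^ 2 := by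
      rw [sq, Finset.sum_mul_sum]
      simp [Set.inter_indicator_one]
    rw [hsq]
    by_cases hω : ∀ i, ω ∉ A i
    · simp [hω]
    · rw [Set.indicator_of_notMem (by simpa using hω)]
      nlinarith [sq_nonneg (∑ i, (A i).indicator (1 : Ω → ℝ) ω - m)]
  have hi₁ : Integrable (fun ω => ∑ i, ∑ j, (A i ∩ A j).indicator (1 : Ω → ℝ) ω) μ :=
    integrable_finsetSum _ fun i _ => integrable_finsetSum _ fun j _ => hint _ ((hA i).inter (hA j))
  have hi₂ : Integrable (fun ω => ∑ i, (A i).indicator (1 : Ω → ℝ) ω) μ :=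
    integrable_finsetSum _ fun i _ => hint _ (hA i)
  have h := integral_mono ((hint _ hZ).const_mul (m ^ 2))
    ((hi₁.sub (hi₂.const_mul (2 * m))).add (integrable_const (m ^ 2))) hle
  have e₁ : ∫ ω, ∑ i, ∑ j, (A i ∩ A j).indicator (1 : Ω → ℝ) ω ∂μ =
      ∑ i, ∑ j, μ.real (A i ∩ A j) := by
    rw [integral_finsetSum _ fun i _ => integrable_finsetSum _ fun j _ =>
      hint _ ((hA i).inter (hA j))]
    refine Finset.sum_congr rfl fun i _ => ?_
    rw [integral_finsetSum _ fun j _ => hint _ ((hA i).inter (hA j))]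
    exact Finset.sum_congr rfl fun j _ => hval _ ((hA i).inter (hA j))
  have e₂ : ∫ ω, ∑ i, (A i).indicator (1 : Ω → ℝ) ω ∂μ = m := by
    rw [integral_finsetSum _ fun i _ => hint _ (hA i)]
    exact Finset.sum_congr rfl fun i _ => hval _ (hA i)
  have e₃ : ∫ ω, (∑ i, ∑ j, (A i ∩ A j).indicator (1 : Ω → ℝ) ω -
      2 * m * ∑ i, (A i).indicator (1 : Ω → ℝ) ω + m ^ 2) ∂μ =
      ∑ i, ∑ j, μ.real (A i ∩ A j) - 2 * m * m + m ^ 2 := by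
    have h₁ := integral_add (hi₁.sub (hi₂.const_mul (2 * m))) (integrable_const (m ^ 2))
    have h₂ := integral_sub hi₁ (hi₂.const_mul (2 * m))
    rw [e₁, integral_const_mul, e₂] at h₂
    simp only [Pi.sub_apply] at h₁
    rw [h₁, h₂]
    simp
  have h' : ∫ ω, m ^ 2 * ({ω | ∀ i, ω ∉ A i}.indicator (1 : Ω → ℝ) ω) ∂μ ≤
    ∫ ω, (∑ i, ∑ j, (A i ∩ A j).indicator (1 : Ω → ℝ) ω -
      2 * m * ∑ i, (A i).indicator (1 : Ω → ℝ) ω + m ^ 2) ∂μ := h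
  rw [integral_const_mul, hval _ hZ, e₃] at h'
  linarith

/-- The first moment bound for the occurrence of small dense vertex sets. -/
theorem aas_forall_edgesIn_card_lt {p : ℕ → unitInterval} {a b K : ℕ} (ha : 0 < a)
    (h : Tendsto (fun n : ℕ => (n : ℝ) ^ a * (p n : ℝ) ^ b) atTop (𝓝 0)) :
    AAS p fun n G => ∀ S : Finset (Fin n), S.Nonempty → #S ≤ K →
      a * #(edgesIn G S) < b * #S := by
  classical
  refine aas_of_forall_le fun ε hε => ?_
  -- This bounds the number of pairs of a size v ≤ K and an edge set on v vertices. The summand 1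
  -- keeps it positive when K = 0.
  set D : ℝ := K * 2 ^ (K * K) + 1 with hD
  have hDpos : 0 < D := by positivity
  have hδ : 0 < ε / D := by positivity
  filter_upwards [h.eventually_le_const (show (0 : ℝ) < min 1 ((ε / D) ^ a) by positivity),
    eventually_ge_atTop 1] with n hn hn1
  set μ := SimpleGraph.binomialRandom (Fin n) (p n)
  have hp0 : 0 ≤ (p n : ℝ) := (p n).2.1
  have hp1 : (p n : ℝ) ≤ 1 := (p n).2.2
  have hn0 : (0 : ℝ) < n := by exact_mod_cast hn1
  -- Up to constants this is the expected number of v-sets with e prescribed edges. Its a-th power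
  -- is at most (n^a p^b)^v, and the inner quantity is eventually below 1.
  have hterm : ∀ v e : ℕ, 1 ≤ v → b * v ≤ a * e → (n : ℝ) ^ v * (p n : ℝ) ^ e ≤ ε / D := by
    intro v e hv hve
    refine le_of_pow_le_pow_left₀ ha.ne' hδ.le ?_
    calc ((n : ℝ) ^ v * (p n : ℝ) ^ e) ^ a = (n : ℝ) ^ (a * v) * (p n : ℝ) ^ (a * e) := by
          rw [mul_pow, ← pow_mul, ← pow_mul, mul_comm v, mul_comm e]
      _ ≤ (n : ℝ) ^ (a * v) * (p n : ℝ) ^ (b * v) := by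
          gcongr ?_ * ?_
          exact pow_le_pow_of_le_one hp0 hp1 hve
      _ = ((n : ℝ) ^ a * (p n : ℝ) ^ b) ^ v := by rw [mul_pow, ← pow_mul, ← pow_mul]
      _ ≤ (n : ℝ) ^ a * (p n : ℝ) ^ b :=
          pow_le_of_le_one (by positivity) (hn.trans (min_le_left _ _)) (by omega)
      _ ≤ (ε / D) ^ a := hn.trans (min_le_right _ _)
  let T : ℕ → Finset (Finset (Fin n)) := fun v => Finset.powersetCard v Finset.univ
  let F : Finset (Fin n) → Finset (Finset (Sym2 (Fin n))) := fun S =>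
    {E ∈ S.sym2.powerset | (∀ e ∈ E, ¬ e.IsDiag) ∧ b * #S ≤ a * #E}
  have hsub : {G : SimpleGraph (Fin n) | ¬ ∀ S : Finset (Fin n), S.Nonempty → #S ≤ K →
      a * #(edgesIn G S) < b * #S} ⊆
      ⋃ v ∈ Finset.Icc 1 K, ⋃ S ∈ T v, ⋃ E ∈ F S, {G | ∀ e ∈ E, e ∈ G.edgeSet} := by
    intro G hG
    simp only [Set.mem_ofPred_eq, not_forall, not_lt] at hG
    obtain ⟨S, hS, hSK, hle⟩ := hG
    simp only [Set.mem_iUnion]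
    refine ⟨#S, Finset.mem_Icc.2 ⟨hS.card_pos, hSK⟩, S, by simp [T], edgesIn G S, ?_,
      fun e he => (mem_edgesIn.1 he).2⟩
    refine Finset.mem_filter.2 ⟨Finset.mem_powerset.2 fun e he => ?_, fun e he =>
      G.not_isDiag_of_mem_edgeSet (mem_edgesIn.1 he).2, hle⟩
    exact Finset.mem_sym2_iff.2 (mem_edgesIn.1 he).1
  have hF : ∀ v ∈ Finset.Icc 1 K, ∀ S ∈ T v, μ.real (⋃ E ∈ F S, {G | ∀ e ∈ E, e ∈ G.edgeSet}) ≤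
      2 ^ (K * K) * (ε / D / n ^ v) := by
    intro v hv S hS
    obtain ⟨hv1, hvK⟩ := Finset.mem_Icc.1 hv
    have hSv : #S = v := (Finset.mem_powersetCard.1 hS).2
    calc μ.real (⋃ E ∈ F S, {G | ∀ e ∈ E, e ∈ G.edgeSet})
        ≤ ∑ E ∈ F S, μ.real {G | ∀ e ∈ E, e ∈ G.edgeSet} := measureReal_biUnion_finset_le _ _
      _ ≤ ∑ E ∈ F S, ε / D / n ^ v := by
          refine Finset.sum_le_sum fun E hE => ?_
          obtain ⟨-, hE, hcard⟩ := Finset.mem_filter.1 hE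
          rw [binomialRandom_real_forall_mem_edgeSet _ _ hE, le_div_iff₀ (by positivity), mul_comm]
          exact hterm v _ hv1 (hSv ▸ hcard)
      _ = #(F S) * (ε / D / n ^ v) := by simp
      _ ≤ 2 ^ (K * K) * (ε / D / n ^ v) := by
          gcongr
          have h1 : #(F S) ≤ 2 ^ #S.sym2 := (Finset.card_filter_le _ _).trans
            (Finset.card_powerset _).le
          have h2 : #S.sym2 ≤ K * K := by
            rw [Finset.card_sym2, hSv, Nat.choose_two_right]
            refine (Nat.div_le_of_le_mul ?_)
            rw [Nat.add_sub_cancel]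
            nlinarith
          exact_mod_cast h1.trans (Nat.pow_le_pow_right (by norm_num) h2)
  calc μ.real {G | ¬ ∀ S : Finset (Fin n), S.Nonempty → #S ≤ K → a * #(edgesIn G S) < b * #S}
      ≤ μ.real (⋃ v ∈ Finset.Icc 1 K, ⋃ S ∈ T v, ⋃ E ∈ F S, {G | ∀ e ∈ E, e ∈ G.edgeSet}) :=
        measureReal_mono hsub (measure_ne_top _ _)
    _ ≤ ∑ v ∈ Finset.Icc 1 K, μ.real (⋃ S ∈ T v, ⋃ E ∈ F S, {G | ∀ e ∈ E, e ∈ G.edgeSet}) :=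
        measureReal_biUnion_finset_le _ _
    _ ≤ ∑ v ∈ Finset.Icc 1 K, ∑ S ∈ T v, 2 ^ (K * K) * (ε / D / n ^ v) :=
        Finset.sum_le_sum fun v hv => (measureReal_biUnion_finset_le _ _).trans
          (Finset.sum_le_sum (hF v hv))
    _ ≤ ∑ v ∈ Finset.Icc 1 K, 2 ^ (K * K) * (ε / D) := by
        refine Finset.sum_le_sum fun v _ => ?_
        have hc : (#(T v) : ℝ) ≤ n ^ v := by
          simp only [T, Finset.card_powersetCard, Finset.card_univ, Fintype.card_fin]
          exact_mod_cast Nat.choose_le_pow n v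
        rw [Finset.sum_const, nsmul_eq_mul]
        calc (#(T v) : ℝ) * (2 ^ (K * K) * (ε / D / n ^ v))
            ≤ n ^ v * (2 ^ (K * K) * (ε / D / n ^ v)) := by gcongr
          _ = 2 ^ (K * K) * (ε / D) := by field_simp
    _ = (K * 2 ^ (K * K)) * (ε / D) := by simp [mul_assoc]
    _ ≤ D * (ε / D) := by gcongr; linarith
    _ = ε := by field_simp

/-- The edges of the copies of a graph under two embeddings that coincide are edges of the second
graph inside the preimage of the range of the first embedding. -/
lemma card_image_inter_image_le {k : ℕ} {V : Type*} [DecidableEq V] (E : Finset (Sym2 (Fin k)))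
    (φ ψ : Fin k ↪ V) :
    #(E.image (Sym2.map φ) ∩ E.image (Sym2.map ψ)) ≤
      #{e ∈ E | ∀ x ∈ e, x ∈ ({i | ψ i ∈ Finset.univ.image φ} : Finset (Fin k))} := by
  refine (Finset.card_le_card (t := Finset.image (Sym2.map ψ)
    {e ∈ E | ∀ x ∈ e, x ∈ ({i | ψ i ∈ Finset.univ.image φ} : Finset (Fin k))}) ?_).trans
    Finset.card_image_le
  intro e he
  obtain ⟨h₁, h₂⟩ := Finset.mem_inter.1 he
  obtain ⟨e₁, he₁, rfl⟩ := Finset.mem_image.1 h₁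
  obtain ⟨e₂, he₂, h⟩ := Finset.mem_image.1 h₂
  refine Finset.mem_image.2 ⟨e₂, Finset.mem_filter.2 ⟨he₂, fun x hx => ?_⟩, h⟩
  have hx' : ψ x ∈ Sym2.map φ e₁ := h ▸ Sym2.mem_map.2 ⟨x, hx, rfl⟩
  obtain ⟨y, -, hy⟩ := Sym2.mem_map.1 hx'
  simp only [Finset.mem_filter, Finset.mem_univ, true_and]
  exact Finset.mem_image.2 ⟨y, Finset.mem_univ _, hy⟩

lemma card_embedding_forall_mem_le {k n : ℕ} (R : Finset (Fin n)) (U : Finset (Fin k)) :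
    #{ψ : Fin k ↪ Fin n | ∀ i ∈ U, ψ i ∈ R} ≤ #R ^ #U * n ^ (k - #U) := by
  classical
  calc #{ψ : Fin k ↪ Fin n | ∀ i ∈ U, ψ i ∈ R}
      ≤ #(Fintype.piFinset fun i : Fin k => if i ∈ U then R else Finset.univ) := by
        refine Finset.card_le_card_of_injOn (fun ψ => ψ) (fun ψ hψ => ?_)
          (DFunLike.coe_injective.injOn)
        simp only [Finset.coe_filter, Finset.mem_univ, true_and, Set.mem_ofPred_eq] at hψ
        simp only [Finset.mem_coe, Fintype.mem_piFinset]
        intro i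
        split_ifs with hi
        · exact hψ i hi
        · exact Finset.mem_univ _
    _ = #R ^ #U * n ^ (k - #U) := by
        rw [Fintype.card_piFinset]
        have : ∀ i : Fin k, #(if i ∈ U then R else Finset.univ) = if i ∈ U then #R else n := by
          intro i
          split_ifs <;> simp
        simp only [this, Finset.prod_ite, Finset.prod_const, Finset.filter_mem_eq_inter,
          Finset.univ_inter]
        congr 2
        rw [← Finset.sdiff_eq_filter, Finset.card_sdiff]
        simp

/-- A fixed graph all of whose subgraphs are sparse enough occurs asymptotically almost surely. -/
theorem aas_exists_embedding {p : ℕ → unitInterval} {a b k : ℕ} (ha : 0 < a) (hb : 0 < b)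
    (E : Finset (Sym2 (Fin k))) (hE : ∀ e ∈ E, ¬ e.IsDiag)
    (hdens : ∀ U : Finset (Fin k), a * #{e ∈ E | ∀ x ∈ e, x ∈ U} ≤ b * #U)
    (h : Tendsto (fun n : ℕ => (n : ℝ) ^ a * (p n : ℝ) ^ b) atTop atTop) :
    AAS p fun n G => ∃ φ : Fin k ↪ Fin n, ∀ e ∈ E, e.map φ ∈ G.edgeSet := by
  classical
  refine aas_of_forall_le fun ε hε => ?_
  -- The factors bound the number of overlap patterns U, the placements of U inside a fixed copy,
  -- and the ratio of n^k to the number of embeddings.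
  set C : ℝ := 2 ^ k * (k + 1) ^ k * 2 ^ k with hC
  have hCpos : 0 < C := by positivity
  set M : ℝ := C / ε with hM
  have hMpos : 0 < M := by positivity
  filter_upwards [h.eventually_ge_atTop (max 1 (M ^ a)), eventually_ge_atTop (2 * k),
    eventually_ge_atTop 1] with n hn hnk hn1
  set μ := SimpleGraph.binomialRandom (Fin n) (p n)
  have hp1 : (p n : ℝ) ≤ 1 := (p n).2.2
  have hp0 : 0 < (p n : ℝ) := by
    refine (p n).2.1.lt_of_ne' fun h0 => ?_
    have := (le_max_left _ _).trans hn
    rw [h0, zero_pow hb.ne', mul_zero] at this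
    linarith
  have hn0 : (0 : ℝ) < n := by exact_mod_cast hn1
  -- Every nonempty induced subgraph has, up to constants, at least M expected copies. This keeps
  -- the variance small.
  have hexp : ∀ U : Finset (Fin k), U.Nonempty →
      M ≤ (n : ℝ) ^ #U * (p n : ℝ) ^ #{e ∈ E | ∀ x ∈ e, x ∈ U} := by
    intro U hU
    refine le_of_pow_le_pow_left₀ ha.ne' (by positivity) ?_
    calc M ^ a ≤ (n : ℝ) ^ a * (p n : ℝ) ^ b := (le_max_right _ _).trans hn
      _ ≤ ((n : ℝ) ^ a * (p n : ℝ) ^ b) ^ #U :=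
          le_self_pow₀ ((le_max_left _ _).trans hn) hU.card_pos.ne'
      _ = (n : ℝ) ^ (a * #U) * (p n : ℝ) ^ (b * #U) := by rw [mul_pow, ← pow_mul, ← pow_mul]
      _ ≤ (n : ℝ) ^ (a * #U) * (p n : ℝ) ^ (a * #{e ∈ E | ∀ x ∈ e, x ∈ U}) := by
          gcongr ?_ * ?_
          exact pow_le_pow_of_le_one hp0.le hp1 (hdens U)
      _ = _ := by rw [mul_pow, ← pow_mul, ← pow_mul, mul_comm a, mul_comm a]
  set m := #E with hm
  set N : ℝ := ((Fintype.card (Fin k ↪ Fin n) : ℕ) : ℝ) with hN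
  have hNn : (n : ℝ) ^ k ≤ 2 ^ k * N := by
    rw [hN, Fintype.card_embedding_eq, Fintype.card_fin, Fintype.card_fin]
    have h1 : ((n + 1 - k : ℕ) : ℝ) ^ k ≤ n.descFactorial k := by
      exact_mod_cast Nat.pow_sub_le_descFactorial n k
    have h2 : (n : ℝ) ≤ 2 * (n + 1 - k : ℕ) := by
      exact_mod_cast (by omega : n ≤ 2 * (n + 1 - k))
    calc (n : ℝ) ^ k ≤ (2 * (n + 1 - k : ℕ)) ^ k := by gcongr
      _ = 2 ^ k * ((n + 1 - k : ℕ) : ℝ) ^ k := mul_pow _ _ _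
      _ ≤ _ := by gcongr
  have hNpos : 0 < N := by
    have : (0 : ℝ) < 2 ^ k * N := lt_of_lt_of_le (by positivity) hNn
    exact pos_of_mul_pos_right this (by positivity)
  let A : (Fin k ↪ Fin n) → Set (SimpleGraph (Fin n)) := fun φ =>
    {G | ∀ e ∈ E.image (Sym2.map φ), e ∈ G.edgeSet}
  have hdiag : ∀ φ : Fin k ↪ Fin n, ∀ e ∈ E.image (Sym2.map φ), ¬ e.IsDiag := by
    intro φ e he
    obtain ⟨e', he', rfl⟩ := Finset.mem_image.1 he
    rw [Sym2.isDiag_map φ.injective]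
    exact hE e' he'
  have hcard : ∀ φ : Fin k ↪ Fin n, #(E.image (Sym2.map φ)) = m := fun φ =>
    Finset.card_image_of_injective _ (Sym2.map.injective φ.injective)
  have hA : ∀ φ, μ.real (A φ) = (p n : ℝ) ^ m := by
    intro φ
    rw [← hcard φ]
    exact binomialRandom_real_forall_mem_edgeSet _ _ (hdiag φ)
  have hsum : ∑ φ, μ.real (A φ) = N * (p n : ℝ) ^ m := by simp [hA, hN]
  -- Pairs of copies are classified by the set of vertices of the second copy that lie in the first.
  let u : (Fin k ↪ Fin n) → (Fin k ↪ Fin n) → Finset (Fin k) := fun φ ψ =>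
    {i | ψ i ∈ Finset.univ.image φ}
  let W : Finset (Fin k) → ℝ := fun U => (p n : ℝ) ^ (m - #{e ∈ E | ∀ x ∈ e, x ∈ U}) * (p n : ℝ) ^ m
  have hAA : ∀ φ ψ, μ.real (A φ ∩ A ψ) ≤ W (u φ ψ) := by
    intro φ ψ
    have hset : A φ ∩ A ψ =
        {G | ∀ e ∈ E.image (Sym2.map φ) ∪ E.image (Sym2.map ψ), e ∈ G.edgeSet} := by
      ext G
      simp only [A, Set.mem_inter_iff, Set.mem_ofPred_eq, Finset.mem_union]
      exact ⟨fun h e he => he.elim (h.1 e) (h.2 e), fun h => ⟨fun e he => h e (.inl he),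
        fun e he => h e (.inr he)⟩⟩
    rw [hset, binomialRandom_real_forall_mem_edgeSet _ _ fun e he =>
      (Finset.mem_union.1 he).elim (hdiag φ e) (hdiag ψ e)]
    simp only [W, ← pow_add]
    refine pow_le_pow_of_le_one hp0.le hp1 ?_
    have h1 := Finset.card_union_add_card_inter (E.image (Sym2.map φ)) (E.image (Sym2.map ψ))
    have h2 : _ ≤ #{e ∈ E | ∀ x ∈ e, x ∈ u φ ψ} := card_image_inter_image_le E φ ψ
    have h3 : #{e ∈ E | ∀ x ∈ e, x ∈ u φ ψ} ≤ m := Finset.card_filter_le _ _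
    rw [hcard, hcard] at h1
    omega
  have hW : ∀ U : Finset (Fin k), U.Nonempty →
      W U * n ^ (k - #U) * M ≤ (n : ℝ) ^ k * (p n : ℝ) ^ m * (p n : ℝ) ^ m := by
    intro U hU
    have h3 : #{e ∈ E | ∀ x ∈ e, x ∈ U} ≤ m := Finset.card_filter_le _ _
    have h4 : #U ≤ k := by simpa using Finset.card_le_univ U
    calc W U * n ^ (k - #U) * M ≤ W U * n ^ (k - #U) *
          ((n : ℝ) ^ #U * (p n : ℝ) ^ #{e ∈ E | ∀ x ∈ e, x ∈ U}) := by
          gcongr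
          exact hexp U hU
      _ = (n : ℝ) ^ (k - #U + #U) *
          (p n : ℝ) ^ (m - #{e ∈ E | ∀ x ∈ e, x ∈ U} + #{e ∈ E | ∀ x ∈ e, x ∈ U}) *
          (p n : ℝ) ^ m := by
          rw [pow_add, pow_add]
          ring
      _ = _ := by rw [Nat.sub_add_cancel h3, Nat.sub_add_cancel h4]
  set Q : ℝ := (n : ℝ) ^ k * (p n : ℝ) ^ m * (p n : ℝ) ^ m with hQ
  have hrow : ∀ φ, ∑ ψ, μ.real (A φ ∩ A ψ) ≤
      N * ((p n : ℝ) ^ m * (p n : ℝ) ^ m) + 2 ^ k * ((k + 1) ^ k * (Q / M)) := by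
    intro φ
    have hR : #(Finset.univ.image φ) = k := by
      rw [Finset.card_image_of_injective _ φ.injective, Finset.card_univ, Fintype.card_fin]
    have hψ : ∀ ψ, μ.real (A φ ∩ A ψ) ≤ (p n : ℝ) ^ m * (p n : ℝ) ^ m +
        ∑ U : Finset (Fin k) with U.Nonempty,
          if ∀ i ∈ U, ψ i ∈ Finset.univ.image φ then W U else 0 := by
      intro ψ
      have hnn : ∀ U ∈ ({U | U.Nonempty} : Finset (Finset (Fin k))),
          0 ≤ if ∀ i ∈ U, ψ i ∈ Finset.univ.image φ then W U else 0 := by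
        intro U _
        split_ifs <;> positivity
      refine (hAA φ ψ).trans ?_
      -- Disjoint copies contribute at most the product of their probabilities, which the squared
      -- mean absorbs. Only nonempty overlaps feed the variance.
      obtain h0 | h0 := (u φ ψ).eq_empty_or_nonempty
      · have hempty : #{e ∈ E | ∀ x ∈ e, x ∈ (∅ : Finset (Fin k))} = 0 := by
          have := hdens ∅
          rw [Finset.card_empty, mul_zero] at this
          exact (Nat.mul_eq_zero.1 (Nat.le_zero.1 this)).resolve_left ha.ne'
        have hWe : W (u φ ψ) = (p n : ℝ) ^ m * (p n : ℝ) ^ m := by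
          simp only [W, h0, hempty, Nat.sub_zero]
        rw [hWe]
        exact le_add_of_nonneg_right (Finset.sum_nonneg hnn)
      · have hsingle := Finset.single_le_sum hnn
          (Finset.mem_filter.2 ⟨Finset.mem_univ (u φ ψ), h0⟩)
        rw [if_pos fun i hi => (Finset.mem_filter.1 hi).2] at hsingle
        exact hsingle.trans (le_add_of_nonneg_left (by positivity))
    calc ∑ ψ, μ.real (A φ ∩ A ψ)
        ≤ ∑ ψ : Fin k ↪ Fin n, ((p n : ℝ) ^ m * (p n : ℝ) ^ m +
          ∑ U : Finset (Fin k) with U.Nonempty,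
            if ∀ i ∈ U, ψ i ∈ Finset.univ.image φ then W U else 0) :=
          Finset.sum_le_sum fun ψ _ => hψ ψ
      _ = N * ((p n : ℝ) ^ m * (p n : ℝ) ^ m) + ∑ U : Finset (Fin k) with U.Nonempty,
          #{ψ : Fin k ↪ Fin n | ∀ i ∈ U, ψ i ∈ Finset.univ.image φ} * W U := by
          rw [Finset.sum_add_distrib, Finset.sum_comm, Finset.sum_const, nsmul_eq_mul,
            Finset.card_univ]
          congr 1
          refine Finset.sum_congr rfl fun U _ => ?_
          rw [← Finset.sum_filter, Finset.sum_const, nsmul_eq_mul]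
      _ ≤ N * ((p n : ℝ) ^ m * (p n : ℝ) ^ m) + ∑ U : Finset (Fin k) with U.Nonempty,
          ((k + 1) ^ k * (Q / M)) := by
          refine add_le_add_right (Finset.sum_le_sum fun U hU => ?_) _
          have hU' := (Finset.mem_filter.1 hU).2
          have h4 : #U ≤ k := by simpa using Finset.card_le_univ U
          have h5 : (#{ψ : Fin k ↪ Fin n | ∀ i ∈ U, ψ i ∈ Finset.univ.image φ} : ℝ) ≤
              (k : ℝ) ^ #U * n ^ (k - #U) := by
            have := card_embedding_forall_mem_le (Finset.univ.image φ) U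
            rw [hR] at this
            exact_mod_cast this
          -- The base k + 1 is at least 1 even for k = 0, so the exponent may be raised.
          have h6 : (k : ℝ) ^ #U ≤ (k + 1) ^ k :=
            (pow_le_pow_left₀ (by positivity) (by linarith) _).trans
              (pow_le_pow_right₀ (by linarith [Nat.cast_nonneg (α := ℝ) k]) h4)
          calc (#{ψ : Fin k ↪ Fin n | ∀ i ∈ U, ψ i ∈ Finset.univ.image φ} : ℝ) * W U
              ≤ (k : ℝ) ^ #U * n ^ (k - #U) * W U := by gcongr
            _ = (k : ℝ) ^ #U * (W U * n ^ (k - #U)) := by ring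
            _ ≤ (k + 1) ^ k * (Q / M) := by
                gcongr
                rw [le_div_iff₀ hMpos]
                exact hW U hU'
      _ ≤ N * ((p n : ℝ) ^ m * (p n : ℝ) ^ m) + 2 ^ k * ((k + 1) ^ k * (Q / M)) := by
          rw [Finset.sum_const, nsmul_eq_mul]
          gcongr
          have : #({U | U.Nonempty} : Finset (Finset (Fin k))) ≤ 2 ^ k := by
            refine (Finset.card_le_univ _).trans ?_
            simp
          exact_mod_cast this
  have hsecond := sq_sum_mul_measureReal_forall_notMem_le μ A fun _ => measurableSet_simpleGraph _
  have hdouble : ∑ φ, ∑ ψ, μ.real (A φ ∩ A ψ) ≤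
      N * (N * ((p n : ℝ) ^ m * (p n : ℝ) ^ m) + 2 ^ k * ((k + 1) ^ k * (Q / M))) := by
    refine (Finset.sum_le_sum fun φ _ => hrow φ).trans_eq ?_
    rw [Finset.sum_const, nsmul_eq_mul, Finset.card_univ]
  have hQN : Q ≤ 2 ^ k * N * ((p n : ℝ) ^ m * (p n : ℝ) ^ m) := by
    rw [hQ, mul_assoc]
    gcongr
  have hset : {G : SimpleGraph (Fin n) | ¬ ∃ φ : Fin k ↪ Fin n, ∀ e ∈ E, e.map φ ∈ G.edgeSet} =
      {G | ∀ φ, G ∉ A φ} := by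
    ext G
    simp [A]
  rw [hset]
  rw [hsum] at hsecond
  have hfin : (N * (p n : ℝ) ^ m) ^ 2 * μ.real {G | ∀ φ, G ∉ A φ} ≤
      (N * (p n : ℝ) ^ m) ^ 2 * ε := by
    calc _ ≤ N * (2 ^ k * ((k + 1) ^ k * (Q / M))) := by linarith
      _ ≤ N * (2 ^ k * ((k + 1) ^ k * (2 ^ k * N * ((p n : ℝ) ^ m * (p n : ℝ) ^ m) / M))) := by
          gcongr
      _ = (N * (p n : ℝ) ^ m) ^ 2 * (C / M) := by
          rw [hC]
          ring
      _ = (N * (p n : ℝ) ^ m) ^ 2 * ε := by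
          rw [hM]
          congr 1
          field_simp
  exact le_of_mul_le_mul_left hfin (by positivity)

end RandomGraphs

/-! ### From densities to thresholds -/

section Thresholds

open scoped Finset

/-- A power of `n` is a threshold for a game that Breaker wins on all locally sparse graphs and that
Maker wins on all graphs that contain a fixed graph of the critical density. -/
theorem isThresholdProbability_of_density {MakerWin : ∀ n : ℕ, SimpleGraph (Fin n) → Prop}
    {a b K k : ℕ} (ha : 0 < a) (hb : 0 < b) (E : Finset (Sym2 (Fin k)))
    (hE : ∀ e ∈ E, ¬ e.IsDiag)
    (hdens : ∀ U : Finset (Fin k), a * #{e ∈ E | ∀ x ∈ e, x ∈ U} ≤ b * #U)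
    (hmaker : ∀ n (G : SimpleGraph (Fin n)),
      (∃ φ : Fin k ↪ Fin n, ∀ e ∈ E, e.map φ ∈ G.edgeSet) → MakerWin n G)
    (hbreaker : ∀ n (G : SimpleGraph (Fin n)), (∀ S : Finset (Fin n), S.Nonempty → #S ≤ K →
      a * #(edgesIn G S) < b * #S) → ¬ MakerWin n G) :
    IsThresholdProbability MakerWin (fun n : ℕ => (n : ℝ) ^ (-(a / b : ℝ))) := by
  have hmono : ∀ {p : ℕ → unitInterval} {P Q : ∀ n : ℕ, SimpleGraph (Fin n) → Prop},
      (∀ n G, P n G → Q n G) → AAS p P → AAS p Q := fun hPQ hP =>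
    tendsto_of_tendsto_of_tendsto_of_le_of_le hP tendsto_const_nhds
      (fun n => MeasureTheory.measure_mono fun G hG => hPQ n G hG)
      (fun n => MeasureTheory.prob_le_one)
  -- The function q is normalised by n^a q^b = 1, so p = ω(q) and p = o(q) become n^a p^b → ∞ and
  -- n^a p^b → 0.
  have hq : ∀ n : ℕ, 1 ≤ n → (n : ℝ) ^ a * ((n : ℝ) ^ (-(a / b : ℝ))) ^ b = 1 := by
    intro n hn
    have hn0 : (0 : ℝ) < n := by exact_mod_cast hn
    have hb0 : (b : ℝ) ≠ 0 := by positivity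
    rw [← Real.rpow_natCast (_ ^ _) b, ← Real.rpow_mul hn0.le, neg_mul, div_mul_cancel₀ _ hb0,
      Real.rpow_neg hn0.le, Real.rpow_natCast]
    exact mul_inv_cancel₀ (by positivity)
  refine ⟨fun p hp => ?_, fun p hp => ?_⟩
  · refine hmono hmaker (aas_exists_embedding ha hb E hE hdens (tendsto_atTop.2 fun M => ?_))
    have hM : (0 : ℝ) < max 1 M := by positivity
    filter_upwards [hp.bound (inv_pos.2 hM), eventually_ge_atTop 1] with n hn hn1
    have hp0 : 0 ≤ (p n : ℝ) := (p n).2.1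
    rw [Real.norm_of_nonneg hp0, Real.norm_of_nonneg (by positivity),
      inv_mul_eq_div, le_div_iff₀ hM] at hn
    calc M ≤ max 1 M := le_max_right _ _
      _ ≤ max 1 M ^ b := le_self_pow₀ (le_max_left _ _) hb.ne'
      _ = (n : ℝ) ^ a * ((n : ℝ) ^ (-(a / b : ℝ)) * max 1 M) ^ b := by
          rw [mul_pow, ← mul_assoc, hq n hn1, one_mul]
      _ ≤ (n : ℝ) ^ a * (p n : ℝ) ^ b := by gcongr
  · refine hmono hbreaker (aas_forall_edgesIn_card_lt ha (Metric.tendsto_nhds.2 fun ε hε => ?_))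
    have hc : (0 : ℝ) < min 1 (ε / 2) := by positivity
    filter_upwards [hp.bound hc, eventually_ge_atTop 1] with n hn hn1
    have hp0 : 0 ≤ (p n : ℝ) := (p n).2.1
    rw [Real.norm_of_nonneg hp0, Real.norm_of_nonneg (by positivity)] at hn
    rw [Real.dist_eq, sub_zero, abs_of_nonneg (by positivity)]
    calc (n : ℝ) ^ a * (p n : ℝ) ^ b
        ≤ (n : ℝ) ^ a * (min 1 (ε / 2) * (n : ℝ) ^ (-(a / b : ℝ))) ^ b := by gcongr
      _ = min 1 (ε / 2) ^ b := by rw [mul_pow, mul_left_comm, hq n hn1, mul_one]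
      _ ≤ min 1 (ε / 2) := pow_le_of_le_one hc.le (min_le_left _ _) hb.ne'
      _ ≤ ε / 2 := min_le_right _ _
      _ < ε := half_lt_self hε

/-- The critical graph has 9 edges on 5 vertices. The kernel checks that no vertex subset is denser
than 9/5. -/
theorem isThresholdProbability_triangleGame :
    IsThresholdProbability (fun _ G => TriangleGameMakerWin G)
      (fun n : ℕ => (n : ℝ) ^ (-(5 / 9 : ℝ))) := by
  simpa using isThresholdProbability_of_density (MakerWin := fun _ G => TriangleGameMakerWin G)
    (a := 5) (b := 9) (by norm_num) (by norm_num) nearlyComplete (by decide) (by decide +kernel)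
    (fun _ _ ⟨φ, hφ⟩ => triangleGameMakerWin_of_nearlyComplete φ hφ)
    (fun _ G hG => not_triangleGameMakerWin G hG)

/-- The critical graph has 15 edges on 8 vertices, and again all vertex subsets are checked by
evaluation. -/
theorem isThresholdProbability_cyclicGame :
    IsThresholdProbability (fun _ G => TournamentGameMakerWin cyclicTriangle G)
      (fun n : ℕ => (n : ℝ) ^ (-(8 / 15 : ℝ))) := by
  simpa using isThresholdProbability_of_density
    (MakerWin := fun _ G => TournamentGameMakerWin cyclicTriangle G)
    (a := 8) (b := 15) (by norm_num) (by norm_num) doubleWheel (by decide) (by decide +kernel)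
    (fun _ _ ⟨φ, hφ⟩ => cyclicGameMakerWin_of_doubleWheel φ hφ)
    (fun _ G hG => not_cyclicGameMakerWin G hG)

end Thresholds
end MakerBreaker

theorem theorem3 :
    MakerBreaker.IsThresholdProbability
      (fun _ G => MakerBreaker.TournamentGameMakerWin MakerBreaker.acyclicTriangle G)
      (fun n : ℕ => (n : ℝ) ^ (-(5 / 9 : ℝ))) ∧
    MakerBreaker.IsThresholdProbability
      (fun _ G => MakerBreaker.TriangleGameMakerWin G)
      (fun n : ℕ => (n : ℝ) ^ (-(5 / 9 : ℝ))) ∧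
    MakerBreaker.IsThresholdProbability
      (fun _ G => MakerBreaker.TournamentGameMakerWin MakerBreaker.cyclicTriangle G)
      (fun n : ℕ => (n : ℝ) ^ (-(8 / 15 : ℝ))) := by
  refine ⟨?_, MakerBreaker.isThresholdProbability_triangleGame,
    MakerBreaker.isThresholdProbability_cyclicGame⟩
  simpa only [MakerBreaker.acyclic_makerWin_iff] using
    MakerBreaker.isThresholdProbability_triangleGame
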